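/- Let $M$ be a $C^\infty$ manifold (Hausdorff, paracompact, of constant dimension, not necessarily compact, possibly with boundary). Let $B\subset M$ be a compact proper submanifold, i.e. $\partial B=B\cap\partial M$ and this intersection is transversal; connected components of $B$ may have distinct dimensions. Let $p:E\to B$ be a regular neighborhood of $B$ in $M$: $E$ is an open neighborhood of $B$ in $M$ and $p$ is a $C^\infty$ retraction equipped with the structure of a $C^\infty$ vector bundle (of locally constant rank) whose zero section is $B$. Let $\mathrm{Diff}_{inv}(M,B)$ be the group of $C^\infty$ diffeomorphisms $h$ of $M$ with $h(B)=B$, and $\mathrm{Diff}_{fix}(M,B)$ its subgroup of those $h$ with $h(x)=x$ for all $x\in B$. Let $\mathrm{Diff}^{lin}_{inv}(M,B)$ be the group of those $h\in\mathrm{Diff}_{inv}(M,B)$ for which there are a $C^\infty$ vector bundle isomorphism $\hat h:E\to E$ (a diffeomorphism of $E$ mapping every fiber linearly and isomorphically onto some fiber) and an open neighborhood $U_h$ of $B$ in $E$ such that $h|_{U_h}=\hat h|_{U_h}$, and put $\mathrm{Diff}^{lin}_{fix}(M,B)=\mathrm{Diff}_{fix}(M,B)\cap\mathrm{Diff}^{lin}_{inv}(M,B)$.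 Then the inclusion of pairs $$\bigl(\mathrm{Diff}^{lin}_{fix}(M,B),\ \mathrm{Diff}^{lin}_{inv}(M,B)\bigr)\subset\bigl(\mathrm{Diff}_{fix}(M,B),\ \mathrm{Diff}_{inv}(M,B)\bigr)$$ is a homotopy equivalence of pairs (there is a continuous map of pairs in the opposite direction such that both compositions are homotopic to the identity through maps of pairs) when all the groups carry the topology induced from the weak Whitney $C^\infty$ topology on $C^\infty(M,M)$, and also when they all carry the topology induced from the strong one. Here the weak (resp. strong) $C^\infty$ topology is the one generated by the union over finite $r$ of the weak (resp. strong) Whitney $C^r$ topologies. -/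

import Mathlib

open Set Topology
open scoped Manifold ContDiff

universe u

/-! ### Manifolds with (possibly empty) boundary -/

/-- The model `I` is either a whole vector space (`ℓ = 0`) or a closed half-space (`ℓ ≠ 0`).
A manifold over such a model is a manifold which may have a boundary, but no corners. -/
def IsHalfSpaceModel {E : Type*} [NormedAddCommGroup E] [NormedSpace ℝ E]
    {H : Type*} [TopologicalSpace H] (I : ModelWithCorners ℝ E H) : Prop :=
  ∃ ℓ : E →L[ℝ] ℝ, range I = {x | 0 ≤ ℓ x}

/-! ### Weak and strong Whitney topologies -/

section Whitney

variable {E : Type*} [NormedAddCommGroup E] [NormedSpace ℝ E]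
  {H : Type*} [TopologicalSpace H] (I : ModelWithCorners ℝ E H)
  {M : Type u} [TopologicalSpace M] [ChartedSpace H M]
  {E' : Type*} [NormedAddCommGroup E'] [NormedSpace ℝ E']
  {H' : Type*} [TopologicalSpace H'] (J : ModelWithCorners ℝ E' H')
  {N : Type*} [TopologicalSpace N] [ChartedSpace H' N]

/-- The expression `ψ ∘ f ∘ φ⁻¹` of a map `f : M → N` in charts `φ` of `M` and `ψ` of `N`. -/
noncomputable def localRep (φ : OpenPartialHomeomorph M H) (ψ : OpenPartialHomeomorph N H')
    (f : M → N) : E → E' :=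
  fun y => ψ.extend J (f ((φ.extend I).symm y))

/-- The set of smooth maps `g` such that `g(K)` lies in the chart `ψ` and, in the charts
`φ`, `ψ`, all derivatives of `g` of orders `0, …, r` are `ε`-close to those of `f` on `K`. -/
def whitneyNhd (r : ℕ) (φ : OpenPartialHomeomorph M H) (ψ : OpenPartialHomeomorph N H')
    (K : Set M) (ε : ℝ) (f : C^∞⟮I, M; J, N⟯) : Set C^∞⟮I, M; J, N⟯ :=
  {g | MapsTo g K ψ.source ∧ ∀ x ∈ K, ∀ k ≤ r,
    ‖iteratedFDerivWithin ℝ k (localRep I J φ ψ g) (range I) (φ.extend I x) -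
      iteratedFDerivWithin ℝ k (localRep I J φ ψ f) (range I) (φ.extend I x)‖ < ε}

/-- `(φ, ψ, K, ε)` is admissible for `f`: `φ`, `ψ` are smooth charts, `K` is a compact subset of
the domain of `φ`, `f(K)` lies in the domain of `ψ`, and `ε > 0`. -/
def IsWhitneyDatum (φ : OpenPartialHomeomorph M H) (ψ : OpenPartialHomeomorph N H')
    (K : Set M) (ε : ℝ) (f : C^∞⟮I, M; J, N⟯) : Prop :=
  φ ∈ IsManifold.maximalAtlas I ∞ M ∧ ψ ∈ IsManifold.maximalAtlas J ∞ N ∧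
    IsCompact K ∧ K ⊆ φ.source ∧ MapsTo f K ψ.source ∧ 0 < ε

variable (M N)

/-- The weak `C^r` Whitney topology on `C^∞(M, N)`, for finite `r`. -/
@[reducible] noncomputable def weakWhitney (r : ℕ) : TopologicalSpace C^∞⟮I, M; J, N⟯ :=
  TopologicalSpace.generateFrom
    {S | ∃ (f : C^∞⟮I, M; J, N⟯) (φ : OpenPartialHomeomorph M H)
        (ψ : OpenPartialHomeomorph N H') (K : Set M) (ε : ℝ),
      IsWhitneyDatum I J φ ψ K ε f ∧ S = whitneyNhd I J r φ ψ K ε f}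

/-- The strong `C^r` Whitney topology on `C^∞(M, N)`, for finite `r`: a basic open set is given
by an arbitrary locally finite family of charts of `M`, with a compact set inside each of them,
charts of `N` and positive numbers. -/
@[reducible] noncomputable def strongWhitney (r : ℕ) : TopologicalSpace C^∞⟮I, M; J, N⟯ :=
  TopologicalSpace.generateFrom
    {S | ∃ (f : C^∞⟮I, M; J, N⟯) (ι : Type u) (φ : ι → OpenPartialHomeomorph M H)
        (ψ : ι → OpenPartialHomeomorph N H') (K : ι → Set M) (ε : ι → ℝ),
      LocallyFinite (fun i => (φ i).source) ∧
      (∀ i, IsWhitneyDatum I J (φ i) (ψ i) (K i) (ε i) f) ∧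
      S = ⋂ i, whitneyNhd I J r (φ i) (ψ i) (K i) (ε i) f}

/-- The weak `C^∞` Whitney topology: it is generated by the union over finite `r` of the weak
`C^r` topologies (`⨅` in Mathlib's order on topologies). -/
@[reducible] noncomputable def weakWhitneyInfty : TopologicalSpace C^∞⟮I, M; J, N⟯ :=
  ⨅ r : ℕ, weakWhitney I M J N r

/-- The strong `C^∞` Whitney topology: it is generated by the union over finite `r` of the
strong `C^r` topologies. -/
@[reducible] noncomputable def strongWhitneyInfty : TopologicalSpace C^∞⟮I, M; J, N⟯ :=
  ⨅ r : ℕ, strongWhitney I M J N r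

/-- The weak `C^∞` topology on the set of diffeomorphisms of `M`, as a subset of
`C^∞(M, M)`. -/
@[reducible] noncomputable def weakDiffTopology : TopologicalSpace (M ≃ₘ⟮I, I⟯ M) :=
  (weakWhitneyInfty I M I M).induced Diffeomorph.toContMDiffMap

/-- The strong `C^∞` topology on the set of diffeomorphisms of `M`, as a subset of
`C^∞(M, M)`. -/
@[reducible] noncomputable def strongDiffTopology : TopologicalSpace (M ≃ₘ⟮I, I⟯ M) :=
  (strongWhitneyInfty I M I M).induced Diffeomorph.toContMDiffMap

end Whitney

/-! ### Homotopy equivalences of pairs -/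

/-- A map of pairs `f : (X, A) → (Y, B)` is a homotopy equivalence of pairs: there is a map of
pairs `g : (Y, B) → (X, A)` such that `g ∘ f` and `f ∘ g` are homotopic to the identities through
maps of pairs. -/
def IsHomotopyEquivOfPairs {X Y : Type*} [TopologicalSpace X] [TopologicalSpace Y]
    (A : Set X) (B : Set Y) (f : C(X, Y)) : Prop :=
  MapsTo f A B ∧ ∃ g : C(Y, X), MapsTo g B A ∧
    (g.comp f).HomotopicWith (ContinuousMap.id X) (fun k => MapsTo k A A) ∧
    (f.comp g).HomotopicWith (ContinuousMap.id Y) (fun k => MapsTo k B B)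

/-- For subsets of a set `D` with topology `τ`: `(A', X')` and `(A, X)` are pairs,
`A' ⊆ A`, `X' ⊆ X`, and, for the subspace topologies, the inclusion of pairs
`(A', X') ⊆ (A, X)` is a homotopy equivalence of pairs. -/
def InclusionOfPairsIsHomotopyEquiv {D : Type*} (τ : TopologicalSpace D)
    (A' X' A X : Set D) : Prop :=
  A' ⊆ X' ∧ A ⊆ X ∧ A' ⊆ A ∧ ∃ h : X' ⊆ X,
    IsHomotopyEquivOfPairs (X := X') (Y := X) ((↑) ⁻¹' A') ((↑) ⁻¹' A)
      ⟨inclusion h, continuous_inclusion h⟩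

/-! ### Proper submanifolds and their regular neighborhoods -/

section Submanifold

variable {E : Type*} [NormedAddCommGroup E] [NormedSpace ℝ E]
  {H : Type*} [TopologicalSpace H] (I : ModelWithCorners ℝ E H)
  {M : Type*} [TopologicalSpace M] [ChartedSpace H M]

/-- `B` is a proper (neat) embedded submanifold of `M`: near each of its points, in a suitable
smooth chart of `M`, `B` is the part of an affine subspace `L` lying in the image of the chart
(an open subset of the model half-space), where `L` meets the interior of the half-space.

At a point of `∂M` the last condition says that `L` is transversal to the boundary hyperplane,
so that `B` is near that point a manifold with boundary `B ∩ ∂M`, transversal to `∂M`. At an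
interior point of `M` it holds automatically and `B` has no boundary there. The dimension of `L`
may depend on the point, so connected components of `B` may have distinct dimensions. -/
def IsProperSubmanifold (B : Set M) : Prop :=
  ∀ b ∈ B, ∃ φ ∈ IsManifold.maximalAtlas I ∞ M, ∃ L : AffineSubspace ℝ E,
    b ∈ φ.source ∧
    φ.extend I '' (φ.source ∩ B) = (φ.extend I).target ∩ (L : Set E) ∧
    ((L : Set E) ∩ interior (range I)).Nonempty

/-- The fiber over `b` of a map `p` defined on a set `U`. -/
abbrev Fiber (U : Set M) (p : M → M) (b : M) : Type _ :=
  {x : M // x ∈ U ∧ p x = b}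

/-- A regular neighborhood of `B` in `M`: an open neighborhood `carrier` of `B` (only the values
of `proj` there matter) with a smooth retraction `proj` of it onto `B` and a structure of a smooth
vector bundle on this retraction, having `B` as its zero section. That is, the fibers are real
vector spaces, and each point of `B` has an open neighborhood `B ∩ W` in `B` with a diffeomorphism
`x ↦ (proj x, τ x)` of `proj⁻¹(B ∩ W)` onto `(B ∩ W) × ℝᵏ`, with inverse `σ`, which is linear on
the fibers. The rank `k` may be distinct over distinct components of `B`. -/
structure RegularNeighborhood (B : Set M) where
  carrier : Set M
  proj : M → M
  isOpen_carrier : IsOpen carrier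
  subset_carrier : B ⊆ carrier
  contMDiffOn_proj : ContMDiffOn I I ∞ proj carrier
  mapsTo_proj : MapsTo proj carrier B
  proj_eq_self : ∀ b ∈ B, proj b = b
  addCommGroupFiber : ∀ b : B, AddCommGroup (Fiber carrier proj (b : M))
  moduleFiber : ∀ b : B, Module ℝ (Fiber carrier proj (b : M))
  zero_fiber : ∀ b : B, ((0 : Fiber carrier proj (b : M)) : M) = b
  locally_trivial : ∀ b ∈ B, ∃ (k : ℕ) (W : Set M)
    (τ : M → EuclideanSpace ℝ (Fin k)) (σ : M × EuclideanSpace ℝ (Fin k) → M),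
    IsOpen W ∧ b ∈ W ∧
    ContMDiffOn I 𝓘(ℝ, EuclideanSpace ℝ (Fin k)) ∞ τ (carrier ∩ proj ⁻¹' W) ∧
    ContMDiffOn (I.prod 𝓘(ℝ, EuclideanSpace ℝ (Fin k))) I ∞ σ ((B ∩ W) ×ˢ univ) ∧
    ∀ c : B, (c : M) ∈ W →
      ∃ T : Fiber carrier proj (c : M) ≃ₗ[ℝ] EuclideanSpace ℝ (Fin k),
        (∀ x, T x = τ x) ∧ (∀ v, (T.symm v : M) = σ ((c : M), v))

attribute [instance] RegularNeighborhood.addCommGroupFiber RegularNeighborhood.moduleFiber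

variable {I}

/-- (The restriction to `carrier` of) `g` is a smooth vector bundle isomorphism of the regular
neighborhood onto itself: a diffeomorphism of the total space that maps each fiber linearly
and isomorphically onto some fiber. -/
def RegularNeighborhood.IsBundleIso {B : Set M} (R : RegularNeighborhood I B)
    (g : M → M) : Prop :=
  BijOn g R.carrier R.carrier ∧
  ContMDiffOn I I ∞ g R.carrier ∧
  (∃ g' : M → M, InvOn g' g R.carrier R.carrier ∧ ContMDiffOn I I ∞ g' R.carrier) ∧
  ∀ b : B, ∃ (c : B) (T : Fiber R.carrier R.proj (b : M) ≃ₗ[ℝ] Fiber R.carrier R.proj (c : M)),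
    ∀ x, (T x : M) = g x

/-! ### Groups of diffeomorphisms -/

variable (I)

/-- Diffeomorphisms `h` of `M` with `h(B) = B`. -/
def DiffInv (B : Set M) : Set (M ≃ₘ⟮I, I⟯ M) :=
  {h | h '' B = B}

/-- Diffeomorphisms of `M` fixed on `B`. -/
def DiffFix (B : Set M) : Set (M ≃ₘ⟮I, I⟯ M) :=
  {h | ∀ b ∈ B, h b = b}

variable {I}

/-- Diffeomorphisms of `M` leaving `B` invariant which coincide, on some open neighborhood of
`B` in the regular neighborhood, with a vector bundle isomorphism of the latter. -/
def DiffInvLin {B : Set M} (R : RegularNeighborhood I B) : Set (M ≃ₘ⟮I, I⟯ M) :=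
  {h | h ∈ DiffInv I B ∧ ∃ g : M → M, R.IsBundleIso g ∧
    ∃ U : Set M, IsOpen U ∧ B ⊆ U ∧ U ⊆ R.carrier ∧ EqOn h g U}

/-- Diffeomorphisms of `M` fixed on `B` which coincide near `B` with a vector bundle
isomorphism of the regular neighborhood. -/
def DiffFixLin {B : Set M} (R : RegularNeighborhood I B) : Set (M ≃ₘ⟮I, I⟯ M) :=
  DiffFix I B ∩ DiffInvLin R

end Submanifold

open Filter
set_option linter.unusedSectionVars false

section SmoothFamily

variable {Λ Λ' E F G : Type*} [TopologicalSpace Λ] [TopologicalSpace Λ']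
  [NormedAddCommGroup E] [NormedSpace ℝ E] [NormedAddCommGroup F] [NormedSpace ℝ F]
  [NormedAddCommGroup G] [NormedSpace ℝ G]

/-- A family of maps which are smooth within `S` near `x`, for parameters near `l`, and all of
whose derivatives are jointly continuous at `(l, x)` in the parameter and the variable. -/
structure SmoothFamilyWithinAt (f : Λ → E → F) (S : Set E) (l : Λ) (x : E) : Prop where
  smooth : ∀ᶠ q : Λ × E in 𝓝 l ×ˢ 𝓝[S] x, ContDiffWithinAt ℝ ∞ (f q.1) S q.2
  tendsto : ∀ k : ℕ, Tendsto (fun q : Λ × E => iteratedFDerivWithin ℝ k (f q.1) S q.2)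
    (𝓝 l ×ˢ 𝓝[S] x) (𝓝 (iteratedFDerivWithin ℝ k (f l) S x))

theorem prod_nhdsWithin_eq (S : Set E) (l : Λ) (x : E) :
    𝓝 l ×ˢ 𝓝[S] x = 𝓝[univ ×ˢ S] (l, x) := by
  rw [nhdsWithin_prod_eq, nhdsWithin_univ]

theorem Filter.Eventually.self_of_prod_nhdsWithin {S : Set E} {l : Λ} {x : E} {P : Λ × E → Prop}
    (h : ∀ᶠ q in 𝓝 l ×ˢ 𝓝[S] x, P q) (hx : x ∈ S) : P (l, x) := by
  rw [prod_nhdsWithin_eq] at h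
  exact h.self_of_nhdsWithin ⟨mem_univ _, hx⟩

theorem Filter.Eventually.eventually_prod_nhdsWithin {S : Set E} {l : Λ} {x : E}
    {P : Λ × E → Prop} (h : ∀ᶠ q in 𝓝 l ×ˢ 𝓝[S] x, P q) :
    ∀ᶠ q in 𝓝 l ×ˢ 𝓝[S] x, ∀ᶠ r in 𝓝 q.1 ×ˢ 𝓝[S] q.2, P r := by
  simp_rw [prod_nhdsWithin_eq] at h ⊢
  exact eventually_eventually_nhdsWithin.2 h

theorem Filter.Eventually.slice_prod_nhdsWithin {S : Set E} {l : Λ} {x : E}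
    {P : Λ × E → Prop} (h : ∀ᶠ q in 𝓝 l ×ˢ 𝓝[S] x, P q) : ∀ᶠ y in 𝓝[S] x, P (l, y) := by
  have : Tendsto (fun y => (l, y)) (𝓝[S] x) (𝓝 l ×ˢ 𝓝[S] x) :=
    tendsto_const_nhds.prodMk tendsto_id
  exact this.eventually h

theorem Filter.Eventually.slices_prod_nhdsWithin {S : Set E} {l : Λ} {x : E}
    {P : Λ × E → Prop} (h : ∀ᶠ q in 𝓝 l ×ˢ 𝓝[S] x, P q) :
    ∀ᶠ q in 𝓝 l ×ˢ 𝓝[S] x, ∀ᶠ y in 𝓝[S] q.2, P (q.1, y) :=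
  h.eventually_prod_nhdsWithin.mono fun _ hq => hq.slice_prod_nhdsWithin

theorem eventually_mem_prod_nhdsWithin {S : Set E} {l : Λ} {x : E} :
    ∀ᶠ q : Λ × E in 𝓝 l ×ˢ 𝓝[S] x, q.2 ∈ S :=
  tendsto_snd.eventually self_mem_nhdsWithin

theorem FormalMultilinearSeries.tendsto_taylorComp {α : Type*} {A : Filter α}
    {q : α → FormalMultilinearSeries ℝ F G} {q₀ : FormalMultilinearSeries ℝ F G}
    {p : α → FormalMultilinearSeries ℝ E F} {p₀ : FormalMultilinearSeries ℝ E F}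
    (hq : ∀ k, Tendsto (fun a => q a k) A (𝓝 (q₀ k)))
    (hp : ∀ k, Tendsto (fun a => p a k) A (𝓝 (p₀ k))) (n : ℕ) :
    Tendsto (fun a => (q a).taylorComp (p a) n) A (𝓝 (q₀.taylorComp p₀ n)) := by
  rw [tendsto_iff_norm_sub_tendsto_zero, ← Asymptotics.isLittleO_one_iff ℝ,
    Asymptotics.isLittleO_norm_left]
  refine FormalMultilinearSeries.taylorComp_sub_taylorComp_isLittleO
    (p₂ := fun _ => q₀) (q₂ := fun _ => p₀) (fun k _ => ?_) (fun k _ => ?_) (fun k _ => ?_)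
    (fun k _ => ?_) (fun k _ => ?_)
  · exact (hq k).norm.isBoundedUnder_le
  · rw [Asymptotics.isLittleO_one_iff]
    simpa using (hq k).sub_const (q₀ k)
  · exact (hp k).norm.isBoundedUnder_le
  · exact (tendsto_const_nhds (x := ‖p₀ k‖)).isBoundedUnder_le
  · rw [Asymptotics.isLittleO_one_iff]
    simpa using (hp k).sub_const (p₀ k)

namespace SmoothFamilyWithinAt

variable {f : Λ → E → F} {S : Set E} {l : Λ} {x : E}

protected theorem congr {g : Λ → E → F} (hf : SmoothFamilyWithinAt f S l x) (hx : x ∈ S)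
    (h : ∀ᶠ q : Λ × E in 𝓝 l ×ˢ 𝓝[S] x, g q.1 q.2 = f q.1 q.2) :
    SmoothFamilyWithinAt g S l x := by
  have key : ∀ᶠ q : Λ × E in 𝓝 l ×ˢ 𝓝[S] x, g q.1 =ᶠ[𝓝[S] q.2] f q.1 ∧ g q.1 q.2 = f q.1 q.2 :=
    h.slices_prod_nhdsWithin.and h
  refine ⟨?_, fun k => ?_⟩
  · filter_upwards [key, hf.smooth] with q hq hs using hs.congr_of_eventuallyEq hq.1 hq.2
  · have h0 := key.self_of_prod_nhdsWithin hx
    rw [h0.1.iteratedFDerivWithin_eq h0.2 k]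
    refine (hf.tendsto k).congr' ?_
    filter_upwards [key] with q hq using (hq.1.iteratedFDerivWithin_eq hq.2 k).symm

theorem smoothAt (hf : SmoothFamilyWithinAt f S l x) (hx : x ∈ S) :
    ContDiffWithinAt ℝ ∞ (f l) S x :=
  hf.smooth.self_of_prod_nhdsWithin hx

theorem tendsto_apply (hf : SmoothFamilyWithinAt f S l x) :
    Tendsto (fun q : Λ × E => f q.1 q.2) (𝓝 l ×ˢ 𝓝[S] x) (𝓝 (f l x)) := by
  have := (hf.tendsto 0)
  have h2 := ((continuousMultilinearCurryFin0 ℝ E F).continuous.tendsto _).comp this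
  simpa [Function.comp_def, iteratedFDerivWithin_zero_eq_comp] using h2

theorem of_contDiffWithinAt {g : E → F} (hx : x ∈ S) (hS : UniqueDiffOn ℝ S)
    (h : ∀ᶠ y in 𝓝[S] x, ContDiffWithinAt ℝ ∞ g S y) (l : Λ) :
    SmoothFamilyWithinAt (fun _ : Λ => g) S l x := by
  refine ⟨tendsto_snd.eventually h, fun k => ?_⟩
  have h0 : ContDiffWithinAt ℝ ∞ g S x := h.self_of_nhdsWithin hx
  have : ContinuousWithinAt (iteratedFDerivWithin ℝ k g S) S x :=
    (h0.iteratedFDerivWithin_right (m := 0) hS (by simpa using mod_cast le_top) hx).continuousWithinAt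
  exact this.tendsto.comp tendsto_snd

theorem of_contDiff {g : E → F} (hx : x ∈ S) (hS : UniqueDiffOn ℝ S) (h : ContDiff ℝ ∞ g) (l : Λ) :
    SmoothFamilyWithinAt (fun _ : Λ => g) S l x :=
  of_contDiffWithinAt hx hS (.of_forall fun _ => h.contDiffWithinAt) l

theorem of_parameter {c : Λ → F} (hc : ContinuousAt c l) (S : Set E) (x : E) :
    SmoothFamilyWithinAt (fun l (_ : E) => c l) S l x := by
  refine ⟨.of_forall fun _ => contDiffWithinAt_const, fun k => ?_⟩
  rcases eq_or_ne k 0 with rfl | hk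
  · have : Tendsto (fun q : Λ × E => (continuousMultilinearCurryFin0 ℝ E F).symm (c q.1))
        (𝓝 l ×ˢ 𝓝[S] x) (𝓝 ((continuousMultilinearCurryFin0 ℝ E F).symm (c l))) :=
      ((continuousMultilinearCurryFin0 ℝ E F).symm.continuous.tendsto _).comp
        (hc.tendsto.comp tendsto_fst)
    simpa [iteratedFDerivWithin_zero_eq_comp, Function.comp_def] using this
  · simp only [iteratedFDerivWithin_const_of_ne hk]
    exact tendsto_const_nhds

theorem comp_parameter {c : Λ' → Λ} {l' : Λ'} (hc : ContinuousAt c l')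
    (hf : SmoothFamilyWithinAt f S (c l') x) : SmoothFamilyWithinAt (fun l => f (c l)) S l' x := by
  have : Tendsto (fun q : Λ' × E => (c q.1, q.2)) (𝓝 l' ×ˢ 𝓝[S] x) (𝓝 (c l') ×ˢ 𝓝[S] x) :=
    hc.tendsto.prodMap tendsto_id
  exact ⟨this.eventually hf.smooth, fun k => (hf.tendsto k).comp this⟩

theorem tendsto_prodMk {T : Set F} (hf : SmoothFamilyWithinAt f S l x)
    (hT : ∀ᶠ q : Λ × E in 𝓝 l ×ˢ 𝓝[S] x, f q.1 q.2 ∈ T) :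
    Tendsto (fun q : Λ × E => (q.1, f q.1 q.2)) (𝓝 l ×ˢ 𝓝[S] x) (𝓝 l ×ˢ 𝓝[T] (f l x)) :=
  tendsto_fst.prodMk (tendsto_nhdsWithin_iff.2 ⟨hf.tendsto_apply, hT⟩)

protected theorem comp {g : Λ → F → G} {T : Set F} (hg : SmoothFamilyWithinAt g T l (f l x))
    (hf : SmoothFamilyWithinAt f S l x) (hS : UniqueDiffOn ℝ S) (hT : UniqueDiffOn ℝ T)
    (hx : x ∈ S) (hST : ∀ᶠ q : Λ × E in 𝓝 l ×ˢ 𝓝[S] x, f q.1 q.2 ∈ T) :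
    SmoothFamilyWithinAt (fun l y => g l (f l y)) S l x := by
  have h1 := hf.tendsto_prodMk hST
  have key : ∀ᶠ q : Λ × E in 𝓝 l ×ˢ 𝓝[S] x, q.2 ∈ S ∧ ContDiffWithinAt ℝ ∞ (g q.1) T (f q.1 q.2) ∧
      ContDiffWithinAt ℝ ∞ (f q.1) S q.2 ∧ ∀ᶠ y in 𝓝[S] q.2, f q.1 y ∈ T := by
    filter_upwards [eventually_mem_prod_nhdsWithin, h1.eventually hg.smooth, hf.smooth,
      hST.slices_prod_nhdsWithin] with q a b c d using ⟨a, b, c, d⟩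
  refine ⟨?_, fun k => ?_⟩
  · filter_upwards [key] with q hq
    exact hq.2.1.comp_of_preimage_mem_nhdsWithin _ hq.2.2.1 hq.2.2.2
  · have e : ∀ᶠ q : Λ × E in 𝓝 l ×ˢ 𝓝[S] x,
        iteratedFDerivWithin ℝ k (fun y => g q.1 (f q.1 y)) S q.2 =
        (ftaylorSeriesWithin ℝ (g q.1) T (f q.1 q.2)).taylorComp
          (ftaylorSeriesWithin ℝ (f q.1) S q.2) k := by
      filter_upwards [key] with q hq
      exact iteratedFDerivWithin_comp_of_eventually_mem hq.2.1 hq.2.2.1 hT hS hq.1 hq.2.2.2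
        (mod_cast le_top)
    rw [e.self_of_prod_nhdsWithin hx]
    refine Tendsto.congr' (e.mono fun q hq => hq.symm) ?_
    exact FormalMultilinearSeries.tendsto_taylorComp (fun k => (hg.tendsto k).comp h1)
      (fun k => hf.tendsto k) k

theorem comp_contDiff {g : F → G} (hg : ContDiff ℝ ∞ g)
    (hf : SmoothFamilyWithinAt f S l x) (hS : UniqueDiffOn ℝ S) (hx : x ∈ S) :
    SmoothFamilyWithinAt (fun l y => g (f l y)) S l x :=
  SmoothFamilyWithinAt.comp (T := univ) (of_contDiff (mem_univ _) uniqueDiffOn_univ hg l) hf hS uniqueDiffOn_univ hx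
    (.of_forall fun _ => mem_univ _)

protected theorem prodMk {g : Λ → E → G} (hf : SmoothFamilyWithinAt f S l x)
    (hg : SmoothFamilyWithinAt g S l x) (hS : UniqueDiffOn ℝ S) (hx : x ∈ S) :
    SmoothFamilyWithinAt (fun l y => (f l y, g l y)) S l x := by
  have key : ∀ᶠ q : Λ × E in 𝓝 l ×ˢ 𝓝[S] x, q.2 ∈ S ∧ ContDiffWithinAt ℝ ∞ (f q.1) S q.2 ∧
      ContDiffWithinAt ℝ ∞ (g q.1) S q.2 := by
    filter_upwards [eventually_mem_prod_nhdsWithin, hf.smooth, hg.smooth] with q a b c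
      using ⟨a, b, c⟩
  refine ⟨?_, fun k => ?_⟩
  · filter_upwards [key] with q hq using hq.2.1.prodMk hq.2.2
  · have e : ∀ᶠ q : Λ × E in 𝓝 l ×ˢ 𝓝[S] x,
        iteratedFDerivWithin ℝ k (fun y => (f q.1 y, g q.1 y)) S q.2 =
        (iteratedFDerivWithin ℝ k (f q.1) S q.2).prod (iteratedFDerivWithin ℝ k (g q.1) S q.2) := by
      filter_upwards [key] with q hq
      exact iteratedFDerivWithin_prodMk hq.2.1 hq.2.2 hS hq.1 (mod_cast le_top)
    rw [e.self_of_prod_nhdsWithin hx]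
    refine Tendsto.congr' (e.mono fun q hq => hq.symm) ?_
    exact ((ContinuousMultilinearMap.prodL ℝ (fun _ : Fin k => E) F G).continuous.tendsto
      (_, _)).comp ((hf.tendsto k).prodMk_nhds (hg.tendsto k))

/-- The derivatives of a smooth family form a smooth family. -/
protected theorem fderivWithin (hf : SmoothFamilyWithinAt f S l x) (hS : UniqueDiffOn ℝ S) (hx : x ∈ S) :
    SmoothFamilyWithinAt (fun l => fderivWithin ℝ (f l) S) S l x := by
  refine ⟨?_, fun k => ?_⟩
  · filter_upwards [eventually_mem_prod_nhdsWithin, hf.smooth] with q hq hs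
    exact hs.fderivWithin_right hS le_rfl hq
  · have e : ∀ q : Λ × E, q.2 ∈ S → iteratedFDerivWithin ℝ k (fderivWithin ℝ (f q.1) S) S q.2
        = continuousMultilinearCurryRightEquiv' ℝ k E F
          (iteratedFDerivWithin ℝ (k + 1) (f q.1) S q.2) := by
      intro q hq
      rw [iteratedFDerivWithin_succ_eq_comp_right hS hq]
      simp
    rw [e (l, x) hx]
    refine Tendsto.congr' (eventually_mem_prod_nhdsWithin.mono fun q hq => (e q hq).symm) ?_
    exact ((continuousMultilinearCurryRightEquiv' ℝ k E F).continuous.tendsto _).comp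
      (hf.tendsto (k + 1))

end SmoothFamilyWithinAt

end SmoothFamily

section ParametricIntegral

variable {Λ E F : Type*} [TopologicalSpace Λ]
  [NormedAddCommGroup E] [NormedSpace ℝ E] [NormedAddCommGroup F] [NormedSpace ℝ F]

theorem IsCompact.eventually_forall_of_forall_prod {α Y : Type*} [TopologicalSpace Y] {K : Set Y}
    (hK : IsCompact K) {A : Filter α} {P : α × Y → Prop}
    (h : ∀ y ∈ K, ∀ᶠ q in A ×ˢ 𝓝[K] y, P q) : ∀ᶠ a in A, ∀ y ∈ K, P (a, y) := by
  have h' : ∀ y ∈ K, ∀ᶠ q in A ×ˢ 𝓝 y, q.2 ∈ K → P q := by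
    intro y hy
    obtain ⟨p, hp, r, hr, hpr⟩ := eventually_prod_iff.1 (h y hy)
    exact eventually_prod_iff.2 ⟨p, hp, _, eventually_nhdsWithin_iff.1 hr,
      fun ha _ hb hbK => hpr ha (hb hbK)⟩
  obtain ⟨p, hp, r, hr, hpr⟩ := eventually_prod_iff.1 (hK.mem_prod_nhdsSet_of_forall h')
  exact hp.mono fun a ha y hy => hpr ha (subset_of_mem_nhdsSet hr hy) hy

/-- Differentiation of an integral depending on a parameter in a convex set. -/
theorem hasFDerivWithinAt_intervalIntegral_of_continuousOn
    {φ : ℝ → E → F} {φ' : ℝ → E → E →L[ℝ] F} {V : Set E} (hV : Convex ℝ V)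
    {y : E} (hy : y ∈ V)
    (hd : ∀ s ∈ Icc (0 : ℝ) 1, ∀ z ∈ V, HasFDerivWithinAt (φ s) (φ' s z) V z)
    (hc : ∀ z ∈ V, ContinuousOn (fun s => φ s z) (Icc 0 1))
    (hc' : ContinuousOn (fun q : ℝ × E => φ' q.1 q.2) (Icc 0 1 ×ˢ V)) :
    HasFDerivWithinAt (fun z => ∫ s in (0 : ℝ)..1, φ s z) (∫ s in (0 : ℝ)..1, φ' s y) V y := by
  have hint : ∀ z ∈ V, IntervalIntegrable (fun s => φ s z) MeasureTheory.volume 0 1 := fun z hz =>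
    ContinuousOn.intervalIntegrable (by rw [uIcc_of_le zero_le_one]; exact hc z hz)
  have hint' : IntervalIntegrable (fun s => φ' s y) MeasureTheory.volume 0 1 := by
    refine ContinuousOn.intervalIntegrable ?_
    rw [uIcc_of_le zero_le_one]
    exact hc'.comp (f := fun s : ℝ => (s, y)) (by fun_prop) fun s hs => mk_mem_prod hs hy
  rw [hasFDerivWithinAt_iff_isLittleO, Asymptotics.isLittleO_iff]
  intro c hcpos
  have hunif : ∀ᶠ z in 𝓝[V] y, ∀ s ∈ Icc (0 : ℝ) 1, ‖φ' s z - φ' s y‖ ≤ c := by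
    refine isCompact_Icc.eventually_forall_of_forall_prod
      (P := fun q : E × ℝ => ‖φ' q.2 q.1 - φ' q.2 y‖ ≤ c) fun s hs => ?_
    have h1 : ContinuousWithinAt (fun q : ℝ × E => φ' q.1 q.2 - φ' q.1 y) (Icc 0 1 ×ˢ V)
        (s, y) := by
      refine (hc' _ (mk_mem_prod hs hy)).sub ?_
      exact ContinuousWithinAt.comp (x := (s, y)) (g := fun q : ℝ × E => φ' q.1 q.2)
        (f := fun q : ℝ × E => (q.1, y)) (t := Icc 0 1 ×ˢ V) (hc' (s, y) (mk_mem_prod hs hy))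
        (by fun_prop) fun q hq => mk_mem_prod hq.1 hy
    have h2 := h1.norm.tendsto.eventually_le_const (u := c) (by simpa using hcpos)
    rw [nhdsWithin_prod_eq, eventually_swap_iff] at h2
    exact h2
  obtain ⟨r, hr, hball⟩ := Metric.mem_nhdsWithin_iff.1 hunif
  have : ∀ᶠ z in 𝓝[V] y, z ∈ Metric.ball y r ∩ V :=
    inter_mem (mem_nhdsWithin_of_mem_nhds (Metric.ball_mem_nhds y hr)) self_mem_nhdsWithin
  filter_upwards [this] with z hz
  have hint2 : IntervalIntegrable (fun s => φ' s y (z - y)) MeasureTheory.volume 0 1 := by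
    refine ContinuousOn.intervalIntegrable ?_
    rw [uIcc_of_le zero_le_one]
    exact (hc'.comp (f := fun s : ℝ => (s, y)) (by fun_prop)
      fun s hs => mk_mem_prod hs hy).clm_apply continuousOn_const
  rw [ContinuousLinearMap.intervalIntegral_apply hint',
    ← intervalIntegral.integral_sub (hint z hz.2) (hint y hy),
    ← intervalIntegral.integral_sub ((hint z hz.2).sub (hint y hy)) hint2]
  refine (intervalIntegral.norm_integral_le_of_norm_le_const (C := c * ‖z - y‖) ?_).trans (by simp)
  intro s hs
  rw [uIoc_of_le zero_le_one] at hs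
  have hs' : s ∈ Icc (0 : ℝ) 1 := ⟨hs.1.le, hs.2⟩
  refine Convex.norm_image_sub_le_of_norm_hasFDerivWithin_le' (f' := φ' s)
    (s := Metric.ball y r ∩ V) (fun w hw => (hd s hs' w hw.2).mono inter_subset_right)
    (fun w hw => hball hw s hs') ((convex_ball y r).inter hV) ⟨Metric.mem_ball_self hr, hy⟩ hz

protected theorem SmoothFamilyWithinAt.intervalIntegral [CompleteSpace F] {f : Λ → ℝ → E → F} {S : Set E}
    (hS : UniqueDiffOn ℝ S) (hconv : Convex ℝ S) {l : Λ} {x : E} (hx : x ∈ S)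
    (h : ∀ s ∈ Icc (0 : ℝ) 1, ∀ᶠ q : (Λ × ℝ) × E in 𝓝 (l, s) ×ˢ 𝓝[S] x,
      SmoothFamilyWithinAt (fun p : Λ × ℝ => f p.1 p.2) S q.1 q.2) :
    SmoothFamilyWithinAt (fun l y => ∫ s in (0 : ℝ)..1, f l s y) S l x := by
  have tube : ∀ᶠ q : Λ × E in 𝓝 l ×ˢ 𝓝[S] x, ∀ s ∈ Icc (0 : ℝ) 1,
      SmoothFamilyWithinAt (fun p : Λ × ℝ => f p.1 p.2) S (q.1, s) q.2 := by
    refine isCompact_Icc.eventually_forall_of_forall_prod (P := fun q : (Λ × E) × ℝ =>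
      SmoothFamilyWithinAt (fun p : Λ × ℝ => f p.1 p.2) S (q.1.1, q.2) q.1.2) fun s hs => ?_
    have : Tendsto (fun q : (Λ × E) × ℝ => ((q.1.1, q.2), q.1.2))
        ((𝓝 l ×ˢ 𝓝[S] x) ×ˢ 𝓝[Icc 0 1] s) (𝓝 (l, s) ×ˢ 𝓝[S] x) := by
      refine Tendsto.prodMk ?_ (tendsto_snd.comp tendsto_fst)
      exact (tendsto_fst.comp tendsto_fst).prodMk_nhds
        (tendsto_snd.mono_right nhdsWithin_le_nhds)
    exact this.eventually (h s hs)
  set P : Λ → E → FormalMultilinearSeries ℝ E F := fun l y k =>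
    ∫ s in (0 : ℝ)..1, iteratedFDerivWithin ℝ k (f l s) S y with hP
  have taylor : ∀ᶠ q : Λ × E in 𝓝 l ×ˢ 𝓝[S] x, q.2 ∈ S ∧
      ContDiffWithinAt ℝ ∞ (fun y => ∫ s in (0 : ℝ)..1, f q.1 s y) S q.2 ∧
      ∀ k, iteratedFDerivWithin ℝ k (fun y => ∫ s in (0 : ℝ)..1, f q.1 s y) S q.2 =
        P q.1 q.2 k := by
    filter_upwards [tube.slices_prod_nhdsWithin, eventually_mem_prod_nhdsWithin]
      with ⟨l, x⟩ hq hx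
    obtain ⟨r, hr, hball⟩ := Metric.mem_nhdsWithin_iff.1 hq
    set V := S ∩ Metric.ball x r
    have hV : Convex ℝ V := hconv.inter (convex_ball x r)
    have hVx : x ∈ V := ⟨hx, Metric.mem_ball_self hr⟩
    have hVf : ∀ s ∈ Icc (0 : ℝ) 1, ∀ y ∈ V,
        SmoothFamilyWithinAt (fun s => f l s) S s y := fun s hs y hy =>
      (hball ⟨hy.2, hy.1⟩ s hs).comp_parameter (c := fun s => (l, s)) (by fun_prop)
    have hcont : ∀ k, ContinuousOn (fun q : ℝ × E => iteratedFDerivWithin ℝ k (f l q.1) S q.2)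
        (Icc 0 1 ×ˢ V) := by
      intro k q hq
      have := (hVf q.1 hq.1 q.2 hq.2).tendsto k
      rw [ContinuousWithinAt, nhdsWithin_prod_eq]
      exact this.mono_left (Filter.prod_mono nhdsWithin_le_nhds
        (nhdsWithin_mono _ inter_subset_left))
    have hint : ∀ k, ∀ y ∈ V, IntervalIntegrable
        (fun s => iteratedFDerivWithin ℝ k (f l s) S y) MeasureTheory.volume 0 1 := by
      intro k y hy
      refine ContinuousOn.intervalIntegrable ?_
      rw [uIcc_of_le zero_le_one]
      exact (hcont k).comp (f := fun s : ℝ => (s, y)) (by fun_prop)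
        fun s hs => mk_mem_prod hs hy
    have hderiv : ∀ k, ∀ y ∈ V, HasFDerivWithinAt (fun y => P l y k)
        (P l y (k + 1)).curryLeft V y := by
      intro k y hy
      have h1 := hasFDerivWithinAt_intervalIntegral_of_continuousOn
        (φ := fun s => iteratedFDerivWithin ℝ k (f l s) S)
        (φ' := fun s y => (iteratedFDerivWithin ℝ (k + 1) (f l s) S y).curryLeft) hV hy ?_ ?_ ?_
      · let L : (E [×(k + 1)]→L[ℝ] F) →L[ℝ] (E →L[ℝ] E [×k]→L[ℝ] F) :=
          (continuousMultilinearCurryLeftEquiv ℝ (fun _ : Fin (k + 1) =>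
            E) F).toContinuousLinearEquiv.toContinuousLinearMap
        exact h1.congr_fderiv (ContinuousLinearMap.intervalIntegral_comp_comm (𝕜 := ℝ)
          (E := E [×(k + 1)]→L[ℝ] F) (F := E →L[ℝ] E [×k]→L[ℝ] F) L (hint (k + 1) y hy))
      · intro s hs z hz
        have hz' := (hVf s hs z hz).smoothAt hz.1
        have : HasFDerivWithinAt (iteratedFDerivWithin ℝ k (f l s) S)
            (fderivWithin ℝ (iteratedFDerivWithin ℝ k (f l s) S) S z) S z :=
          (hz'.differentiableWithinAt_iteratedFDerivWithin (mod_cast WithTop.coe_lt_top k)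
            (by rwa [insert_eq_of_mem hz.1])).hasFDerivWithinAt
        exact this.mono inter_subset_left
      · intro z hz
        exact (hcont k).comp (f := fun s : ℝ => (s, z)) (by fun_prop)
          fun s hs => mk_mem_prod hs hz
      · exact (continuousMultilinearCurryLeftEquiv ℝ (fun _ : Fin (k + 1) => E)
          F).continuous.comp_continuousOn (hcont (k + 1))
    have hT : HasFTaylorSeriesUpToOn ∞ (fun y => ∫ s in (0 : ℝ)..1, f l s y) (P l) V := by
      refine ⟨fun y hy => ?_, fun k _ y hy => hderiv k y hy,
        fun k _ y hy => (hderiv k y hy).continuousWithinAt⟩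
      let L : (E [×0]→L[ℝ] F) →L[ℝ] F :=
        (continuousMultilinearCurryFin0 ℝ E F).toContinuousLinearEquiv.toContinuousLinearMap
      exact (L.intervalIntegral_comp_comm (hint 0 y hy)).symm
    have hVn : V ∈ 𝓝[S] x := inter_mem self_mem_nhdsWithin
      (mem_nhdsWithin_of_mem_nhds (Metric.ball_mem_nhds x hr))
    refine ⟨hx, ?_, fun k => ?_⟩
    · exact (hT.contDiffOn x hVx).mono_of_mem_nhdsWithin hVn
    · have := hT.eq_iteratedFDerivWithin_of_uniqueDiffOn (m := k) (mod_cast le_top)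
        (hS.inter Metric.isOpen_ball) hVx
      rw [this, iteratedFDerivWithin_inter_open Metric.isOpen_ball hVx.2]
  refine ⟨taylor.mono fun q hq => hq.2.1, fun k => ?_⟩
  rw [(taylor.self_of_prod_nhdsWithin hx).2.2 k]
  refine Tendsto.congr' (taylor.mono fun q hq => (hq.2.2 k).symm) ?_
  have hint : ∀ᶠ q : Λ × E in 𝓝 l ×ˢ 𝓝[S] x, IntervalIntegrable
      (fun s => iteratedFDerivWithin ℝ k (f q.1 s) S q.2) MeasureTheory.volume 0 1 := by
    filter_upwards [tube, eventually_mem_prod_nhdsWithin] with q hq hqS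
    refine ContinuousOn.intervalIntegrable ?_
    rw [uIcc_of_le zero_le_one]
    intro s hs
    have h1 := ((hq s hs).comp_parameter (c := fun s => (q.1, s)) (by fun_prop)).tendsto k
    have h2 : Tendsto (fun s => (s, q.2)) (𝓝[Icc 0 1] s) (𝓝 s ×ˢ 𝓝[S] q.2) :=
      (tendsto_id.mono_right nhdsWithin_le_nhds).prodMk
        ((tendsto_pure.2 (.of_forall fun _ => rfl)).mono_right (pure_le_nhdsWithin hqS))
    exact h1.comp h2
  rw [Metric.tendsto_nhds]
  intro η hη
  have hclose : ∀ᶠ q : Λ × E in 𝓝 l ×ˢ 𝓝[S] x, ∀ s ∈ Icc (0 : ℝ) 1,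
      ‖iteratedFDerivWithin ℝ k (f q.1 s) S q.2 - iteratedFDerivWithin ℝ k (f l s) S x‖
        ≤ η / 2 := by
    refine isCompact_Icc.eventually_forall_of_forall_prod (P := fun q : (Λ × E) × ℝ =>
      ‖iteratedFDerivWithin ℝ k (f q.1.1 q.2) S q.1.2 -
        iteratedFDerivWithin ℝ k (f l q.2) S x‖ ≤ η / 2) fun s hs => ?_
    have h1 := ((h s hs).self_of_prod_nhdsWithin hx).tendsto k
    have t1 : Tendsto (fun q : (Λ × E) × ℝ => ((q.1.1, q.2), q.1.2))
        ((𝓝 l ×ˢ 𝓝[S] x) ×ˢ 𝓝[Icc 0 1] s) (𝓝 (l, s) ×ˢ 𝓝[S] x) := by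
      refine Tendsto.prodMk ?_ (tendsto_snd.comp tendsto_fst)
      exact (tendsto_fst.comp tendsto_fst).prodMk_nhds
        (tendsto_snd.mono_right nhdsWithin_le_nhds)
    have t2 : Tendsto (fun q : (Λ × E) × ℝ => ((l, q.2), x))
        ((𝓝 l ×ˢ 𝓝[S] x) ×ˢ 𝓝[Icc 0 1] s) (𝓝 (l, s) ×ˢ 𝓝[S] x) := by
      refine Tendsto.prodMk ?_ ?_
      · exact tendsto_const_nhds.prodMk_nhds (tendsto_snd.mono_right nhdsWithin_le_nhds)
      · exact (tendsto_pure.2 (.of_forall fun _ => rfl)).mono_right (pure_le_nhdsWithin hx)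
    have h3 := ((h1.comp t1).sub (h1.comp t2)).norm
    rw [sub_self, norm_zero] at h3
    exact h3.eventually_le_const (by positivity)
  filter_upwards [hint, hclose] with q hq hc
  rw [dist_eq_norm, hP, ← intervalIntegral.integral_sub hq (hint.self_of_prod_nhdsWithin hx)]
  refine (intervalIntegral.norm_integral_le_of_norm_le_const (C := η / 2) ?_).trans_lt ?_
  · intro s hs
    rw [uIoc_of_le zero_le_one] at hs
    exact hc s ⟨hs.1.le, hs.2⟩
  · simpa using hη

end ParametricIntegral

section Hadamard

variable {Λ E F : Type*} [TopologicalSpace Λ]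
  [NormedAddCommGroup E] [NormedSpace ℝ E] [NormedAddCommGroup F] [NormedSpace ℝ F]

theorem dslope_eq_integral [CompleteSpace F] {φ φ' : ℝ → F} {t : ℝ}
    (hd : ∀ s ∈ Icc (0 : ℝ) 1, HasDerivAt φ (φ' (s * t)) (s * t))
    (hc : ContinuousOn (fun s => φ' (s * t)) (Icc 0 1)) :
    dslope φ 0 t = ∫ s in (0 : ℝ)..1, φ' (s * t) := by
  rcases eq_or_ne t 0 with rfl | ht
  · rw [dslope_same]
    simpa using (hd 0 ⟨le_rfl, zero_le_one⟩).deriv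
  · have h1 : ∫ s in (0 : ℝ)..1, t • φ' (s * t) = φ (1 * t) - φ (0 * t) := by
      refine intervalIntegral.integral_eq_sub_of_hasDerivAt (f := fun s => φ (s * t))
        (fun s hs => ?_) ?_
      · rw [uIcc_of_le zero_le_one] at hs
        simpa [Function.comp_def] using (hd s hs).scomp s ((hasDerivAt_id s).mul_const t)
      · refine ContinuousOn.intervalIntegrable ?_
        rw [uIcc_of_le zero_le_one]
        exact continuousOn_const.smul hc
    rw [intervalIntegral.integral_smul] at h1
    rw [dslope_of_ne _ ht, slope_def_module, sub_zero]
    simp only [one_mul, zero_mul] at h1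
    rw [← h1, smul_smul, inv_mul_cancel₀ ht, one_smul]

/-- Hadamard's lemma for families: division by a real variable preserves smoothness. -/
protected theorem SmoothFamilyWithinAt.dslope [CompleteSpace F] {f : Λ → ℝ × E → F} {S : Set E}
    (hS : UniqueDiffOn ℝ S) (hconv : Convex ℝ S) {l : Λ} {u : E} (hu : u ∈ S)
    (h : ∀ᶠ q : Λ × (ℝ × E) in 𝓝 l ×ˢ 𝓝[univ ×ˢ S] (0, u),
      SmoothFamilyWithinAt f (univ ×ˢ S) q.1 q.2) :
    SmoothFamilyWithinAt (fun l p => dslope (fun t => f l (t, p.2)) 0 p.1)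
      (univ ×ˢ S) l (0, u) := by
  have hS' : UniqueDiffOn ℝ ((univ : Set ℝ) ×ˢ S) := uniqueDiffOn_univ.prod hS
  have hu' : ((0 : ℝ), u) ∈ (univ : Set ℝ) ×ˢ S := ⟨mem_univ _, hu⟩
  set g : Λ → ℝ → ℝ × E → F := fun l s p =>
    fderivWithin ℝ (f l) (univ ×ˢ S) (s * p.1, p.2) (1, 0) with hg
  have hgfam : ∀ q : (Λ × ℝ) × (ℝ × E), q.2.2 ∈ S →
      SmoothFamilyWithinAt f (univ ×ˢ S) q.1.1 (q.1.2 * q.2.1, q.2.2) →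
      SmoothFamilyWithinAt (fun p : Λ × ℝ => g p.1 p.2) (univ ×ˢ S) q.1 q.2 := by
    rintro ⟨⟨l, s⟩, p⟩ hp hf
    have hp' : p ∈ (univ : Set ℝ) ×ˢ S := ⟨mem_univ _, hp⟩
    have h1 : SmoothFamilyWithinAt (fun (q : Λ × ℝ) (p : ℝ × E) => (q.2 * p.1, p.2))
        (univ ×ˢ S) (l, s) p := by
      have h2 := (SmoothFamilyWithinAt.of_parameter (c := fun q : Λ × ℝ => q.2) (l := (l, s))
        (by fun_prop) (univ ×ˢ S) p).prodMk (SmoothFamilyWithinAt.of_contDiff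
          hp' hS' contDiff_id (l, s)) hS' hp'
      exact h2.comp_contDiff (g := fun r : ℝ × (ℝ × E) => (r.1 * r.2.1, r.2.2)) (by fun_prop)
        hS' hp'
    have h3 := (hf.fderivWithin hS' (by exact ⟨mem_univ _, hp⟩)).comp_contDiff
      (g := fun L : ℝ × E →L[ℝ] F => L (1, 0)) (by fun_prop) hS' ⟨mem_univ _, hp⟩
    have h4 := SmoothFamilyWithinAt.comp_parameter (c := fun q : Λ × ℝ => q.1) (l' := (l, s))
      (by fun_prop) h3
    exact h4.comp h1 hS' hS' hp' (eventually_mem_prod_nhdsWithin.mono fun q hq =>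
      ⟨mem_univ _, hq.2⟩)
  have hint : SmoothFamilyWithinAt (fun l p => ∫ s in (0 : ℝ)..1, g l s p) (univ ×ˢ S) l
      (0, u) := by
    refine SmoothFamilyWithinAt.intervalIntegral hS' (convex_univ.prod hconv) hu' fun s _ => ?_
    have ht : Tendsto (fun q : (Λ × ℝ) × (ℝ × E) => (q.1.1, (q.1.2 * q.2.1, q.2.2)))
        (𝓝 (l, s) ×ˢ 𝓝[univ ×ˢ S] (0, u)) (𝓝 l ×ˢ 𝓝[univ ×ˢ S] (0, u)) := by
      refine ((continuousAt_fst.tendsto).comp tendsto_fst).prodMk (tendsto_nhdsWithin_iff.2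
        ⟨?_, eventually_mem_prod_nhdsWithin.mono fun q hq => ⟨mem_univ _, hq.2⟩⟩)
      have : ContinuousAt (fun q : (Λ × ℝ) × (ℝ × E) => (q.1.2 * q.2.1, q.2.2))
        ((l, s), (0, u)) := by fun_prop
      have := this.tendsto
      rw [nhds_prod_eq] at this
      simp only [mul_zero] at this
      exact this.mono_left (Filter.prod_mono le_rfl nhdsWithin_le_nhds)
    filter_upwards [ht.eventually h, eventually_mem_prod_nhdsWithin] with q hq hqS
    exact hgfam q hqS.2 hq
  refine hint.congr hu' ?_
  have tube : ∀ᶠ q : Λ × (ℝ × E) in 𝓝 l ×ˢ 𝓝[univ ×ˢ S] (0, u), ∀ s ∈ Icc (0 : ℝ) 1,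
      SmoothFamilyWithinAt f (univ ×ˢ S) q.1 (s * q.2.1, q.2.2) := by
    refine isCompact_Icc.eventually_forall_of_forall_prod (P := fun q : (Λ × (ℝ × E)) × ℝ =>
      SmoothFamilyWithinAt f (univ ×ˢ S) q.1.1 (q.2 * q.1.2.1, q.1.2.2)) fun s hs => ?_
    have ht : Tendsto (fun q : (Λ × (ℝ × E)) × ℝ => (q.1.1, (q.2 * q.1.2.1, q.1.2.2)))
        ((𝓝 l ×ˢ 𝓝[univ ×ˢ S] (0, u)) ×ˢ 𝓝[Icc 0 1] s) (𝓝 l ×ˢ 𝓝[univ ×ˢ S] (0, u)) := by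
      refine (tendsto_fst.comp tendsto_fst).prodMk (tendsto_nhdsWithin_iff.2
        ⟨?_, (tendsto_fst.eventually eventually_mem_prod_nhdsWithin).mono
          fun q hq => ⟨mem_univ _, hq.2⟩⟩)
      have : ContinuousAt (fun q : (ℝ × E) × ℝ => (q.2 * q.1.1, q.1.2)) ((0, u), s) := by fun_prop
      have := this.tendsto
      rw [nhds_prod_eq] at this
      simp only [mul_zero] at this
      exact this.comp ((tendsto_snd.mono_right nhdsWithin_le_nhds).prodMap tendsto_id |>.mono_right
        (Filter.prod_mono le_rfl nhdsWithin_le_nhds))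
    exact ht.eventually h
  filter_upwards [tube, eventually_mem_prod_nhdsWithin] with ⟨l, t, v⟩ hq hqS
  refine dslope_eq_integral (φ := fun t => f l (t, v))
    (φ' := fun t => fderivWithin ℝ (f l) (univ ×ˢ S) (t, v) (1, 0)) (fun s hs => ?_) ?_
  · have h1 := (((hq s hs).smoothAt ⟨mem_univ _, hqS.2⟩).differentiableWithinAt
      (by simp)).hasFDerivWithinAt
    have h2 : HasDerivAt (fun t : ℝ => (t, v)) ((1 : ℝ), (0 : E)) (s * t) :=
      (hasDerivAt_id _).prodMk (hasDerivAt_const _ _)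
    have := h1.comp_hasDerivWithinAt (s * t) h2.hasDerivWithinAt
      (s := univ) (t := univ ×ˢ S) (fun r _ => mk_mem_prod (mem_univ r) hqS.2)
    simpa [Function.comp_def, hasDerivWithinAt_univ] using this
  · intro s hs
    have h1 := ((hq s hs).fderivWithin hS' (by exact ⟨mem_univ _, hqS.2⟩)).tendsto_apply
    have h2 : Tendsto (fun s : ℝ => (s * t, v)) (𝓝[Icc 0 1] s) (𝓝[univ ×ˢ S] (s * t, v)) := by
      refine tendsto_nhdsWithin_iff.2 ⟨?_, .of_forall fun r => ⟨mem_univ _, hqS.2⟩⟩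
      exact (Continuous.tendsto (by fun_prop) s).mono_left nhdsWithin_le_nhds
    exact ((ContinuousLinearMap.apply ℝ F ((1 : ℝ), (0 : E))).continuous.tendsto _).comp
      (h1.comp (tendsto_const_nhds.prodMk h2))

end Hadamard

section ManifoldFamily

variable {Λ Λ' : Type*} [TopologicalSpace Λ] [TopologicalSpace Λ']
  {E : Type*} [NormedAddCommGroup E] [NormedSpace ℝ E]
  {H : Type*} [TopologicalSpace H] {I : ModelWithCorners ℝ E H}
  {M : Type*} [TopologicalSpace M] [ChartedSpace H M]
  {E' : Type*} [NormedAddCommGroup E'] [NormedSpace ℝ E']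
  {H' : Type*} [TopologicalSpace H'] {J : ModelWithCorners ℝ E' H'}
  {N : Type*} [TopologicalSpace N] [ChartedSpace H' N]
  {E'' : Type*} [NormedAddCommGroup E''] [NormedSpace ℝ E'']
  {H'' : Type*} [TopologicalSpace H''] {J' : ModelWithCorners ℝ E'' H''}
  {N' : Type*} [TopologicalSpace N'] [ChartedSpace H'' N']

theorem map_prod_extend_nhds (I : ModelWithCorners ℝ E H) (φ : OpenPartialHomeomorph M H)
    {x : M} (hx : x ∈ φ.source) (l : Λ) :
    map (fun q : Λ × M => (q.1, φ.extend I q.2)) (𝓝 (l, x)) =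
      𝓝 l ×ˢ 𝓝[range I] (φ.extend I x) := by
  rw [← φ.map_extend_nhds hx, nhds_prod_eq]
  nth_rw 2 [← Filter.map_id (f := 𝓝 l)]
  rw [Filter.prod_map_map_eq]
  rfl

theorem tendsto_prod_extend (I : ModelWithCorners ℝ E H) (φ : OpenPartialHomeomorph M H)
    {x : M} (hx : x ∈ φ.source) (l : Λ) :
    Tendsto (fun q : Λ × M => (q.1, φ.extend I q.2)) (𝓝 (l, x))
      (𝓝 l ×ˢ 𝓝[range I] (φ.extend I x)) :=
  (map_prod_extend_nhds I φ hx l).le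

theorem eventually_prod_extend_iff (φ : OpenPartialHomeomorph M H)
    {x : M} (hx : x ∈ φ.source) (l : Λ) {P : Λ × E → Prop} :
    (∀ᶠ q in 𝓝 l ×ˢ 𝓝[range I] (φ.extend I x), P q) ↔
      ∀ᶠ q : Λ × M in 𝓝 (l, x), P (q.1, φ.extend I q.2) := by
  rw [← map_prod_extend_nhds I φ hx l, eventually_map]

theorem eventually_mem_source {φ : OpenPartialHomeomorph M H} {x : M} (hx : x ∈ φ.source) (l : Λ) :
    ∀ᶠ q : Λ × M in 𝓝 (l, x), q.2 ∈ φ.source :=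
  (continuousAt_snd (p := (l, x))).eventually (φ.open_source.mem_nhds hx)

variable (I J) in
/-- A family of maps of manifolds, near a parameter and a point: in charts, it is a smooth family
of maps, all derivatives being jointly continuous in the parameter and the point. -/
structure SmoothFamilyAt (f : Λ → M → N) (l : Λ) (x : M) : Prop where
  continuousAt : ContinuousAt (fun q : Λ × M => f q.1 q.2) (l, x)
  localRep : SmoothFamilyWithinAt
    (fun l' => localRep I J (chartAt H x) (chartAt H' (f l x)) (f l')) (range I) l
    ((chartAt H x).extend I x)

theorem contDiffWithinAt_localRep_of_contMDiffAt {g : M → N} {x : M}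
    {φ : OpenPartialHomeomorph M H} {ψ : OpenPartialHomeomorph N H'}
    (hφ : φ ∈ IsManifold.maximalAtlas I ∞ M) (hψ : ψ ∈ IsManifold.maximalAtlas J ∞ N)
    [IsManifold I ∞ M] [IsManifold J ∞ N] (hx : x ∈ φ.source) (hy : g x ∈ ψ.source)
    (h : ContMDiffAt I J ∞ g x) :
    ContDiffWithinAt ℝ ∞ (localRep I J φ ψ g) (range I) (φ.extend I x) := by
  have := ((contMDiffWithinAt_iff_of_mem_maximalAtlas hφ hψ hx hy).1 h).2
  rwa [preimage_univ, univ_inter] at this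

namespace SmoothFamilyAt

variable {f : Λ → M → N} {l : Λ} {x : M}

theorem eventually_mem (hf : ContinuousAt (fun q : Λ × M => f q.1 q.2) (l, x))
    {ψ : OpenPartialHomeomorph N H'} (hψ : f l x ∈ ψ.source) :
    ∀ᶠ q : Λ × M in 𝓝 (l, x), f q.1 q.2 ∈ ψ.source :=
  hf.eventually (ψ.open_source.mem_nhds hψ)

theorem localRep_of_localRep [IsManifold I ∞ M] [IsManifold J ∞ N]
    (hc : ContinuousAt (fun q : Λ × M => f q.1 q.2) (l, x))
    {φ φ' : OpenPartialHomeomorph M H} {ψ ψ' : OpenPartialHomeomorph N H'}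
    (hφ : φ ∈ IsManifold.maximalAtlas I ∞ M) (hφ' : φ' ∈ IsManifold.maximalAtlas I ∞ M)
    (hψ : ψ ∈ IsManifold.maximalAtlas J ∞ N) (hψ' : ψ' ∈ IsManifold.maximalAtlas J ∞ N)
    (hx : x ∈ φ.source) (hx' : x ∈ φ'.source) (hy : f l x ∈ ψ.source) (hy' : f l x ∈ ψ'.source)
    (h : SmoothFamilyWithinAt (fun l' => _root_.localRep I J φ ψ (f l')) (range I) l
      (φ.extend I x)) :
    SmoothFamilyWithinAt (fun l' => _root_.localRep I J φ' ψ' (f l')) (range I) l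
      (φ'.extend I x) := by
  have c1 : SmoothFamilyWithinAt (fun _ : Λ => φ.extend I ∘ (φ'.extend I).symm) (range I) l
      (φ'.extend I x) := by
    refine .of_contDiffWithinAt (x := φ'.extend I x) (S := range I) (mem_range_self _) I.uniqueDiffOn ?_ l
    rw [← φ'.map_extend_nhds (I := I) hx', eventually_map]
    filter_upwards [φ'.open_source.mem_nhds hx', φ.open_source.mem_nhds hx] with y hy' hy
    refine ModelWithCorners.contDiffWithinAt_extendCoordChange hφ' hφ ?_
    simp [hy, hy', φ'.left_inv hy']
  have c2 : SmoothFamilyWithinAt (fun _ : Λ => ψ'.extend J ∘ (ψ.extend J).symm) (range J) l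
      (ψ.extend J (f l x)) := by
    refine .of_contDiffWithinAt (x := ψ.extend J (f l x)) (S := range J) (mem_range_self _) J.uniqueDiffOn ?_ l
    rw [← ψ.map_extend_nhds (I := J) hy, eventually_map]
    filter_upwards [ψ'.open_source.mem_nhds hy', ψ.open_source.mem_nhds hy] with y hy' hy
    refine ModelWithCorners.contDiffWithinAt_extendCoordChange hψ hψ' ?_
    simp [hy, hy', ψ.left_inv hy]
  have e1 : (φ.extend I ∘ (φ'.extend I).symm) (φ'.extend I x) = φ.extend I x := by
    simp [φ'.left_inv hx']
  have e2 : _root_.localRep I J φ ψ (f l) ((φ.extend I ∘ (φ'.extend I).symm) (φ'.extend I x)) =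
      ψ.extend J (f l x) := by
    simp [_root_.localRep, φ'.left_inv hx', φ.left_inv hx]
  rw [← e1] at h
  have h1 := h.comp c1 I.uniqueDiffOn I.uniqueDiffOn (mem_range_self _)
    (eventually_of_mem (f := _) univ_mem fun q _ => by simp)
  rw [← e2] at c2
  have h2 := c2.comp h1 I.uniqueDiffOn J.uniqueDiffOn (mem_range_self _)
    (.of_forall fun q => by simp [_root_.localRep])
  refine h2.congr (mem_range_self _) ?_
  rw [eventually_prod_extend_iff φ' hx']
  filter_upwards [eventually_mem_source hx l, eventually_mem_source hx' l, eventually_mem hc hy]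
    with q h1 h2 h3
  simp [_root_.localRep, φ.left_inv h1, φ'.left_inv h2, ψ.left_inv h3]

variable [IsManifold I ∞ M] [IsManifold J ∞ N]

theorem localRep_of_mem_maximalAtlas (h : SmoothFamilyAt I J f l x)
    {φ : OpenPartialHomeomorph M H} {ψ : OpenPartialHomeomorph N H'}
    (hφ : φ ∈ IsManifold.maximalAtlas I ∞ M) (hψ : ψ ∈ IsManifold.maximalAtlas J ∞ N)
    (hx : x ∈ φ.source) (hy : f l x ∈ ψ.source) :
    SmoothFamilyWithinAt (fun l' => _root_.localRep I J φ ψ (f l')) (range I) l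
      (φ.extend I x) :=
  localRep_of_localRep h.continuousAt (IsManifold.chart_mem_maximalAtlas x) hφ
    (IsManifold.chart_mem_maximalAtlas _) hψ (mem_chart_source _ _) hx (mem_chart_source _ _) hy
    h.localRep

theorem of_mem_maximalAtlas (hc : ContinuousAt (fun q : Λ × M => f q.1 q.2) (l, x))
    {φ : OpenPartialHomeomorph M H} {ψ : OpenPartialHomeomorph N H'}
    (hφ : φ ∈ IsManifold.maximalAtlas I ∞ M) (hψ : ψ ∈ IsManifold.maximalAtlas J ∞ N)
    (hx : x ∈ φ.source) (hy : f l x ∈ ψ.source)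
    (h : SmoothFamilyWithinAt (fun l' => _root_.localRep I J φ ψ (f l')) (range I) l
      (φ.extend I x)) : SmoothFamilyAt I J f l x :=
  ⟨hc, localRep_of_localRep hc hφ (IsManifold.chart_mem_maximalAtlas x) hψ
    (IsManifold.chart_mem_maximalAtlas _) hx (mem_chart_source _ _) hy (mem_chart_source _ _) h⟩

theorem contMDiffAt (h : SmoothFamilyAt I J f l x) : ContMDiffAt I J ∞ (f l) x := by
  refine contMDiffAt_iff.2 ⟨?_, h.localRep.smoothAt (mem_range_self _)⟩
  exact ContinuousAt.comp (g := fun q : Λ × M => f q.1 q.2) (f := fun y => (l, y)) h.continuousAt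
    (by fun_prop)

protected theorem congr {g : Λ → M → N} (h : SmoothFamilyAt I J f l x)
    (hfg : ∀ᶠ q : Λ × M in 𝓝 (l, x), g q.1 q.2 = f q.1 q.2) : SmoothFamilyAt I J g l x := by
  have e : g l x = f l x := hfg.self_of_nhds
  refine of_mem_maximalAtlas (h.continuousAt.congr (hfg.mono fun _ h => h.symm))
    (IsManifold.chart_mem_maximalAtlas x) (IsManifold.chart_mem_maximalAtlas (f l x))
    (mem_chart_source _ _) (by rw [e]; exact mem_chart_source _ _) ?_
  refine h.localRep.congr (mem_range_self _) ?_
  rw [eventually_prod_extend_iff (chartAt H x) (mem_chart_source _ _)]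
  filter_upwards [hfg, eventually_mem_source (mem_chart_source H x) l] with q hq hs
  simp [_root_.localRep, (chartAt H x).left_inv hs, hq]

theorem of_contMDiffAt {g : M → N} (h : ∀ᶠ y in 𝓝 x, ContMDiffAt I J ∞ g y) (l : Λ) :
    SmoothFamilyAt I J (fun _ : Λ => g) l x := by
  have hx := h.self_of_nhds
  refine ⟨hx.continuousAt.comp (f := Prod.snd) (x := (l, x)) continuousAt_snd, ?_⟩
  refine .of_contDiffWithinAt (x := (chartAt H x).extend I x) (S := range I) (mem_range_self _) I.uniqueDiffOn ?_ l
  rw [← (chartAt H x).map_extend_nhds (I := I) (mem_chart_source _ _), eventually_map]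
  filter_upwards [h, (chartAt H x).open_source.mem_nhds (mem_chart_source _ _),
    hx.continuousAt.eventually ((chartAt H' (g x)).open_source.mem_nhds (mem_chart_source _ _))]
    with y h1 h2 h3
  exact contDiffWithinAt_localRep_of_contMDiffAt (IsManifold.chart_mem_maximalAtlas x)
    (IsManifold.chart_mem_maximalAtlas _) h2 h3 h1

theorem of_contMDiffOn {g : M → N} {U : Set M} (h : ContMDiffOn I J ∞ g U) (hU : U ∈ 𝓝 x) (l : Λ) :
    SmoothFamilyAt I J (fun _ : Λ => g) l x := by
  refine of_contMDiffAt ?_ l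
  filter_upwards [eventually_eventually_nhds.2 hU] with y hy using h.contMDiffAt hy

theorem of_contMDiff {g : M → N} (h : ContMDiff I J ∞ g) (l : Λ) (x : M) :
    SmoothFamilyAt I J (fun _ : Λ => g) l x :=
  of_contMDiffAt (.of_forall fun _ => h.contMDiffAt) l

variable [IsManifold J' ∞ N']

protected theorem comp {g : Λ → N → N'} (hg : SmoothFamilyAt J J' g l (f l x))
    (hf : SmoothFamilyAt I J f l x) : SmoothFamilyAt I J' (fun l y => g l (f l y)) l x := by
  refine ⟨ContinuousAt.comp (g := fun q : Λ × N => g q.1 q.2) (f := fun q : Λ × M =>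
    (q.1, f q.1 q.2)) hg.continuousAt (continuousAt_fst.prodMk hf.continuousAt), ?_⟩
  have e : _root_.localRep I J (chartAt H x) (chartAt H' (f l x)) (f l)
      ((chartAt H x).extend I x) = (chartAt H' (f l x)).extend J (f l x) := by
    simp [_root_.localRep]
  have hg' := hg.localRep
  rw [← e] at hg'
  refine (hg'.comp hf.localRep I.uniqueDiffOn J.uniqueDiffOn (mem_range_self _)
    (.of_forall fun q => by simp [_root_.localRep])).congr (mem_range_self _) ?_
  rw [eventually_prod_extend_iff (chartAt H x) (mem_chart_source _ _)]
  filter_upwards [eventually_mem_source (mem_chart_source H x) l,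
    eventually_mem hf.continuousAt (mem_chart_source H' (f l x))] with q h1 h2
  simp [_root_.localRep, (chartAt H x).left_inv h1, (chartAt H' (f l x)).left_inv h2]

protected theorem prodMk {g : Λ → M → N'} (hf : SmoothFamilyAt I J f l x)
    (hg : SmoothFamilyAt I J' g l x) :
    SmoothFamilyAt I (J.prod J') (fun l y => (f l y, g l y)) l x :=
  ⟨hf.continuousAt.prodMk hg.continuousAt,
    hf.localRep.prodMk hg.localRep I.uniqueDiffOn (mem_range_self _)⟩

theorem of_parameter {F : Type*} [NormedAddCommGroup F] [NormedSpace ℝ F] {c : Λ → F} {l : Λ}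
    (hc : ContinuousAt c l) (x : M) : SmoothFamilyAt I 𝓘(ℝ, F) (fun l (_ : M) => c l) l x :=
  ⟨hc.comp continuousAt_fst, .of_parameter hc _ _⟩

end SmoothFamilyAt

end ManifoldFamily

section FamilyDslope

variable {Λ : Type*} [TopologicalSpace Λ]
  {E : Type*} [NormedAddCommGroup E] [NormedSpace ℝ E]
  {H : Type*} [TopologicalSpace H] {I : ModelWithCorners ℝ E H}
  {M : Type*} [TopologicalSpace M] [ChartedSpace H M] [IsManifold I ∞ M]

theorem SmoothFamilyAt.of_localRep_vector {F : Type*} [NormedAddCommGroup F] [NormedSpace ℝ F]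
    {f : Λ → M → F} {l : Λ} {x : M}
    (h : SmoothFamilyWithinAt (fun l' => _root_.localRep I 𝓘(ℝ, F) (chartAt H x)
      (OpenPartialHomeomorph.refl F) (f l')) (range I) l ((chartAt H x).extend I x)) :
    SmoothFamilyAt I 𝓘(ℝ, F) f l x := by
  refine ⟨?_, h⟩
  have h1 := h.tendsto_apply.comp (tendsto_prod_extend I (chartAt H x) (mem_chart_source H x) l)
  have e : ∀ q : Λ × M, q.2 ∈ (chartAt H x).source → _root_.localRep I 𝓘(ℝ, F) (chartAt H x)
      (OpenPartialHomeomorph.refl F) (f q.1) ((chartAt H x).extend I q.2) = f q.1 q.2 := by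
    intro q hq
    simp [_root_.localRep, (chartAt H x).left_inv hq]
  have e0 := e (l, x) (mem_chart_source H x)
  simp only at e0
  rw [e0] at h1
  exact h1.congr' ((eventually_mem_source (mem_chart_source H x) l).mono e)

protected theorem SmoothFamilyAt.dslope {F : Type*} [NormedAddCommGroup F] [NormedSpace ℝ F]
    [CompleteSpace F] {f : Λ → ℝ × M → F} {l : Λ} {x : M}
    (h : ∀ᶠ q : Λ × (ℝ × M) in 𝓝 (l, (0, x)),
      SmoothFamilyAt (𝓘(ℝ, ℝ).prod I) 𝓘(ℝ, F) f q.1 q.2) :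
    SmoothFamilyAt (𝓘(ℝ, ℝ).prod I) 𝓘(ℝ, F)
      (fun l p => dslope (fun t => f l (t, p.2)) 0 p.1) l (0, x) := by
  have hφ0 : ((0 : ℝ), x) ∈ (chartAt (ModelProd ℝ H) ((0 : ℝ), x)).source := mem_chart_source _ _
  have hrange : range (𝓘(ℝ, ℝ).prod I) = univ ×ˢ range I := by
    rw [ModelWithCorners.range_prod]; simp
  have h1 : ∀ᶠ q : Λ × (ℝ × E) in 𝓝 l ×ˢ 𝓝[univ ×ˢ range I] (0, (chartAt H x).extend I x),
      SmoothFamilyWithinAt (fun l' => _root_.localRep (𝓘(ℝ, ℝ).prod I) 𝓘(ℝ, F)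
        (chartAt (ModelProd ℝ H) ((0 : ℝ), x))
        (OpenPartialHomeomorph.refl F) (f l')) (univ ×ˢ range I) q.1 q.2 := by
    have := (eventually_prod_extend_iff (I := 𝓘(ℝ, ℝ).prod I)
      (chartAt (ModelProd ℝ H) ((0 : ℝ), x)) hφ0 l (P := fun q =>
      SmoothFamilyWithinAt (fun l' => _root_.localRep (𝓘(ℝ, ℝ).prod I) 𝓘(ℝ, F)
        (chartAt (ModelProd ℝ H) ((0 : ℝ), x))
        (OpenPartialHomeomorph.refl F) (f l')) (univ ×ˢ range I) q.1 q.2)).2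
    rw [hrange] at this
    refine this ?_
    filter_upwards [h, eventually_mem_source hφ0 l] with q hq hs
    rw [← hrange]
    exact hq.localRep_of_mem_maximalAtlas (IsManifold.chart_mem_maximalAtlas _)
      (IsManifold.chart_mem_maximalAtlas (f q.1 q.2)) hs (mem_univ _)
  have h2 := SmoothFamilyWithinAt.dslope I.uniqueDiffOn I.convex_range (mem_range_self _) h1
  refine .of_localRep_vector ?_
  rw [hrange]
  exact h2

end FamilyDslope

section WhitneyFamily

variable {Λ : Type*} [TopologicalSpace Λ]
  {E : Type*} [NormedAddCommGroup E] [NormedSpace ℝ E]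
  {H : Type*} [TopologicalSpace H] {I : ModelWithCorners ℝ E H}
  {M : Type*} [TopologicalSpace M] [ChartedSpace H M] [IsManifold I ∞ M]
  {E' : Type*} [NormedAddCommGroup E'] [NormedSpace ℝ E']
  {H' : Type*} [TopologicalSpace H'] {J : ModelWithCorners ℝ E' H'}
  {N : Type*} [TopologicalSpace N] [ChartedSpace H' N] [IsManifold J ∞ N]

theorem mem_whitneyNhd_self {r : ℕ} {φ : OpenPartialHomeomorph M H}
    {ψ : OpenPartialHomeomorph N H'} {K : Set M} {ε : ℝ} {f : C^∞⟮I, M; J, N⟯}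
    (h : IsWhitneyDatum I J φ ψ K ε f) : f ∈ whitneyNhd I J r φ ψ K ε f :=
  ⟨h.2.2.2.2.1, fun x _ k _ => by simpa using h.2.2.2.2.2⟩

/-- The derivatives of the local representative of a smooth map are continuous. -/
theorem continuousWithinAt_iteratedFDerivWithin_localRep {φ : OpenPartialHomeomorph M H}
    {ψ : OpenPartialHomeomorph N H'} {K : Set M} {ε : ℝ} {f : C^∞⟮I, M; J, N⟯}
    (h : IsWhitneyDatum I J φ ψ K ε f) {x : M} (hx : x ∈ K) (k : ℕ) :
    ContinuousWithinAt (iteratedFDerivWithin ℝ k (localRep I J φ ψ f) (range I)) (range I)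
      (φ.extend I x) := by
  have := contDiffWithinAt_localRep_of_contMDiffAt h.1 h.2.1 (h.2.2.2.1 hx) (h.2.2.2.2.1 hx)
    (f.contMDiff x)
  exact (this.iteratedFDerivWithin_right (m := 0) I.uniqueDiffOn (by simpa using mod_cast le_top)
    (mem_range_self _)).continuousWithinAt

/-- A jointly smooth family is continuous for the weak topology. -/
theorem continuous_weakWhitneyInfty_of_smoothFamilyAt {f : Λ → C^∞⟮I, M; J, N⟯}
    (h : ∀ l x, SmoothFamilyAt I J (fun l => f l) l x) :
    @Continuous _ _ _ (weakWhitneyInfty I M J N) f := by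
  refine continuous_iInf_rng.2 fun r => continuous_generateFrom_iff.2 ?_
  rintro _ ⟨g, φ, ψ, K, ε, hd, rfl⟩
  rw [isOpen_iff_mem_nhds]
  rintro l ⟨hl1, hl2⟩
  have key : ∀ x ∈ K, ∀ᶠ q : Λ × M in 𝓝 (l, x), f q.1 q.2 ∈ ψ.source ∧ ∀ k ≤ r,
      ‖iteratedFDerivWithin ℝ k (localRep I J φ ψ (f q.1)) (range I) (φ.extend I q.2) -
        iteratedFDerivWithin ℝ k (localRep I J φ ψ g) (range I) (φ.extend I q.2)‖ < ε := by
    intro x hx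
    refine (SmoothFamilyAt.eventually_mem (f := fun l => f l) (h l x).continuousAt (hl1 hx)).and ?_
    have hfin : ∀ k ∈ Iic r, ∀ᶠ q : Λ × M in 𝓝 (l, x),
      ‖iteratedFDerivWithin ℝ k (localRep I J φ ψ (f q.1)) (range I) (φ.extend I q.2) -
        iteratedFDerivWithin ℝ k (localRep I J φ ψ g) (range I) (φ.extend I q.2)‖ < ε := by
      intro k hk
      have h1 := ((h l x).localRep_of_mem_maximalAtlas hd.1 hd.2.1 (hd.2.2.2.1 hx)
        (hl1 hx)).tendsto k
      have h2 : Tendsto (fun q : Λ × E => iteratedFDerivWithin ℝ k (localRep I J φ ψ g) (range I)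
          q.2) (𝓝 l ×ˢ 𝓝[range I] (φ.extend I x)) _ :=
        (continuousWithinAt_iteratedFDerivWithin_localRep hd hx k).tendsto.comp tendsto_snd
      exact ((h1.sub h2).norm.comp (tendsto_prod_extend I φ (hd.2.2.2.1 hx) l)).eventually_lt_const
        (hl2 x hx k hk)
    simpa using ((finite_Iic r).eventually_all).2 hfin
  have := hd.2.2.1.eventually_forall_of_forall_eventually (x₀ := l) (P := fun l x =>
    f l x ∈ ψ.source ∧ ∀ k ≤ r,
      ‖iteratedFDerivWithin ℝ k (localRep I J φ ψ (f l)) (range I) (φ.extend I x) -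
        iteratedFDerivWithin ℝ k (localRep I J φ ψ g) (range I) (φ.extend I x)‖ < ε) key
  filter_upwards [this] with l' hl'
  exact ⟨fun x hx => (hl' x hx).1, fun x hx => (hl' x hx).2⟩

/-- The tautological family of a set of maps with the weak topology is jointly smooth. -/
theorem smoothFamilyAt_of_continuous_weakWhitneyInfty [LocallyCompactSpace M]
    {f : Λ → C^∞⟮I, M; J, N⟯} (hf : @Continuous _ _ _ (weakWhitneyInfty I M J N) f)
    (l : Λ) (x : M) : SmoothFamilyAt I J (fun l => f l) l x := by
  set φ := chartAt H x
  set ψ := chartAt H' (f l x)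
  have hxφ : x ∈ φ.source := mem_chart_source _ _
  have hyψ : f l x ∈ ψ.source := mem_chart_source _ _
  obtain ⟨K, hKx, hKsub, hK⟩ := local_compact_nhds (inter_mem (φ.open_source.mem_nhds hxφ)
    ((f l).contMDiff.continuous.continuousAt.preimage_mem_nhds (ψ.open_source.mem_nhds hyψ)))
  have hxK : x ∈ K := mem_of_mem_nhds hKx
  have hd : ∀ ε, 0 < ε → IsWhitneyDatum I J φ ψ K ε (f l) := fun ε hε =>
    ⟨IsManifold.chart_mem_maximalAtlas _, IsManifold.chart_mem_maximalAtlas _, hK,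
      fun y hy => (hKsub hy).1, fun y hy => (hKsub hy).2, hε⟩
  have hnhd : ∀ r ε, 0 < ε → ∀ᶠ l' in 𝓝 l, f l' ∈ whitneyNhd I J r φ ψ K ε (f l) := by
    intro r ε hε
    have h1 := continuous_iInf_rng.1 hf r
    have h2 := (continuous_generateFrom_iff.1 h1 _ ⟨f l, φ, ψ, K, ε, hd ε hε, rfl⟩)
    exact h2.mem_nhds (mem_whitneyNhd_self (hd ε hε))
  have hKev : ∀ᶠ q : Λ × M in 𝓝 (l, x), q.2 ∈ K :=
    (continuousAt_snd (p := (l, x))).eventually hKx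
  have hmaps : ∀ᶠ q : Λ × M in 𝓝 (l, x), q.2 ∈ K ∧ f q.1 q.2 ∈ ψ.source := by
    filter_upwards [hKev, (continuousAt_fst (p := (l, x))).eventually (hnhd 0 1 one_pos)]
      with q h1 h2 using ⟨h1, h2.1 h1⟩
  have hfam : SmoothFamilyWithinAt (fun l' => localRep I J φ ψ (f l')) (range I) l
      (φ.extend I x) := by
    refine ⟨?_, fun k => ?_⟩
    · rw [eventually_prod_extend_iff φ hxφ]
      filter_upwards [hmaps] with q hq
      exact contDiffWithinAt_localRep_of_contMDiffAt (IsManifold.chart_mem_maximalAtlas _)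
        (IsManifold.chart_mem_maximalAtlas _) (hKsub hq.1).1 hq.2 ((f q.1).contMDiff q.2)
    · have h1 : Tendsto (fun q : Λ × E => iteratedFDerivWithin ℝ k (localRep I J φ ψ (f l))
          (range I) q.2) (𝓝 l ×ˢ 𝓝[range I] (φ.extend I x)) (𝓝 (iteratedFDerivWithin ℝ k
            (localRep I J φ ψ (f l)) (range I) (φ.extend I x))) :=
        (continuousWithinAt_iteratedFDerivWithin_localRep (hd 1 one_pos) hxK k).tendsto.comp
          tendsto_snd
      refine tendsto_of_tendsto_of_dist h1 ?_
      rw [Metric.tendsto_nhds]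
      intro ε hε
      rw [eventually_prod_extend_iff φ hxφ]
      filter_upwards [hKev, (continuousAt_fst (p := (l, x))).eventually (hnhd k ε hε)] with q h1 h2
      have := h2.2 q.2 h1 k le_rfl
      rwa [Real.dist_0_eq_abs, abs_of_nonneg dist_nonneg, dist_comm, dist_eq_norm]
  refine ⟨?_, hfam⟩
  have h1 := hfam.tendsto_apply.comp (tendsto_prod_extend I φ hxφ l)
  have e : ∀ q : Λ × M, q.2 ∈ φ.source → localRep I J φ ψ (f q.1) (φ.extend I q.2) =
      ψ.extend J (f q.1 q.2) := by
    intro q hq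
    simp [localRep, φ.left_inv hq]
  have e0 := e (l, x) hxφ
  simp only at e0
  rw [e0] at h1
  have h2 := (ψ.continuousAt_extend_symm (I := J) hyψ).tendsto.comp h1
  rw [ψ.extend_left_inv hyψ] at h2
  refine Tendsto.congr' ?_ h2
  filter_upwards [eventually_mem_source hxφ l, hmaps] with q h3 h4
  simp only [Function.comp_apply]
  rw [e q h3, ψ.extend_left_inv h4.2]

end WhitneyFamily

section StrongWhitney

variable {Λ : Type*} [TopologicalSpace Λ]
  {E : Type*} [NormedAddCommGroup E] [NormedSpace ℝ E]
  {H : Type*} [TopologicalSpace H] {I : ModelWithCorners ℝ E H}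
  {M : Type u} [TopologicalSpace M] [ChartedSpace H M] [IsManifold I ∞ M]
  {E' : Type*} [NormedAddCommGroup E'] [NormedSpace ℝ E']
  {H' : Type*} [TopologicalSpace H'] {J : ModelWithCorners ℝ E' H'}
  {N : Type*} [TopologicalSpace N] [ChartedSpace H' N] [IsManifold J ∞ N]

theorem mem_whitneyNhd_congr {r : ℕ} {φ : OpenPartialHomeomorph M H}
    {ψ : OpenPartialHomeomorph N H'} {K : Set M} {ε : ℝ} {f g g' : C^∞⟮I, M; J, N⟯}
    (hK : K ⊆ φ.source) (h : EqOn g g' φ.source) (hg : g ∈ whitneyNhd I J r φ ψ K ε f) :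
    g' ∈ whitneyNhd I J r φ ψ K ε f := by
  refine ⟨fun x hx => h (hK hx) ▸ hg.1 hx, fun x hx k hk => ?_⟩
  have e : localRep I J φ ψ g =ᶠ[𝓝[range I] (φ.extend I x)] localRep I J φ ψ g' := by
    rw [← φ.map_extend_nhds (I := I) (hK hx), EventuallyEq, eventually_map]
    filter_upwards [φ.open_source.mem_nhds (hK hx)] with y hy
    simp [localRep, φ.left_inv hy, h hy]
  rw [← e.iteratedFDerivWithin_eq (e.self_of_nhdsWithin (mem_range_self _)) k]
  exact hg.2 x hx k hk

theorem strongWhitneyInfty_le_weakWhitneyInfty :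
    strongWhitneyInfty I M J N ≤ weakWhitneyInfty I M J N := by
  refine iInf_mono fun r => le_generateFrom ?_
  rintro _ ⟨f, φ, ψ, K, ε, hd, rfl⟩
  refine TopologicalSpace.isOpen_generateFrom_of_mem ⟨f, PUnit, fun _ => φ, fun _ => ψ, fun _ => K,
    fun _ => ε, locallyFinite_of_finite _, fun _ => hd, ?_⟩
  exact (iInter_const (ι := PUnit) _).symm

/-- A jointly smooth family which differs from a strongly continuous one only in a fixed compact
set is strongly continuous. -/
theorem continuous_strongWhitneyInfty_of_eqOn_compl {f g : Λ → C^∞⟮I, M; J, N⟯}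
    (hf : @Continuous _ _ _ (weakWhitneyInfty I M J N) f)
    (hg : @Continuous _ _ _ (strongWhitneyInfty I M J N) g)
    {C : Set M} (hC : IsCompact C) (hfg : ∀ l, EqOn (f l) (g l) Cᶜ) :
    @Continuous _ _ _ (strongWhitneyInfty I M J N) f := by
  refine continuous_iInf_rng.2 fun r => continuous_generateFrom_iff.2 ?_
  rintro _ ⟨c, ι, φ, ψ, K, ε, hlf, hd, rfl⟩
  rw [isOpen_iff_mem_nhds]
  intro l hl
  have hT : {i | ((φ i).source ∩ C).Nonempty}.Finite := hlf.finite_nonempty_inter_compact hC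
  have heq : ∀ i, ¬ ((φ i).source ∩ C).Nonempty → ∀ l, EqOn (f l) (g l) (φ i).source :=
    fun i hi l x hx => hfg l fun hxC => hi ⟨x, hx, hxC⟩
  have h1 : ∀ᶠ l' in 𝓝 l, ∀ i ∈ {i | ((φ i).source ∩ C).Nonempty},
      f l' ∈ whitneyNhd I J r (φ i) (ψ i) (K i) (ε i) c := by
    refine hT.eventually_all.2 fun i _ => ?_
    have := continuous_generateFrom_iff.1 (continuous_iInf_rng.1 hf r) _
      ⟨c, φ i, ψ i, K i, ε i, hd i, rfl⟩
    exact this.mem_nhds (mem_iInter.1 hl i)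
  have h2 : ∀ᶠ l' in 𝓝 l, ∀ i, ¬ ((φ i).source ∩ C).Nonempty →
      g l' ∈ whitneyNhd I J r (φ i) (ψ i) (K i) (ε i) c := by
    have := continuous_generateFrom_iff.1 (continuous_iInf_rng.1 hg r) _
      ⟨c, {i // ¬ ((φ i).source ∩ C).Nonempty}, fun i => φ i, fun i => ψ i, fun i => K i,
        fun i => ε i, hlf.comp_injective Subtype.val_injective, fun i => hd i, rfl⟩
    filter_upwards [this.mem_nhds (mem_iInter.2 fun i => mem_whitneyNhd_congr (hd i).2.2.2.1
      (heq i i.2 l) (mem_iInter.1 hl i))] with l' hl' i hi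
    exact mem_iInter.1 hl' ⟨i, hi⟩
  filter_upwards [h1, h2] with l' hl1 hl2
  refine mem_iInter.2 fun i => ?_
  by_cases hi : ((φ i).source ∩ C).Nonempty
  · exact hl1 i hi
  · exact mem_whitneyNhd_congr (hd i).2.2.2.1 (heq i hi l').symm (hl2 i hi)

end StrongWhitney

namespace RegularNeighborhood

section Act

variable {E : Type*} [NormedAddCommGroup E] [NormedSpace ℝ E]
  {H : Type*} [TopologicalSpace H] {I : ModelWithCorners ℝ E H}
  {M : Type*} [TopologicalSpace M] [ChartedSpace H M] {B : Set M}
  (R : RegularNeighborhood I B)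

open Classical in
/-- Scalar multiplication in the fibers of a regular neighborhood. -/
noncomputable def act (t : ℝ) (x : M) : M :=
  if hx : x ∈ R.carrier then
    ((t • (⟨x, hx, rfl⟩ : Fiber R.carrier R.proj ((⟨R.proj x, R.mapsTo_proj hx⟩ : B) : M)) :
      Fiber R.carrier R.proj ((⟨R.proj x, R.mapsTo_proj hx⟩ : B) : M)) : M)
  else x

theorem act_coe (t : ℝ) (c : B) (y : Fiber R.carrier R.proj (c : M)) :
    R.act t y = ((t • y : Fiber R.carrier R.proj (c : M)) : M) := by
  obtain ⟨c, hc⟩ := c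
  obtain ⟨x, hx, hp⟩ := y
  simp only at hp
  subst hp
  simp [act, hx]

variable {R}

theorem exists_fiber {x : M} (hx : x ∈ R.carrier) :
    ∃ (c : B) (y : Fiber R.carrier R.proj (c : M)), (y : M) = x ∧ (c : M) = R.proj x :=
  ⟨⟨R.proj x, R.mapsTo_proj hx⟩, ⟨x, hx, rfl⟩, rfl, rfl⟩

theorem act_mem {x : M} (hx : x ∈ R.carrier) (t : ℝ) : R.act t x ∈ R.carrier := by
  obtain ⟨c, y, rfl, -⟩ := exists_fiber hx
  rw [R.act_coe]
  exact (t • y).2.1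

theorem proj_act {x : M} (hx : x ∈ R.carrier) (t : ℝ) : R.proj (R.act t x) = R.proj x := by
  obtain ⟨c, y, rfl, hc⟩ := exists_fiber hx
  rw [R.act_coe]
  exact (t • y).2.2.trans hc

theorem act_one {x : M} (hx : x ∈ R.carrier) : R.act 1 x = x := by
  obtain ⟨c, y, rfl, hc⟩ := exists_fiber hx
  rw [R.act_coe, one_smul]

theorem act_zero {x : M} (hx : x ∈ R.carrier) : R.act 0 x = R.proj x := by
  obtain ⟨c, y, rfl, hc⟩ := exists_fiber hx
  rw [R.act_coe, zero_smul, R.zero_fiber]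
  exact hc

theorem act_act {x : M} (hx : x ∈ R.carrier) (s t : ℝ) :
    R.act s (R.act t x) = R.act (s * t) x := by
  obtain ⟨c, y, rfl, hc⟩ := exists_fiber hx
  rw [R.act_coe t, R.act_coe s, R.act_coe, mul_smul]

theorem act_inv_act {x : M} (hx : x ∈ R.carrier) {t : ℝ} (ht : t ≠ 0) :
    R.act t⁻¹ (R.act t x) = x := by
  rw [act_act hx, inv_mul_cancel₀ ht, act_one hx]

theorem act_act_inv {x : M} (hx : x ∈ R.carrier) {t : ℝ} (ht : t ≠ 0) :
    R.act t (R.act t⁻¹ x) = x := by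
  rw [act_act hx, mul_inv_cancel₀ ht, act_one hx]

theorem act_of_mem {b : M} (hb : b ∈ B) (t : ℝ) : R.act t b = b := by
  have : b = ((0 : Fiber R.carrier R.proj ((⟨b, hb⟩ : B) : M)) : M) :=
    (R.zero_fiber ⟨b, hb⟩).symm
  conv_lhs => rw [this]
  rw [R.act_coe, smul_zero, R.zero_fiber]

theorem proj_mem {x : M} (hx : x ∈ R.carrier) : R.proj x ∈ B := R.mapsTo_proj hx

theorem isOpen_carrier_inter_preimage {W : Set M} (hW : IsOpen W) :
    IsOpen (R.carrier ∩ R.proj ⁻¹' W) :=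
  R.contMDiffOn_proj.continuousOn.isOpen_inter_preimage R.isOpen_carrier hW

variable (R)

/-- A local trivialization of a regular neighborhood. -/
structure Triv where
  rank : ℕ
  base : Set M
  coord : M → EuclideanSpace ℝ (Fin rank)
  total : M × EuclideanSpace ℝ (Fin rank) → M
  isOpen_base : IsOpen base
  contMDiffOn_coord : ContMDiffOn I 𝓘(ℝ, EuclideanSpace ℝ (Fin rank)) ∞ coord
    (R.carrier ∩ R.proj ⁻¹' base)
  contMDiffOn_total : ContMDiffOn (I.prod 𝓘(ℝ, EuclideanSpace ℝ (Fin rank))) I ∞ total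
    ((B ∩ base) ×ˢ univ)
  exists_linearEquiv : ∀ c : B, (c : M) ∈ base →
    ∃ T : Fiber R.carrier R.proj (c : M) ≃ₗ[ℝ] EuclideanSpace ℝ (Fin rank),
      (∀ x, T x = coord x) ∧ (∀ v, (T.symm v : M) = total ((c : M), v))

theorem exists_triv {b : M} (hb : b ∈ B) : ∃ P : Triv R, b ∈ P.base := by
  obtain ⟨k, W, τ, σ, h1, h2, h3, h4, h5⟩ := R.locally_trivial b hb
  exact ⟨⟨k, W, τ, σ, h1, h3, h4, h5⟩, h2⟩

namespace Triv

variable {R} (P : Triv R)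

theorem total_coord {x : M} (hx : x ∈ R.carrier) (hW : R.proj x ∈ P.base) :
    P.total (R.proj x, P.coord x) = x := by
  obtain ⟨c, y, rfl, hc⟩ := exists_fiber hx
  obtain ⟨T, hT, hT'⟩ := P.exists_linearEquiv c (hc ▸ hW)
  rw [← hc, ← hT', ← hT, T.symm_apply_apply]

theorem coord_act {x : M} (hx : x ∈ R.carrier) (hW : R.proj x ∈ P.base) (t : ℝ) :
    P.coord (R.act t x) = t • P.coord x := by
  obtain ⟨c, y, rfl, hc⟩ := exists_fiber hx
  obtain ⟨T, hT, hT'⟩ := P.exists_linearEquiv c (hc ▸ hW)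
  rw [R.act_coe, ← hT, ← hT, map_smul]

theorem total_mem {c : M} (hc : c ∈ B) (hW : c ∈ P.base) (v : EuclideanSpace ℝ (Fin P.rank)) :
    P.total (c, v) ∈ R.carrier := by
  obtain ⟨T, hT, hT'⟩ := P.exists_linearEquiv ⟨c, hc⟩ hW
  rw [← hT' v]
  exact (T.symm v).2.1

theorem proj_total {c : M} (hc : c ∈ B) (hW : c ∈ P.base) (v : EuclideanSpace ℝ (Fin P.rank)) :
    R.proj (P.total (c, v)) = c := by
  obtain ⟨T, hT, hT'⟩ := P.exists_linearEquiv ⟨c, hc⟩ hW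
  rw [← hT' v]
  exact (T.symm v).2.2

theorem coord_total {c : M} (hc : c ∈ B) (hW : c ∈ P.base) (v : EuclideanSpace ℝ (Fin P.rank)) :
    P.coord (P.total (c, v)) = v := by
  obtain ⟨T, hT, hT'⟩ := P.exists_linearEquiv ⟨c, hc⟩ hW
  rw [← hT' v, ← hT, T.apply_symm_apply]

theorem act_eq {x : M} (hx : x ∈ R.carrier) (hW : R.proj x ∈ P.base) (t : ℝ) :
    R.act t x = P.total (R.proj x, t • P.coord x) := by
  rw [← P.coord_act hx hW, ← proj_act hx t, P.total_coord (act_mem hx t)]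
  rwa [proj_act hx]

theorem coord_of_mem {b : M} (hb : b ∈ B) (hW : b ∈ P.base) : P.coord b = 0 := by
  have h1 := R.subset_carrier hb
  have := P.coord_act h1 (by rwa [R.proj_eq_self b hb]) 0
  rwa [act_of_mem hb, zero_smul] at this

theorem coord_eq_zero_iff {x : M} (hx : x ∈ R.carrier) (hW : R.proj x ∈ P.base) :
    P.coord x = 0 ↔ x ∈ B := by
  refine ⟨fun h => ?_, fun h => P.coord_of_mem h (by rwa [R.proj_eq_self x h] at hW)⟩
  have h1 := P.total_coord hx hW
  have h2 := P.total_coord (x := R.proj x) (R.subset_carrier (proj_mem hx))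
    (by rwa [R.proj_eq_self _ (proj_mem hx)])
  rw [R.proj_eq_self _ (proj_mem hx), P.coord_of_mem (proj_mem hx) hW, ← h, h1] at h2
  rw [h2]
  exact proj_mem hx

theorem isOpen_domain : IsOpen (R.carrier ∩ R.proj ⁻¹' P.base) :=
  isOpen_carrier_inter_preimage P.isOpen_base

theorem contMDiffOn_total_proj :
    ContMDiffOn (I.prod 𝓘(ℝ, EuclideanSpace ℝ (Fin P.rank))) I ∞
      (fun q : M × EuclideanSpace ℝ (Fin P.rank) => P.total (R.proj q.1, q.2))
      ((R.carrier ∩ R.proj ⁻¹' P.base) ×ˢ univ) := by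
  refine P.contMDiffOn_total.comp (t := (B ∩ P.base) ×ˢ univ)
    (ContMDiffOn.prodMk ?_ contMDiffOn_snd) fun q hq => ⟨⟨proj_mem hq.1.1, hq.1.2⟩, mem_univ _⟩
  exact (R.contMDiffOn_proj.mono inter_subset_left).comp contMDiffOn_fst fun q hq => hq.1

end Triv

theorem contMDiffOn_act : ContMDiffOn (𝓘(ℝ, ℝ).prod I) I ∞
    (fun q : ℝ × M => R.act q.1 q.2) (univ ×ˢ R.carrier) := by
  rintro ⟨t, x⟩ ⟨-, hx⟩
  obtain ⟨P, hP⟩ := R.exists_triv (proj_mem hx)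
  have hU : (univ : Set ℝ) ×ˢ (R.carrier ∩ R.proj ⁻¹' P.base) ∈ 𝓝 (t, x) :=
    (isOpen_univ.prod P.isOpen_domain).mem_nhds ⟨mem_univ _, hx, hP⟩
  have h1 : ContMDiffOn (𝓘(ℝ, ℝ).prod I) I ∞
      (fun q : ℝ × M => P.total (R.proj q.2, q.1 • P.coord q.2))
      (univ ×ˢ (R.carrier ∩ R.proj ⁻¹' P.base)) := by
    have h2 : ContMDiffOn (𝓘(ℝ, ℝ).prod I) 𝓘(ℝ, EuclideanSpace ℝ (Fin P.rank)) ∞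
        (fun q : ℝ × M => q.1 • P.coord q.2) (univ ×ˢ (R.carrier ∩ R.proj ⁻¹' P.base)) :=
      contMDiffOn_fst.smul (P.contMDiffOn_coord.comp contMDiffOn_snd fun q hq => hq.2)
    exact P.contMDiffOn_total_proj.comp (contMDiffOn_snd.prodMk h2) fun q hq => ⟨hq.2, mem_univ _⟩
  refine ContMDiffAt.contMDiffWithinAt ((h1.contMDiffAt hU).congr_of_eventuallyEq ?_)
  filter_upwards [hU] with q hq using P.act_eq hq.2.1 hq.2.2 _

end Act

end RegularNeighborhood

namespace RegularNeighborhood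

variable {E : Type*} [NormedAddCommGroup E] [NormedSpace ℝ E]
  {H : Type*} [TopologicalSpace H] {I : ModelWithCorners ℝ E H}
  {M : Type*} [TopologicalSpace M] [ChartedSpace H M] {B : Set M}
  (R : RegularNeighborhood I B)

/-- The square of the norm of a smooth fiberwise metric on a regular neighborhood of a compact
submanifold. -/
structure SqNorm where
  toFun : M → ℝ
  contMDiffOn : ContMDiffOn I 𝓘(ℝ, ℝ) ∞ toFun R.carrier
  nonneg : ∀ x ∈ R.carrier, 0 ≤ toFun x
  act : ∀ x ∈ R.carrier, ∀ t, toFun (R.act t x) = t ^ 2 * toFun x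
  mem_of_eq_zero : ∀ x ∈ R.carrier, toFun x = 0 → x ∈ B
  isCompact_le : ∀ r, IsCompact {x | x ∈ R.carrier ∧ toFun x ≤ r}

variable {R}

instance : Nonempty (Triv R) :=
  ⟨⟨0, ∅, fun _ => 0, Prod.fst, isOpen_empty, by simp, by simp, fun c hc => hc.elim⟩⟩

theorem contMDiffOn_bump_mul_sq [FiniteDimensional ℝ E] [IsManifold I ∞ M] [T2Space M]
    (P : Triv R) {b : M}
    (f : SmoothBumpFunction I b) (hf : tsupport f ⊆ P.base) :
    ContMDiffOn I 𝓘(ℝ, ℝ) ∞ (fun x => f (R.proj x) * ‖P.coord x‖ ^ 2) R.carrier := by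
  intro x hx
  have hU := R.isOpen_carrier.mem_nhds hx
  by_cases hW : R.proj x ∈ P.base
  · have h1 : ContMDiffAt I 𝓘(ℝ, ℝ) ∞ (fun x => f (R.proj x)) x :=
      f.contMDiff.contMDiffAt.comp x (R.contMDiffOn_proj.contMDiffAt hU)
    have h2 : ContMDiffAt I 𝓘(ℝ, ℝ) ∞ (fun x => ‖P.coord x‖ ^ 2) x :=
      (contDiff_norm_sq ℝ (n := ∞)).contMDiff.contMDiffAt.comp x
        (P.contMDiffOn_coord.contMDiffAt (P.isOpen_domain.mem_nhds ⟨hx, hW⟩))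
    exact (h1.mul h2).contMDiffWithinAt
  · have h1 : ∀ᶠ y in 𝓝 x, f (R.proj y) = 0 := by
      have h2 : ∀ᶠ z in 𝓝 (R.proj x), z ∉ tsupport f :=
        (isClosed_tsupport f).isOpen_compl.mem_nhds fun h => hW (hf h)
      filter_upwards [(R.contMDiffOn_proj.contMDiffAt hU).continuousAt.eventually h2] with y hy
      exact image_eq_zero_of_notMem_tsupport hy
    refine ContMDiffAt.contMDiffWithinAt
      ((contMDiffAt_const (c := (0 : ℝ))).congr_of_eventuallyEq ?_)
    filter_upwards [h1] with y hy
    simp [hy]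

theorem nonempty_sqNorm [FiniteDimensional ℝ E] [IsManifold I ∞ M] [T2Space M]
    (hB : IsCompact B) : Nonempty (SqNorm R) := by
  classical
  choose! P hP using fun (b : M) (hb : b ∈ B) => R.exists_triv hb
  have hex : ∀ b ∈ B, ∃ f : SmoothBumpFunction I b, tsupport f ⊆ (P b).base := fun b hb => by
    obtain ⟨f, -, hf⟩ := (SmoothBumpFunction.nhds_basis_tsupport (I := I) b).mem_iff.1
      ((P b).isOpen_base.mem_nhds (hP b hb))
    exact ⟨f, hf⟩
  choose! f hf using hex
  obtain ⟨t, htB, ht⟩ := hB.elim_nhds_subcover (fun b => {x | f b x = 1})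
    fun b hb => (f b).eventuallyEq_one
  have hsmooth : ContMDiffOn I 𝓘(ℝ, ℝ) ∞
      (fun x => ∑ b ∈ t, f b (R.proj x) * ‖(P b).coord x‖ ^ 2) R.carrier :=
    contMDiffOn_finsetSum fun b hb => contMDiffOn_bump_mul_sq (P b) (f b) (hf b (htB b hb))
  have hterm : ∀ x ∈ R.carrier, ∃ b ∈ t, R.proj x ∈ B ∩ {x | f b x = 1} ∧
      ‖(P b).coord x‖ ^ 2 ≤ ∑ b ∈ t, f b (R.proj x) * ‖(P b).coord x‖ ^ 2 := by
    intro x hx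
    obtain ⟨b, hb, hbx⟩ := mem_iUnion₂.1 (ht (proj_mem hx))
    refine ⟨b, hb, ⟨proj_mem hx, hbx⟩, ?_⟩
    have := Finset.single_le_sum (f := fun b => f b (R.proj x) * ‖(P b).coord x‖ ^ 2)
      (fun c _ => mul_nonneg (f c).nonneg (sq_nonneg _)) hb
    simpa [show f b (R.proj x) = 1 from hbx] using this
  have hbase : ∀ b ∈ t, {x | f b x = 1} ⊆ (P b).base := fun b hb x hx =>
    hf b (htB b hb) (subset_tsupport _ (by simp [show f b x = 1 from hx]))
  refine ⟨⟨fun x => ∑ b ∈ t, f b (R.proj x) * ‖(P b).coord x‖ ^ 2, hsmooth, ?_, ?_, ?_, ?_⟩⟩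
  · exact fun x _ => Finset.sum_nonneg fun b _ => mul_nonneg (f b).nonneg (sq_nonneg _)
  · intro x hx s
    rw [Finset.mul_sum]
    refine Finset.sum_congr rfl fun b hb => ?_
    rw [proj_act hx]
    by_cases h : f b (R.proj x) = 0
    · simp [h]
    · rw [(P b).coord_act hx (hf b (htB b hb) (subset_tsupport _ h)), norm_smul, mul_pow,
        Real.norm_eq_abs, sq_abs]
      ring
  · intro x hx h0
    obtain ⟨b, hb, hbx, hle⟩ := hterm x hx
    rw [h0] at hle
    refine ((P b).coord_eq_zero_iff hx (hbase b hb hbx.2)).1 ?_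
    simpa using le_antisymm hle (sq_nonneg _)
  · intro r
    set Z : M → Set M := fun b => (P b).total ''
      ((B ∩ {x | f b x = 1}) ×ˢ Metric.closedBall (0 : EuclideanSpace ℝ (Fin (P b).rank)) √r)
    have hZc : ∀ b ∈ t, IsCompact (Z b) := by
      intro b hb
      have hK : IsCompact (B ∩ {x | f b x = 1}) :=
        hB.inter_right (isClosed_eq (f b).continuous continuous_const)
      refine (hK.prod (isCompact_closedBall _ _)).image_of_continuousOn
        ((P b).contMDiffOn_total.continuousOn.mono ?_)
      exact prod_mono (inter_subset_inter_right _ (hbase b hb)) (subset_univ _)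
    have hZU : IsCompact (⋃ b ∈ t, Z b) := t.isCompact_biUnion hZc
    have hZR : (⋃ b ∈ t, Z b) ⊆ R.carrier := by
      refine iUnion₂_subset fun b hb => ?_
      rintro _ ⟨⟨c, v⟩, ⟨hc, -⟩, rfl⟩
      exact (P b).total_mem hc.1 (hbase b hb hc.2) v
    have e : {x | x ∈ R.carrier ∧ ∑ b ∈ t, f b (R.proj x) * ‖(P b).coord x‖ ^ 2 ≤ r} =
        (⋃ b ∈ t, Z b) ∩ (fun x => ∑ b ∈ t, f b (R.proj x) * ‖(P b).coord x‖ ^ 2) ⁻¹' Iic r := by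
      ext x
      refine ⟨fun hx => ⟨?_, hx.2⟩, fun hx => ⟨hZR hx.1, hx.2⟩⟩
      obtain ⟨b, hb, hbx, hle⟩ := hterm x hx.1
      refine mem_iUnion₂.2 ⟨b, hb, (R.proj x, (P b).coord x), ⟨hbx, ?_⟩,
        (P b).total_coord hx.1 (hbase b hb hbx.2)⟩
      rw [mem_closedBall_zero_iff]
      exact Real.le_sqrt_of_sq_le (hle.trans hx.2)
    rw [e]
    exact hZU.of_isClosed_subset ((hsmooth.continuousOn.mono hZR).preimage_isClosed_of_isClosed
      hZU.isClosed isClosed_Iic) inter_subset_left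

namespace SqNorm

variable (Q : SqNorm R)

instance : CoeFun (SqNorm R) fun _ => M → ℝ := ⟨SqNorm.toFun⟩

theorem apply_of_mem {b : M} (hb : b ∈ B) : Q b = 0 := by
  have := Q.act b (R.subset_carrier hb) 0
  rwa [act_of_mem hb, zero_pow two_ne_zero, zero_mul] at this

theorem exists_le_subset {U : Set M} (hU : IsOpen U) (hBU : B ⊆ U) :
    ∃ c > 0, {x | x ∈ R.carrier ∧ Q x ≤ c} ⊆ U := by
  have hK : IsCompact ({x | x ∈ R.carrier ∧ Q x ≤ 1} \ U) := (Q.isCompact_le 1).diff hU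
  rcases ({x | x ∈ R.carrier ∧ Q x ≤ 1} \ U).eq_empty_or_nonempty with he | hne
  · exact ⟨1, one_pos, sdiff_eq_empty.1 he⟩
  · obtain ⟨z, hz, hmin⟩ := hK.exists_isMinOn hne (Q.contMDiffOn.continuousOn.mono
      fun x hx => hx.1.1)
    have hpos : 0 < Q z := lt_of_le_of_ne (Q.nonneg z hz.1.1) fun h =>
      hz.2 (hBU (Q.mem_of_eq_zero z hz.1.1 h.symm))
    refine ⟨Q z / 2, by positivity, fun x hx => ?_⟩
    by_contra hxU
    have h1 : Q z ≤ 1 := hz.1.2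
    have h2 := hmin (a := x) ⟨⟨hx.1, by linarith [hx.2]⟩, hxU⟩
    simp only [mem_ofPred_eq] at h2
    linarith [hx.2]

end SqNorm

end RegularNeighborhood

namespace RegularNeighborhood

variable {Λ : Type*} [TopologicalSpace Λ]
  {E : Type*} [NormedAddCommGroup E] [NormedSpace ℝ E]
  {H : Type*} [TopologicalSpace H] {I : ModelWithCorners ℝ E H}
  {M : Type*} [TopologicalSpace M] [ChartedSpace H M] {B : Set M}
  (R : RegularNeighborhood I B)

open Classical in
/-- The conjugate `t⁻¹ h t` of a map `h` by the multiplication by `t` in the fibers of a regular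
neighborhood, and for `t = 0` its limit, the fiberwise derivative of `h`. -/
noncomputable def conj (h : M → M) (t : ℝ) (y : M) : M :=
  if t = 0 then @limUnder M _ ℝ ⟨y⟩ (𝓝[≠] 0) (fun s => R.act s⁻¹ (h (R.act s y)))
  else R.act t⁻¹ (h (R.act t y))

variable {R}

theorem conj_of_ne (h : M → M) {t : ℝ} (ht : t ≠ 0) (y : M) :
    R.conj h t y = R.act t⁻¹ (h (R.act t y)) := by
  rw [conj, if_neg ht]

/-- The expression of `conj h` in a local trivialization. -/
noncomputable def Triv.conj (P : Triv R) (h : M → M) (q : ℝ × M) : M :=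
  P.total (R.proj (h (R.act q.1 q.2)), dslope (fun s => P.coord (h (R.act s q.2))) 0 q.1)

theorem Triv.conj_eq_of_ne (P : Triv R) {h : M → M} (hB : MapsTo h B B) {t : ℝ} (ht : t ≠ 0)
    {y : M} (hy : y ∈ R.carrier) (hty : h (R.act t y) ∈ R.carrier)
    (hW : R.proj (h (R.act t y)) ∈ P.base) (hW0 : h (R.proj y) ∈ P.base) :
    R.conj h t y = P.conj h (t, y) := by
  rw [conj_of_ne h ht, P.act_eq hty hW, Triv.conj, dslope_of_ne _ ht, slope_def_module, sub_zero]
  simp only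
  rw [act_zero hy, P.coord_of_mem (hB (proj_mem hy)) hW0, sub_zero]

section Family

variable [IsManifold I ∞ M] {h : Λ → M → M}

theorem smoothFamilyAt_act {t : ℝ} {y : M} (hy : y ∈ R.carrier) (l : Λ) :
    SmoothFamilyAt (𝓘(ℝ, ℝ).prod I) I (fun (_ : Λ) (q : ℝ × M) => R.act q.1 q.2) l (t, y) :=
  .of_contMDiffOn R.contMDiffOn_act
    ((isOpen_univ.prod R.isOpen_carrier).mem_nhds ⟨mem_univ _, hy⟩) l

theorem smoothFamilyAt_comp_act (hh : ∀ l x, SmoothFamilyAt I I h l x) {t : ℝ} {y : M}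
    (hy : y ∈ R.carrier) (l : Λ) :
    SmoothFamilyAt (𝓘(ℝ, ℝ).prod I) I (fun l (q : ℝ × M) => h l (R.act q.1 q.2)) l (t, y) :=
  (hh l (R.act t y)).comp (f := fun (_ : Λ) (q : ℝ × M) => R.act q.1 q.2) (x := (t, y))
    (smoothFamilyAt_act hy l)

theorem Triv.smoothFamilyAt_conj (P : Triv R) (hh : ∀ l x, SmoothFamilyAt I I h l x)
    {l : Λ} {y : M} (hy : y ∈ R.carrier) (hyc : h l (R.proj y) ∈ R.carrier)
    (hW : R.proj (h l (R.proj y)) ∈ P.base) :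
    SmoothFamilyAt (𝓘(ℝ, ℝ).prod I) I (fun l => P.conj (h l)) l (0, y) := by
  have hA := smoothFamilyAt_comp_act hh (t := 0) hy l
  have hdom : h l (R.act 0 y) ∈ R.carrier ∩ R.proj ⁻¹' P.base := by
    rw [act_zero hy]; exact ⟨hyc, hW⟩
  have hev : ∀ᶠ q : Λ × (ℝ × M) in 𝓝 (l, (0, y)), q.2.2 ∈ R.carrier ∧
      h q.1 (R.act q.2.1 q.2.2) ∈ R.carrier ∩ R.proj ⁻¹' P.base := by
    refine .and ?_ (hA.continuousAt.eventually (P.isOpen_domain.mem_nhds hdom))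
    exact (continuousAt_snd.snd (x := (l, ((0 : ℝ), y)))).eventually (R.isOpen_carrier.mem_nhds hy)
  have hD : SmoothFamilyAt (𝓘(ℝ, ℝ).prod I) 𝓘(ℝ, EuclideanSpace ℝ (Fin P.rank))
      (fun l q => dslope (fun s => P.coord (h l (R.act s q.2))) 0 q.1) l (0, y) := by
    refine SmoothFamilyAt.dslope (f := fun l (q : ℝ × M) => P.coord (h l (R.act q.1 q.2))) ?_
    filter_upwards [hev] with q hq
    exact (SmoothFamilyAt.of_contMDiffOn P.contMDiffOn_coord (P.isOpen_domain.mem_nhds hq.2)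
      q.1).comp (f := fun l (q : ℝ × M) => h l (R.act q.1 q.2)) (x := q.2)
      (smoothFamilyAt_comp_act hh hq.1 q.1)
  exact (SmoothFamilyAt.of_contMDiffOn P.contMDiffOn_total_proj
    ((P.isOpen_domain.prod isOpen_univ).mem_nhds ⟨hdom, mem_univ _⟩) l).comp
    (f := fun l (q : ℝ × M) => (h l (R.act q.1 q.2),
      dslope (fun s => P.coord (h l (R.act s q.2))) 0 q.1)) (x := (0, y)) (hA.prodMk hD)

variable [T2Space M]

theorem Triv.conj_zero_eq (P : Triv R) (hh : ∀ l x, SmoothFamilyAt I I h l x)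
    (hB : ∀ l, MapsTo (h l) B B) {l : Λ} {y : M} (hy : y ∈ R.carrier)
    (hW : h l (R.proj y) ∈ P.base) :
    R.conj (h l) 0 y = P.conj (h l) (0, y) := by
  have hb : h l (R.proj y) ∈ B := hB l (proj_mem hy)
  have hW' : R.proj (h l (R.proj y)) ∈ P.base := by rwa [R.proj_eq_self _ hb]
  have hF := (P.smoothFamilyAt_conj hh hy (R.subset_carrier hb) hW').contMDiffAt.continuousAt
  have hA := (smoothFamilyAt_comp_act hh (t := 0) hy l).contMDiffAt.continuousAt
  have hdom : h l (R.act 0 y) ∈ R.carrier ∩ R.proj ⁻¹' P.base := by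
    rw [act_zero hy]; exact ⟨R.subset_carrier hb, hW'⟩
  have ht : Tendsto (fun s : ℝ => (s, y)) (𝓝[≠] 0) (𝓝 (0, y)) :=
    (Continuous.tendsto (by fun_prop) _).mono_left nhdsWithin_le_nhds
  rw [RegularNeighborhood.conj, if_pos rfl]
  refine Tendsto.limUnder_eq ((hF.tendsto.comp ht).congr' ?_)
  filter_upwards [ht.eventually (hA.eventually (P.isOpen_domain.mem_nhds hdom)),
    self_mem_nhdsWithin] with s hs hs0
  rw [Function.comp_apply, ← P.conj_eq_of_ne (hB l) hs0 hy hs.1 hs.2 hW, conj_of_ne _ hs0]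

/-- The conjugates `t⁻¹ h t` are jointly smooth, up to `t = 0`. -/
theorem smoothFamilyAt_conj (hh : ∀ l x, SmoothFamilyAt I I h l x)
    (hB : ∀ l, MapsTo (h l) B B) {l : Λ} {t : ℝ} {y : M} (hy : y ∈ R.carrier)
    (hty : h l (R.act t y) ∈ R.carrier) :
    SmoothFamilyAt (𝓘(ℝ, ℝ).prod I) I (fun l q => R.conj (h l) q.1 q.2) l (t, y) := by
  have hA := smoothFamilyAt_comp_act hh (t := t) hy l
  have hev : ∀ᶠ q : Λ × (ℝ × M) in 𝓝 (l, (t, y)), q.2.2 ∈ R.carrier :=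
    (continuousAt_snd.snd (x := (l, (t, y)))).eventually (R.isOpen_carrier.mem_nhds hy)
  rcases eq_or_ne t 0 with rfl | ht
  · have hb : h l (R.proj y) ∈ B := hB l (proj_mem hy)
    obtain ⟨P, hP⟩ := R.exists_triv hb
    have hW' : R.proj (h l (R.proj y)) ∈ P.base := by rwa [R.proj_eq_self _ hb]
    have hdom : h l (R.act 0 y) ∈ R.carrier ∩ R.proj ⁻¹' P.base := by
      rw [act_zero hy]; exact ⟨R.subset_carrier hb, hW'⟩
    refine (P.smoothFamilyAt_conj hh hy (R.subset_carrier hb) hW').congr ?_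
    have hev2 : ∀ᶠ q : Λ × (ℝ × M) in 𝓝 (l, (0, y)), h q.1 (R.act 0 q.2.2) ∈ P.base := by
      have : ContinuousAt (fun q : Λ × (ℝ × M) => h q.1 (R.act 0 q.2.2)) (l, (0, y)) :=
        ContinuousAt.comp (f := fun q : Λ × (ℝ × M) => (q.1, ((0 : ℝ), q.2.2)))
          (g := fun q : Λ × (ℝ × M) => h q.1 (R.act q.2.1 q.2.2)) hA.continuousAt (by fun_prop)
      refine this.eventually (P.isOpen_base.mem_nhds ?_)
      show h l (R.act 0 y) ∈ P.base
      rwa [act_zero hy]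
    filter_upwards [hev, hev2, hA.continuousAt.eventually (P.isOpen_domain.mem_nhds hdom)]
      with ⟨l', t', y'⟩ h1 h2 h3
    simp only at h1 h2 h3
    rw [act_zero h1] at h2
    rcases eq_or_ne t' 0 with rfl | ht'
    · exact P.conj_zero_eq hh hB h1 h2
    · exact P.conj_eq_of_ne (hB l') ht' h1 h3.1 h3.2 h2
  · have hinv : SmoothFamilyAt (𝓘(ℝ, ℝ).prod I) 𝓘(ℝ, ℝ) (fun (_ : Λ) (q : ℝ × M) => q.1⁻¹) l
        (t, y) := by
      refine .of_contMDiffOn (U := {q | q.1 ≠ 0}) (fun q hq => ?_) ?_ l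
      · exact (((contDiffAt_inv ℝ hq).contMDiffAt (n := ∞)).comp q contMDiffAt_fst).contMDiffWithinAt
      · exact (isOpen_ne_fun continuous_fst continuous_const).mem_nhds ht
    have h1 := (smoothFamilyAt_act (R := R) (t := t⁻¹) hty l).comp
      (f := fun l (q : ℝ × M) => (q.1⁻¹, h l (R.act q.1 q.2))) (x := (t, y)) (hinv.prodMk hA)
    refine h1.congr ?_
    filter_upwards [(continuousAt_snd.fst (x := (l, (t, y)))).eventually_ne ht] with q hq
    exact conj_of_ne _ hq _

end Family

section Single

variable [IsManifold I ∞ M] [T2Space M] {h k : M → M}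

theorem contMDiffAt_conj (hh : ContMDiff I I ∞ h) (hB : MapsTo h B B) {t : ℝ} {y : M}
    (hy : y ∈ R.carrier) (hty : h (R.act t y) ∈ R.carrier) :
    ContMDiffAt (𝓘(ℝ, ℝ).prod I) I ∞ (fun q : ℝ × M => R.conj h q.1 q.2) (t, y) :=
  (smoothFamilyAt_conj (Λ := Unit) (h := fun _ => h) (l := ()) (fun l x => .of_contMDiff hh l x)
    (fun _ => hB) hy hty).contMDiffAt

theorem tendsto_conj_zero (hh : ContMDiff I I ∞ h) (hB : MapsTo h B B) {y : M}
    (hy : y ∈ R.carrier) :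
    Tendsto (fun s => R.conj h s y) (𝓝[≠] 0) (𝓝 (R.conj h 0 y)) := by
  have h1 : h (R.act 0 y) ∈ R.carrier := by
    rw [act_zero hy]; exact R.subset_carrier (hB (proj_mem hy))
  have ht : Tendsto (fun s : ℝ => (s, y)) (𝓝[≠] 0) (𝓝 (0, y)) :=
    (Continuous.tendsto (by fun_prop) _).mono_left nhdsWithin_le_nhds
  exact (contMDiffAt_conj hh hB hy h1).continuousAt.tendsto.comp ht

theorem exists_conj_zero_eq (hh : ContMDiff I I ∞ h) (hB : MapsTo h B B) {y : M}
    (hy : y ∈ R.carrier) (P : Triv R) (hW : h (R.proj y) ∈ P.base) :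
    R.conj h 0 y = P.total (h (R.proj y), deriv (fun s => P.coord (h (R.act s y))) 0) := by
  have := P.conj_zero_eq (Λ := Unit) (h := fun _ => h) (l := ())
    (fun l x => .of_contMDiff hh l x) (fun _ => hB) hy hW
  rw [this, Triv.conj, dslope_same, act_zero hy, R.proj_eq_self _ (hB (proj_mem hy))]

theorem conj_mem (hh : ContMDiff I I ∞ h) (hB : MapsTo h B B) {t : ℝ} {y : M}
    (hy : y ∈ R.carrier) (hty : h (R.act t y) ∈ R.carrier) : R.conj h t y ∈ R.carrier := by
  rcases eq_or_ne t 0 with rfl | ht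
  · obtain ⟨P, hP⟩ := R.exists_triv (hB (proj_mem hy))
    rw [exists_conj_zero_eq hh hB hy P hP]
    exact P.total_mem (hB (proj_mem hy)) hP _
  · rw [conj_of_ne _ ht]
    exact act_mem hty _

theorem proj_conj (hh : ContMDiff I I ∞ h) (hB : MapsTo h B B) {t : ℝ} {y : M}
    (hy : y ∈ R.carrier) (hty : h (R.act t y) ∈ R.carrier) :
    R.proj (R.conj h t y) = R.proj (h (R.act t y)) := by
  rcases eq_or_ne t 0 with rfl | ht
  · obtain ⟨P, hP⟩ := R.exists_triv (hB (proj_mem hy))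
    rw [exists_conj_zero_eq hh hB hy P hP, P.proj_total (hB (proj_mem hy)) hP, act_zero hy,
      R.proj_eq_self _ (hB (proj_mem hy))]
  · rw [conj_of_ne _ ht, proj_act hty]

theorem act_conj (hh : ContMDiff I I ∞ h) (hB : MapsTo h B B) {t : ℝ} {y : M}
    (hy : y ∈ R.carrier) (hty : h (R.act t y) ∈ R.carrier) :
    R.act t (R.conj h t y) = h (R.act t y) := by
  rcases eq_or_ne t 0 with rfl | ht
  · rw [act_zero (conj_mem hh hB hy hty), proj_conj hh hB hy hty, act_zero hy,
      R.proj_eq_self _ (hB (proj_mem hy))]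
  · rw [conj_of_ne _ ht, act_act_inv hty ht]

theorem conj_one {y : M} (hy : y ∈ R.carrier) (hhy : h y ∈ R.carrier) : R.conj h 1 y = h y := by
  rw [conj_of_ne _ one_ne_zero, inv_one, act_one hy, act_one hhy]

theorem conj_of_mem (hh : ContMDiff I I ∞ h) (hB : MapsTo h B B) (t : ℝ) {b : M} (hb : b ∈ B) :
    R.conj h t b = h b := by
  have key : ∀ s ≠ 0, R.conj h s b = h b := fun s hs => by
    rw [conj_of_ne _ hs, act_of_mem hb, act_of_mem (hB hb)]
  rcases eq_or_ne t 0 with rfl | ht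
  · refine tendsto_nhds_unique (tendsto_conj_zero hh hB (R.subset_carrier hb)) ?_
    refine tendsto_const_nhds.congr' ?_
    filter_upwards [self_mem_nhdsWithin] with s hs using (key s hs).symm
  · exact key t ht

theorem conj_act (hh : ContMDiff I I ∞ h) (hB : MapsTo h B B) {t r : ℝ} (hr : r ≠ 0) {y : M}
    (hy : y ∈ R.carrier) (hty : h (R.act (t * r) y) ∈ R.carrier) :
    R.conj h t (R.act r y) = R.act r (R.conj h (t * r) y) := by
  have key : ∀ s ≠ 0, h (R.act (s * r) y) ∈ R.carrier →
      R.conj h s (R.act r y) = R.act r (R.conj h (s * r) y) := fun s hs hsy => by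
    rw [conj_of_ne _ hs, conj_of_ne _ (mul_ne_zero hs hr), act_act hy, act_act hsy]
    congr 1
    field_simp
  rcases eq_or_ne t 0 with rfl | ht
  · rw [zero_mul] at hty ⊢
    have hc : Tendsto (fun s : ℝ => s * r) (𝓝[≠] 0) (𝓝[≠] 0) := by
      refine tendsto_nhdsWithin_iff.2 ⟨?_, ?_⟩
      · have : Tendsto (fun s : ℝ => s * r) (𝓝 0) (𝓝 (0 * r)) :=
          Continuous.tendsto (by fun_prop) _
        rw [zero_mul] at this
        exact this.mono_left nhdsWithin_le_nhds
      · filter_upwards [self_mem_nhdsWithin] with s hs using mul_ne_zero hs hr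
    have h1 := (tendsto_conj_zero hh hB hy).comp hc
    have h2 : Tendsto (fun z => R.act r z) (𝓝 (R.conj h 0 y)) (𝓝 (R.act r (R.conj h 0 y))) := by
      have := (R.contMDiffOn_act.contMDiffAt ((isOpen_univ.prod R.isOpen_carrier).mem_nhds
        (show (r, R.conj h 0 y) ∈ _ from ⟨mem_univ _, conj_mem hh hB hy hty⟩))).continuousAt
      exact this.tendsto.comp (Continuous.tendsto (f := fun z => (r, z)) (by fun_prop) _)
    refine tendsto_nhds_unique (tendsto_conj_zero hh hB (act_mem hy r)) ((h2.comp h1).congr' ?_)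
    have h3 : ∀ᶠ s in 𝓝[≠] (0 : ℝ), h (R.act (s * r) y) ∈ R.carrier := by
      have c1 : ContinuousAt (fun s : ℝ => h (R.act s y)) 0 := by
        have := (R.contMDiffOn_act.contMDiffAt ((isOpen_univ.prod R.isOpen_carrier).mem_nhds
          (show ((0 : ℝ), y) ∈ _ from ⟨mem_univ _, hy⟩))).continuousAt
        exact hh.continuous.continuousAt.comp (this.comp (f := fun s : ℝ => (s, y)) (by fun_prop))
      exact hc.eventually (c1.continuousWithinAt.eventually (R.isOpen_carrier.mem_nhds hty))
    filter_upwards [self_mem_nhdsWithin, h3] with s hs hs3 using (key s hs hs3).symm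
  · exact key t ht hty

theorem conj_conj (hh : ContMDiff I I ∞ h) (hB : MapsTo h B B) (hk : ContMDiff I I ∞ k)
    (hkB : MapsTo k B B) (hkh : Function.LeftInverse k h) {t : ℝ} {y : M}
    (hy : y ∈ R.carrier) (hty : h (R.act t y) ∈ R.carrier) :
    R.conj k t (R.conj h t y) = y := by
  have key : ∀ s ≠ 0, h (R.act s y) ∈ R.carrier → R.conj k s (R.conj h s y) = y :=
    fun s hs hsy => by
      rw [conj_of_ne _ hs, conj_of_ne _ hs, act_act_inv hsy hs, hkh, act_inv_act hy hs]
  rcases eq_or_ne t 0 with rfl | ht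
  · have h0 := conj_mem hh hB hy hty
    have h1 : k (R.act 0 (R.conj h 0 y)) ∈ R.carrier := by
      rw [act_zero h0]
      exact R.subset_carrier (hkB (proj_mem h0))
    have h2 := (contMDiffAt_conj hk hkB h0 h1).continuousAt.tendsto.comp
      ((tendsto_id.mono_right (nhdsWithin_le_nhds (s := {0}ᶜ))).prodMk_nhds
        (tendsto_conj_zero hh hB hy))
    refine tendsto_nhds_unique h2 (tendsto_const_nhds.congr' ?_)
    have c1 : ContinuousAt (fun s : ℝ => h (R.act s y)) 0 := by
      have := (R.contMDiffOn_act.contMDiffAt ((isOpen_univ.prod R.isOpen_carrier).mem_nhds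
        (show ((0 : ℝ), y) ∈ _ from ⟨mem_univ _, hy⟩))).continuousAt
      exact hh.continuous.continuousAt.comp (this.comp (f := fun s : ℝ => (s, y)) (by fun_prop))
    filter_upwards [self_mem_nhdsWithin,
      c1.continuousWithinAt.eventually (R.isOpen_carrier.mem_nhds hty)] with s hs hs'
      using (key s hs hs').symm
  · exact key t ht hty

end Single

end RegularNeighborhood

namespace RegularNeighborhood

variable {E : Type*} [NormedAddCommGroup E] [NormedSpace ℝ E]
  {H : Type*} [TopologicalSpace H] {I : ModelWithCorners ℝ E H}
  {M : Type*} [TopologicalSpace M] [ChartedSpace H M] {B : Set M}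
  {R : RegularNeighborhood I B}

theorem contMDiff_total (P : Triv R) {b : M} (hb : b ∈ B) (hW : b ∈ P.base) :
    ContMDiff 𝓘(ℝ, EuclideanSpace ℝ (Fin P.rank)) I ∞ (fun v => P.total (b, v)) := by
  rw [← contMDiffOn_univ]
  exact P.contMDiffOn_total.comp (contMDiff_const.prodMk contMDiff_id).contMDiffOn
    fun v _ => ⟨⟨hb, hW⟩, mem_univ _⟩

theorem act_total (P : Triv R) {b : M} (hb : b ∈ B) (hW : b ∈ P.base) (t : ℝ)
    (v : EuclideanSpace ℝ (Fin P.rank)) : R.act t (P.total (b, v)) = P.total (b, t • v) := by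
  rw [P.act_eq (P.total_mem hb hW v) (by rwa [P.proj_total hb hW]), P.proj_total hb hW,
    P.coord_total hb hW]

theorem total_zero (P : Triv R) {b : M} (hb : b ∈ B) (hW : b ∈ P.base) :
    P.total (b, 0) = b := by
  have := act_total P hb hW 0 0
  rw [zero_smul, act_zero (P.total_mem hb hW 0), P.proj_total hb hW] at this
  exact this.symm

section

variable [IsManifold I ∞ M] [T2Space M] {h k : M → M}

/-- The fiberwise derivative is linear on the fibers. -/
theorem exists_linearMap_conj_zero (hh : ContMDiff I I ∞ h) (hB : MapsTo h B B) (b c : B)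
    (hc : (c : M) = h b) :
    ∃ T : Fiber R.carrier R.proj (b : M) →ₗ[ℝ] Fiber R.carrier R.proj (c : M),
      ∀ x, (T x : M) = R.conj h 0 x := by
  obtain ⟨P, hP⟩ := R.exists_triv b.2
  obtain ⟨P', hP'⟩ := R.exists_triv c.2
  obtain ⟨T, hT, hT'⟩ := P.exists_linearEquiv b hP
  obtain ⟨T₁, hT₁, hT₁'⟩ := P'.exists_linearEquiv c hP'
  set F : EuclideanSpace ℝ (Fin P.rank) → EuclideanSpace ℝ (Fin P'.rank) :=
    fun v => P'.coord (h (P.total (b, v))) with hF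
  have hdom : h (P.total (b, 0)) ∈ R.carrier ∩ R.proj ⁻¹' P'.base := by
    rw [total_zero P b.2 hP, ← hc]
    exact ⟨R.subset_carrier c.2, by rwa [mem_preimage, R.proj_eq_self _ c.2]⟩
  have hFd : DifferentiableAt ℝ F 0 := by
    have h1 : ContMDiffAt 𝓘(ℝ, EuclideanSpace ℝ (Fin P.rank))
        𝓘(ℝ, EuclideanSpace ℝ (Fin P'.rank)) ∞ F 0 :=
      (P'.contMDiffOn_coord.contMDiffAt (P'.isOpen_domain.mem_nhds hdom)).comp 0
        (hh.comp (contMDiff_total P b.2 hP)).contMDiffAt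
    exact h1.contDiffAt.differentiableAt (by simp)
  refine ⟨T₁.symm.toLinearMap ∘ₗ (fderiv ℝ F 0).toLinearMap ∘ₗ T.toLinearMap, fun x => ?_⟩
  have hx : P.total (b, T x) = x := by rw [← hT', T.symm_apply_apply]
  have hpx : R.proj (x : M) = b := x.2.2
  rw [exists_conj_zero_eq hh hB x.2.1 P' (by rwa [hpx, ← hc])]
  simp only [LinearMap.coe_comp, LinearEquiv.coe_coe, Function.comp_apply, hT₁',
    ContinuousLinearMap.coe_coe, hpx, hc]
  congr 2
  have h2 : (fun s : ℝ => P'.coord (h (R.act s x))) = fun s => F (s • T x) := by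
    funext s
    rw [hF]
    simp only
    rw [← act_total P b.2 hP, hx]
  rw [h2]
  have h3 : HasDerivAt (fun s : ℝ => s • T x) (T x) 0 := by
    simpa using (hasDerivAt_id (0 : ℝ)).smul_const (T x)
  have h4 : HasFDerivAt F (fderiv ℝ F 0) ((0 : ℝ) • T x) := by
    rw [zero_smul]; exact hFd.hasFDerivAt
  exact (h4.comp_hasDerivAt (0 : ℝ) h3).deriv.symm

theorem mapsTo_conj_zero (hh : ContMDiff I I ∞ h) (hB : MapsTo h B B) :
    MapsTo (R.conj h 0) R.carrier R.carrier := fun y hy =>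
  conj_mem hh hB hy (by rw [act_zero hy]; exact R.subset_carrier (hB (proj_mem hy)))

theorem leftInvOn_conj_zero (hh : ContMDiff I I ∞ h) (hB : MapsTo h B B)
    (hk : ContMDiff I I ∞ k) (hkB : MapsTo k B B) (hkh : Function.LeftInverse k h) :
    LeftInvOn (R.conj k 0) (R.conj h 0) R.carrier := fun y hy =>
  conj_conj hh hB hk hkB hkh hy (by rw [act_zero hy]; exact R.subset_carrier (hB (proj_mem hy)))

theorem contMDiffOn_conj_zero (hh : ContMDiff I I ∞ h) (hB : MapsTo h B B) :
    ContMDiffOn I I ∞ (R.conj h 0) R.carrier := fun y hy => by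
  have h1 : h (R.act 0 y) ∈ R.carrier := by
    rw [act_zero hy]; exact R.subset_carrier (hB (proj_mem hy))
  exact ((contMDiffAt_conj hh hB hy h1).comp (f := fun y : M => ((0 : ℝ), y)) y
    (contMDiffAt_const.prodMk contMDiffAt_id)).contMDiffWithinAt

/-- The fiberwise derivative of a diffeomorphism is a bundle isomorphism. -/
theorem isBundleIso_conj_zero (hh : ContMDiff I I ∞ h) (hB : MapsTo h B B)
    (hk : ContMDiff I I ∞ k) (hkB : MapsTo k B B) (hkh : Function.LeftInverse k h)
    (hhk : Function.LeftInverse h k) : R.IsBundleIso (R.conj h 0) := by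
  have hinv : InvOn (R.conj k 0) (R.conj h 0) R.carrier R.carrier :=
    ⟨leftInvOn_conj_zero hh hB hk hkB hkh, leftInvOn_conj_zero hk hkB hh hB hhk⟩
  refine ⟨hinv.bijOn (mapsTo_conj_zero hh hB) (mapsTo_conj_zero hk hkB),
    contMDiffOn_conj_zero hh hB, ⟨R.conj k 0, hinv, contMDiffOn_conj_zero hk hkB⟩, fun b => ?_⟩
  obtain ⟨T, hT⟩ := exists_linearMap_conj_zero (R := R) hh hB b ⟨h b, hB b.2⟩ rfl
  obtain ⟨T', hT'⟩ := exists_linearMap_conj_zero (R := R) hk hkB ⟨h b, hB b.2⟩ b (hkh b).symm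
  refine ⟨⟨h b, hB b.2⟩, LinearEquiv.ofLinearMap T T' ?_ ?_, hT⟩
  · ext x
    simp only [LinearMap.coe_comp, Function.comp_apply, LinearMap.id_coe, id_eq, hT, hT']
    exact hinv.2 x.2.1
  · ext x
    simp only [LinearMap.coe_comp, Function.comp_apply, LinearMap.id_coe, id_eq, hT, hT']
    exact hinv.1 x.2.1

theorem IsBundleIso.act {g : M → M} (hg : R.IsBundleIso g) {y : M} (hy : y ∈ R.carrier) (t : ℝ) :
    g (R.act t y) = R.act t (g y) := by
  obtain ⟨b, x, rfl, -⟩ := exists_fiber hy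
  obtain ⟨c, T, hT⟩ := hg.2.2.2 b
  rw [R.act_coe, ← hT, ← hT, R.act_coe, map_smul]

/-- A diffeomorphism which is a bundle isomorphism near the submanifold coincides there with its
conjugates. -/
theorem conj_eq_of_eqOn (hh : ContMDiff I I ∞ h) (hB : MapsTo h B B) {g : M → M}
    (hg : R.IsBundleIso g) {U : Set M} (hU : IsOpen U) (hhg : EqOn h g U) {t : ℝ}
    {y : M} (hy : y ∈ R.carrier) (hty : R.act t y ∈ U) : R.conj h t y = g y := by
  have key : ∀ s ≠ 0, R.act s y ∈ U → R.conj h s y = g y := fun s hs hsy => by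
    rw [conj_of_ne _ hs, hhg hsy, hg.act hy, act_inv_act (hg.1.mapsTo hy) hs]
  rcases eq_or_ne t 0 with rfl | ht
  · refine tendsto_nhds_unique (tendsto_conj_zero hh hB hy) (tendsto_const_nhds.congr' ?_)
    have c1 : ContinuousAt (fun s : ℝ => R.act s y) 0 := by
      have := (R.contMDiffOn_act.contMDiffAt ((isOpen_univ.prod R.isOpen_carrier).mem_nhds
        (show ((0 : ℝ), y) ∈ _ from ⟨mem_univ _, hy⟩))).continuousAt
      exact this.comp (f := fun s : ℝ => (s, y)) (by fun_prop)
    filter_upwards [self_mem_nhdsWithin,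
      c1.continuousWithinAt.eventually (hU.mem_nhds hty)] with s hs hs' using (key s hs hs').symm
  · exact key t ht hty

end

end RegularNeighborhood

section Inverse

variable {E : Type*} [NormedAddCommGroup E] [NormedSpace ℝ E]

/-- A continuous right inverse of a smooth map with invertible derivative is smooth. -/
theorem ContDiffOn.of_rightInverse [CompleteSpace E] {s t : Set E} {f g : E → E}
    (hs : UniqueDiffOn ℝ s) (ht : UniqueDiffOn ℝ t) (hf : ContDiffOn ℝ ∞ f s)
    (hg : ContinuousOn g t) (hgst : MapsTo g t s) (hfg : ∀ y ∈ t, f (g y) = y)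
    (hinv : ∀ x ∈ s, (fderivWithin ℝ f s x).IsInvertible) : ContDiffOn ℝ ∞ g t := by
  have hd : ∀ y ∈ t, HasFDerivWithinAt g (fderivWithin ℝ f s (g y)).inverse t y := by
    intro y hy
    obtain ⟨e, he⟩ := hinv _ (hgst hy)
    rw [← he, ContinuousLinearMap.inverse_equiv]
    refine HasFDerivWithinAt.of_local_left_inverse (f := f) (t := s)
      (tendsto_nhdsWithin_iff.2 ⟨hg y hy, ?_⟩) ?_ hy ?_
    · filter_upwards [self_mem_nhdsWithin] with w hw using hgst hw
    · rw [he]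
      exact ((hf.differentiableOn (by simp)) _ (hgst hy)).hasFDerivWithinAt
    · filter_upwards [self_mem_nhdsWithin] with w hw using hfg w hw
  have hdiff : DifferentiableOn ℝ g t := fun y hy => (hd y hy).differentiableWithinAt
  refine contDiffOn_infty.2 fun n => ?_
  induction n with
  | zero => exact contDiffOn_zero.2 hg
  | succ n ih =>
    refine (contDiffOn_succ_iff_fderivWithin ht).2 ⟨hdiff, fun h => absurd h (WithTop.natCast_ne_top n), ?_⟩
    have h1 : ContDiffOn ℝ n (fun y => fderivWithin ℝ f s (g y)) t :=
      ((hf.fderivWithin hs (m := n) (by exact_mod_cast le_top)).comp ih hgst)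
    refine ContDiffOn.congr (f := fun y => (fderivWithin ℝ f s (g y)).inverse) ?_
      fun y hy => (hd y hy).fderivWithin (ht y hy)
    intro y hy
    obtain ⟨e, he⟩ := hinv _ (hgst hy)
    have h2 : ContDiffAt ℝ n ContinuousLinearMap.inverse (fderivWithin ℝ f s (g y)) := by
      rw [← he]; exact contDiffAt_map_inverse e
    exact h2.comp_contDiffWithinAt y (h1 y hy)

theorem ContinuousLinearMap.isInvertible_of_injective [FiniteDimensional ℝ E] (A : E →L[ℝ] E)
    (hA : ∀ v, A v = 0 → v = 0) : A.IsInvertible :=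
  ⟨(LinearEquiv.ofInjectiveEndo A.toLinearMap
    ((injective_iff_map_eq_zero A.toLinearMap).2 hA)).toContinuousLinearEquiv, by ext; rfl⟩

variable {H : Type*} [TopologicalSpace H] {I : ModelWithCorners ℝ E H}
  {M : Type*} [TopologicalSpace M] [ChartedSpace H M] [IsManifold I ∞ M]

/-- The inverse of a smooth immersive homeomorphism is smooth. -/
theorem Homeomorph.contMDiff_symm_of_mfderiv [FiniteDimensional ℝ E] (f : M ≃ₜ M)
    (hf : ContMDiff I I ∞ f)
    (hinj : ∀ x, ∀ v : TangentSpace I x, mfderiv I I f x v = 0 → v = 0) :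
    ContMDiff I I ∞ f.symm := by
  intro z
  set x := f.symm z with hx
  have hfx : f x = z := f.apply_symm_apply z
  set F := extChartAt I z ∘ f ∘ (extChartAt I x).symm with hF
  set G := extChartAt I x ∘ f.symm ∘ (extChartAt I z).symm with hG
  set s₀ := (extChartAt I x).target ∩ (extChartAt I x).symm ⁻¹' (univ ∩ f ⁻¹' (extChartAt I z).source)
    with hs₀
  set t₀ := (extChartAt I z).target ∩
    (extChartAt I z).symm ⁻¹' (univ ∩ f.symm ⁻¹' (extChartAt I x).source) with ht₀
  have us : UniqueDiffOn ℝ s₀ :=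
    (uniqueMDiffOn_univ (I := I)).uniqueDiffOn_inter_preimage x z f.continuous.continuousOn
  have ut : UniqueDiffOn ℝ t₀ :=
    (uniqueMDiffOn_univ (I := I)).uniqueDiffOn_inter_preimage z x f.symm.continuous.continuousOn
  have hFs : ContDiffOn ℝ ∞ F s₀ := (contMDiffOn_iff.1 hf.contMDiffOn).2 x z
  have hGt : ContinuousOn G t₀ := by
    refine (continuousOn_extChartAt x).comp (f.symm.continuous.comp_continuousOn
      ((continuousOn_extChartAt_symm z).mono inter_subset_left)) fun y hy => hy.2.2
  have hGst : MapsTo G t₀ s₀ := fun y hy => by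
    refine ⟨(extChartAt I x).map_source hy.2.2, mem_univ _, ?_⟩
    simp only [hG, Function.comp_apply, mem_preimage]
    rw [(extChartAt I x).left_inv hy.2.2, f.apply_symm_apply]
    exact (extChartAt I z).map_target hy.1
  have hFG : ∀ y ∈ t₀, F (G y) = y := fun y hy => by
    simp only [hF, hG, Function.comp_apply]
    rw [(extChartAt I x).left_inv hy.2.2, f.apply_symm_apply, (extChartAt I z).right_inv hy.1]
  have hz : extChartAt I z z ∈ t₀ := by
    refine ⟨mem_extChartAt_target z, mem_univ _, ?_⟩
    rw [mem_preimage, extChartAt_to_inv]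
    exact mem_extChartAt_source x
  have hGz : G (extChartAt I z z) = extChartAt I x x := by
    simp only [hG, Function.comp_apply, extChartAt_to_inv, hx]
  obtain ⟨u, hu, hu'⟩ := (continuousOn_iff'.1 (hFs.fderivWithin us (m := ∞) (by simp)).continuousOn)
    _ (ContinuousLinearEquiv.isOpen (𝕜 := ℝ) (E := E) (F := E))
  obtain ⟨v, hv, hv'⟩ := continuousOn_iff'.1 hGt u hu
  have hmem : ∀ y, y ∈ s₀ → (y ∈ u ↔ (fderivWithin ℝ F s₀ y).IsInvertible) := fun y hy => by
    have := Set.ext_iff.1 hu' y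
    simp only [mem_inter_iff, mem_preimage, hy, and_true] at this
    exact this.symm
  have hu0 : extChartAt I x x ∈ u := by
    have hx0 : extChartAt I x x ∈ s₀ := hGz ▸ hGst hz
    refine (hmem _ hx0).2 (ContinuousLinearMap.isInvertible_of_injective _ fun w hw => ?_)
    have hmd : MDifferentiableAt I I f x := (hf x).mdifferentiableAt (by simp)
    refine hinj x w ?_
    have hnhds : s₀ =ᶠ[𝓝 (extChartAt I x x)] range I := by
      refine (Filter.EventuallyEq.inter (extChartAt_target_eventuallyEq (I := I) (x := x))
        ?_).trans (Filter.EventuallyEq.of_eq (inter_univ _))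
      refine eventuallyEq_univ.2 ((continuousAt_extChartAt_symm x).preimage_mem_nhds ?_)
      rw [extChartAt_to_inv, univ_inter]
      exact f.continuous.continuousAt.preimage_mem_nhds
        (hfx ▸ extChartAt_source_mem_nhds (I := I) (f x))
    rw [fderivWithin_congr_set hnhds] at hw
    refine (DFunLike.congr_fun hmd.mfderiv w).trans ?_
    have : writtenInExtChartAt I I x f = F := by rw [hF, writtenInExtChartAt, hfx]
    rw [this]
    exact hw
  have hv0 : extChartAt I z z ∈ v := by
    have : extChartAt I z z ∈ G ⁻¹' u ∩ t₀ := ⟨by rw [mem_preimage, hGz]; exact hu0, hz⟩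
    rw [hv'] at this
    exact this.1
  have key : ContDiffOn ℝ ∞ G (t₀ ∩ v) := by
    refine ContDiffOn.of_rightInverse (us.inter hu) (ut.inter hv) (hFs.mono inter_subset_left)
      (hGt.mono inter_subset_left) (fun y hy => ⟨hGst hy.1, ?_⟩) (fun y hy => hFG y hy.1) ?_
    · have : y ∈ G ⁻¹' u ∩ t₀ := by rw [hv']; exact ⟨hy.2, hy.1⟩
      exact this.1
    · intro y hy
      rw [fderivWithin_inter (hu.mem_nhds hy.2)]
      exact (hmem y hy.1).1 hy.2
  refine contMDiffAt_iff.2 ⟨f.symm.continuous.continuousAt, ?_⟩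
  refine (key _ ⟨hz, hv0⟩).mono_of_mem_nhdsWithin ?_
  refine inter_mem (inter_mem (extChartAt_target_mem_nhdsWithin z) ?_)
    (mem_nhdsWithin_of_mem_nhds (hv.mem_nhds hv0))
  refine mem_nhdsWithin_of_mem_nhds ((continuousAt_extChartAt_symm z).preimage_mem_nhds ?_)
  rw [extChartAt_to_inv, univ_inter]
  exact f.symm.continuous.continuousAt.preimage_mem_nhds (extChartAt_source_mem_nhds _)

end Inverse

namespace RegularNeighborhood

variable {Λ : Type*} [TopologicalSpace Λ]
  {E : Type*} [NormedAddCommGroup E] [NormedSpace ℝ E]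
  {H : Type*} [TopologicalSpace H] {I : ModelWithCorners ℝ E H}
  {M : Type*} [TopologicalSpace M] [ChartedSpace H M] {B : Set M}
  {R : RegularNeighborhood I B} (Q : SqNorm R)

namespace SqNorm

/-- The sublevel set of a fiber metric on which a diffeomorphism is deformed. -/
def tube (ε : ℝ) : Set M := {x | x ∈ R.carrier ∧ Q x ≤ 2 * ε ^ 2}

/-- A function equal to `s` on the `ε`-tube, and to `1` outside of the `√2 ε`-tube. -/
noncomputable def cutoff (ε s : ℝ) (x : M) : ℝ :=
  s + (1 - s) * Real.smoothTransition (Q x / ε ^ 2 - 1)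

open Classical in
/-- A diffeomorphism deformed to its fiberwise derivative in a tube. -/
noncomputable def deform (h : M → M) (ε s : ℝ) (x : M) : M :=
  if x ∈ Q.tube ε then R.conj h (Q.cutoff ε s x) x else h x

variable {Q}

theorem cutoff_mem {s : ℝ} (hs : s ∈ Icc (0 : ℝ) 1) (ε : ℝ) (x : M) :
    Q.cutoff ε s x ∈ Icc (0 : ℝ) 1 := by
  have h0 := Real.smoothTransition.nonneg (Q x / ε ^ 2 - 1)
  have h1 := Real.smoothTransition.le_one (Q x / ε ^ 2 - 1)
  rw [cutoff]
  constructor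
  · have := mul_nonneg (sub_nonneg.2 hs.2) h0
    linarith [hs.1]
  · have := mul_le_mul_of_nonneg_left h1 (sub_nonneg.2 hs.2)
    linarith

theorem cutoff_of_le {ε : ℝ} (hε : 0 < ε) (s : ℝ) {x : M} (hx : Q x ≤ ε ^ 2) :
    Q.cutoff ε s x = s := by
  have : Q x / ε ^ 2 ≤ 1 := (div_le_one (by positivity)).2 hx
  rw [cutoff, Real.smoothTransition.zero_of_nonpos (by linarith), mul_zero, add_zero]

theorem cutoff_of_ge {ε : ℝ} (hε : 0 < ε) (s : ℝ) {x : M} (hx : 2 * ε ^ 2 ≤ Q x) :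
    Q.cutoff ε s x = 1 := by
  have : 2 ≤ Q x / ε ^ 2 := (le_div_iff₀ (by positivity)).2 hx
  rw [cutoff, Real.smoothTransition.one_of_one_le (by linarith)]
  ring

theorem cutoff_one (ε : ℝ) (x : M) : Q.cutoff ε 1 x = 1 := by
  rw [cutoff]; ring

theorem isCompact_tube (ε : ℝ) : IsCompact (Q.tube ε) := Q.isCompact_le _

theorem subset_tube (ε : ℝ) : B ⊆ Q.tube ε := fun b hb =>
  ⟨R.subset_carrier hb, by rw [Q.apply_of_mem hb]; positivity⟩

theorem deform_of_mem {h : M → M} {ε s : ℝ} {x : M} (hx : x ∈ Q.tube ε) :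
    Q.deform h ε s x = R.conj h (Q.cutoff ε s x) x := if_pos hx

theorem deform_of_notMem {h : M → M} {ε s : ℝ} {x : M} (hx : x ∉ Q.tube ε) :
    Q.deform h ε s x = h x := if_neg hx

variable [IsManifold I ∞ M] [T2Space M]

theorem deform_eq_conj {h : M → M} {ε s : ℝ} (hε : 0 < ε) {x : M} (hx : x ∈ R.carrier)
    (hhx : h x ∈ R.carrier) : Q.deform h ε s x = R.conj h (Q.cutoff ε s x) x := by
  by_cases hxt : x ∈ Q.tube ε
  · exact deform_of_mem hxt
  · have : 2 * ε ^ 2 ≤ Q x := by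
      by_contra! hlt
      exact hxt ⟨hx, hlt.le⟩
    rw [deform_of_notMem hxt, cutoff_of_ge hε s this, conj_one hx hhx]

theorem deform_one {h : M → M} {ε : ℝ}
    (hmem : ∀ x ∈ Q.tube ε, h x ∈ R.carrier) : Q.deform h ε 1 = h := by
  funext x
  by_cases hxt : x ∈ Q.tube ε
  · rw [deform_of_mem hxt, cutoff_one, conj_one hxt.1 (hmem x hxt)]
  · exact deform_of_notMem hxt

section Family

theorem contDiff_cutoff_expr : ContDiff ℝ ∞
    (fun q : ℝ × ℝ × ℝ => q.2.1 + (1 - q.2.1) * Real.smoothTransition (q.1 * q.2.2 - 1)) := by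
  have h1 : ContDiff ℝ ∞ (fun q : ℝ × ℝ × ℝ => Real.smoothTransition (q.1 * q.2.2 - 1)) :=
    Real.smoothTransition.contDiff.comp (by fun_prop)
  fun_prop

theorem smoothFamilyAt_cutoff {ε s : Λ → ℝ} (hε : Continuous ε) (hs : Continuous s)
    (hpos : ∀ l, 0 < ε l) {x : M} (hx : x ∈ R.carrier) (l : Λ) :
    SmoothFamilyAt I 𝓘(ℝ, ℝ) (fun l x => Q.cutoff (ε l) (s l) x) l x := by
  have hΨ : ContMDiff (𝓘(ℝ, ℝ).prod (𝓘(ℝ, ℝ).prod 𝓘(ℝ, ℝ))) 𝓘(ℝ, ℝ) ∞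
      (fun q : ℝ × ℝ × ℝ => q.2.1 + (1 - q.2.1) * Real.smoothTransition (q.1 * q.2.2 - 1)) := by
    have := contDiff_cutoff_expr.contMDiff
    rwa [modelWithCornersSelf_prod, modelWithCornersSelf_prod, ← chartedSpaceSelf_prod,
      ← chartedSpaceSelf_prod] at this
  have h1 : SmoothFamilyAt I (𝓘(ℝ, ℝ).prod (𝓘(ℝ, ℝ).prod 𝓘(ℝ, ℝ)))
      (fun l (x : M) => (Q x, s l, (ε l ^ 2)⁻¹)) l x := by
    refine (SmoothFamilyAt.of_contMDiffOn Q.contMDiffOn (R.isOpen_carrier.mem_nhds hx) l).prodMk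
      ((SmoothFamilyAt.of_parameter hs.continuousAt x).prodMk
        (SmoothFamilyAt.of_parameter (c := fun l => (ε l ^ 2)⁻¹) ?_ x))
    exact (hε.pow 2).continuousAt.inv₀ (pow_pos (hpos l) 2).ne'
  exact (SmoothFamilyAt.of_contMDiff hΨ l _).comp
    (f := fun l (x : M) => (Q x, s l, (ε l ^ 2)⁻¹)) (x := x) h1

variable {h : Λ → M → M} {ε s : Λ → ℝ}

theorem smoothFamilyAt_conj_cutoff (hh : ∀ l x, SmoothFamilyAt I I h l x)
    (hB : ∀ l, MapsTo (h l) B B) (hε : Continuous ε) (hs : Continuous s) (hpos : ∀ l, 0 < ε l)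
    {l : Λ} {x : M} (hx : x ∈ R.carrier)
    (hhx : h l (R.act (Q.cutoff (ε l) (s l) x) x) ∈ R.carrier) :
    SmoothFamilyAt I I (fun l x => R.conj (h l) (Q.cutoff (ε l) (s l) x) x) l x :=
  (smoothFamilyAt_conj hh hB hx hhx).comp
    (f := fun l (x : M) => (Q.cutoff (ε l) (s l) x, x)) (x := x)
    ((smoothFamilyAt_cutoff hε hs hpos hx l).prodMk (.of_contMDiff contMDiff_id l x))

theorem deform_eventuallyEq_conj (hh : ∀ l x, SmoothFamilyAt I I h l x) (hpos : ∀ l, 0 < ε l)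
    {l : Λ} {x : M} (hx : x ∈ R.carrier) (hhx : h l x ∈ R.carrier) :
    ∀ᶠ q : Λ × M in 𝓝 (l, x), Q.deform (h q.1) (ε q.1) (s q.1) q.2 =
      R.conj (h q.1) (Q.cutoff (ε q.1) (s q.1) q.2) q.2 := by
  filter_upwards [(continuousAt_snd (p := (l, x))).eventually (R.isOpen_carrier.mem_nhds hx),
    (hh l x).continuousAt.eventually (R.isOpen_carrier.mem_nhds hhx)] with q hq1 hq2
  exact deform_eq_conj (hpos _) hq1 hq2

theorem deform_eventuallyEq_self (hε : Continuous ε) {l : Λ} {x : M}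
    (hx : x ∉ Q.tube (ε l)) :
    ∀ᶠ q : Λ × M in 𝓝 (l, x), Q.deform (h q.1) (ε q.1) (s q.1) q.2 = h q.1 q.2 := by
  obtain ⟨r, hr, hxr⟩ : ∃ r, 2 * ε l ^ 2 < r ∧ x ∉ {x | x ∈ R.carrier ∧ Q x ≤ r} := by
    by_cases hxc : x ∈ R.carrier
    · have : 2 * ε l ^ 2 < Q x := by
        by_contra! hlt
        exact hx ⟨hxc, hlt⟩
      obtain ⟨r, h1, h2⟩ := exists_between this
      exact ⟨r, h1, fun h => absurd h.2 (not_le.2 h2)⟩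
    · exact ⟨_, lt_add_one _, fun h => hxc h.1⟩
  have hc : ContinuousAt (fun q : Λ × M => 2 * ε q.1 ^ 2) (l, x) := by fun_prop
  filter_upwards [hc.eventually (gt_mem_nhds hr), (continuousAt_snd (p := (l, x))).eventually
    ((Q.isCompact_le r).isClosed.isOpen_compl.mem_nhds hxr)] with q h1 h2
  exact deform_of_notMem fun h3 => h2 ⟨h3.1, h3.2.trans h1.le⟩

/-- The deformed diffeomorphisms depend smoothly on the point, jointly continuously with the
parameters. -/
theorem smoothFamilyAt_deform (hh : ∀ l x, SmoothFamilyAt I I h l x)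
    (hB : ∀ l, MapsTo (h l) B B) (hε : Continuous ε) (hs : Continuous s) (hpos : ∀ l, 0 < ε l)
    (hs' : ∀ l, s l ∈ Icc (0 : ℝ) 1)
    (hmem : ∀ l, ∀ t ∈ Icc (0 : ℝ) 1, ∀ y ∈ Q.tube (ε l), h l (R.act t y) ∈ R.carrier)
    (l : Λ) (x : M) : SmoothFamilyAt I I (fun l => Q.deform (h l) (ε l) (s l)) l x := by
  by_cases hx : x ∈ Q.tube (ε l)
  · have hhx := hmem l 1 (by simp) x hx
    rw [act_one hx.1] at hhx
    exact (smoothFamilyAt_conj_cutoff hh hB hε hs hpos hx.1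
      (hmem l _ (cutoff_mem (hs' l) _ _) x hx)).congr (deform_eventuallyEq_conj hh hpos hx.1 hhx)
  · exact (hh l x).congr (deform_eventuallyEq_self hε hx)

end Family

end SqNorm

end RegularNeighborhood

namespace RegularNeighborhood

variable {E : Type*} [NormedAddCommGroup E] [NormedSpace ℝ E]
  {H : Type*} [TopologicalSpace H] {I : ModelWithCorners ℝ E H}
  {M : Type*} [TopologicalSpace M] [ChartedSpace H M] {B : Set M}
  {R : RegularNeighborhood I B} (Q : SqNorm R)

namespace SqNorm

/-- The size `ε` of the tube is small enough for the diffeomorphism `h` with inverse `k` to be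
deformed in it. -/
structure IsAdapted (h k : M → M) (ε : ℝ) : Prop where
  contMDiff : ContMDiff I I ∞ h
  contMDiff_inv : ContMDiff I I ∞ k
  leftInverse : Function.LeftInverse k h
  rightInverse : Function.RightInverse k h
  mapsTo : MapsTo h B B
  mapsTo_inv : MapsTo k B B
  pos : 0 < ε
  mem : ∀ t ∈ Icc (0 : ℝ) 1, ∀ y ∈ Q.tube ε, h (R.act t y) ∈ R.carrier
  abs_deriv_le : ∀ t ∈ Icc (0 : ℝ) 1, ∀ y ∈ Q.tube ε, ∀ q : ℝ,
    |deriv Real.smoothTransition q| *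
      |deriv (fun r => Q (R.conj k r (R.conj h t y))) t| ≤ ε ^ 2 / 2

variable {Q}

namespace IsAdapted

variable [IsManifold I ∞ M] [T2Space M] {h k : M → M} {ε s t : ℝ} {y z : M}

theorem conj_conj (ha : Q.IsAdapted h k ε) (ht : t ∈ Icc (0 : ℝ) 1) (hy : y ∈ Q.tube ε) :
    R.conj k t (R.conj h t y) = y :=
  RegularNeighborhood.conj_conj ha.contMDiff ha.mapsTo ha.contMDiff_inv ha.mapsTo_inv
    ha.leftInverse hy.1 (ha.mem t ht y hy)

theorem conj_mem (ha : Q.IsAdapted h k ε) (ht : t ∈ Icc (0 : ℝ) 1) (hy : y ∈ Q.tube ε) :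
    R.conj h t y ∈ R.carrier :=
  RegularNeighborhood.conj_mem ha.contMDiff ha.mapsTo hy.1 (ha.mem t ht y hy)

theorem inv_act_conj (ha : Q.IsAdapted h k ε) (ht : t ∈ Icc (0 : ℝ) 1) (hy : y ∈ Q.tube ε) :
    k (R.act t (R.conj h t y)) = R.act t y := by
  rw [act_conj ha.contMDiff ha.mapsTo hy.1 (ha.mem t ht y hy), ha.leftInverse]

theorem contMDiffAt_conj_inv (ha : Q.IsAdapted h k ε) (ht : t ∈ Icc (0 : ℝ) 1)
    (hy : y ∈ Q.tube ε) :
    ContMDiffAt (𝓘(ℝ, ℝ).prod I) I ∞ (fun q : ℝ × M => R.conj k q.1 q.2) (t, R.conj h t y) :=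
  contMDiffAt_conj ha.contMDiff_inv ha.mapsTo_inv (ha.conj_mem ht hy)
    (by rw [ha.inv_act_conj ht hy]; exact act_mem hy.1 t)

theorem contMDiffAt_conj_inv_left (ha : Q.IsAdapted h k ε) (ht : t ∈ Icc (0 : ℝ) 1)
    (hy : y ∈ Q.tube ε) :
    ContMDiffAt 𝓘(ℝ, ℝ) I ∞ (fun r : ℝ => R.conj k r (R.conj h t y)) t :=
  (ha.contMDiffAt_conj_inv ht hy).comp (f := fun r : ℝ => (r, R.conj h t y)) t
    (contMDiffAt_id.prodMk contMDiffAt_const)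

theorem exists_hasDerivAt_cutoff (ha : Q.IsAdapted h k ε) (hs : s ∈ Icc (0 : ℝ) 1)
    (ht : t ∈ Icc (0 : ℝ) 1) (hy : y ∈ Q.tube ε) :
    ∃ d : ℝ, |d| ≤ 1 / 2 ∧
      HasDerivAt (fun r => Q.cutoff ε s (R.conj k r (R.conj h t y))) d t := by
  set f := fun r => Q (R.conj k r (R.conj h t y)) with hf
  have h1 : ContMDiffAt 𝓘(ℝ, ℝ) 𝓘(ℝ, ℝ) ∞ f t :=
    (Q.contMDiffOn.contMDiffAt (R.isOpen_carrier.mem_nhds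
      (by rw [ha.conj_conj ht hy]; exact hy.1))).comp t (ha.contMDiffAt_conj_inv_left ht hy)
  have h2 : HasDerivAt f (deriv f t) t := (h1.contDiffAt.differentiableAt (by simp)).hasDerivAt
  have h3 : HasDerivAt Real.smoothTransition
      (deriv Real.smoothTransition (f t / ε ^ 2 - 1)) (f t / ε ^ 2 - 1) :=
    ((Real.smoothTransition.contDiff (n := 1)).differentiable (by simp) _).hasDerivAt
  have h4 := (h3.comp t ((h2.div_const (ε ^ 2)).sub_const 1)).const_mul (1 - s) |>.const_add s
  refine ⟨_, ?_, h4⟩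
  have hε : 0 < ε ^ 2 := pow_pos ha.pos 2
  have h5 := ha.abs_deriv_le t ht y hy (f t / ε ^ 2 - 1)
  rw [abs_mul, abs_mul, abs_div, abs_of_pos hε, abs_of_nonneg (sub_nonneg.2 hs.2), ← mul_div_assoc]
  calc (1 - s) * (|deriv Real.smoothTransition (f t / ε ^ 2 - 1)| * |deriv f t| / ε ^ 2)
      ≤ 1 * (ε ^ 2 / 2 / ε ^ 2) := by
        gcongr
        linarith [hs.1]
    _ = 1 / 2 := by rw [div_div_cancel_left' hε.ne', one_mul]; norm_num

open Classical in
/-- The fixed points of this function are the values of the cutoff function at the preimages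
of `z` under the deformed diffeomorphism. -/
noncomputable def _root_.RegularNeighborhood.SqNorm.level (Q : SqNorm R) (h k : M → M) (ε s : ℝ)
    (z : M) (r : ℝ) : ℝ :=
  if ∃ w ∈ Q.tube ε, R.conj h r w = z then Q.cutoff ε s (R.conj k r z) else 1

theorem level_mem (hs : s ∈ Icc (0 : ℝ) 1) (h k : M → M) (ε : ℝ) (z : M) (r : ℝ) :
    Q.level h k ε s z r ∈ Icc (0 : ℝ) 1 := by
  rw [level]
  split_ifs
  · exact cutoff_mem hs _ _
  · simp

theorem level_conj (ha : Q.IsAdapted h k ε) (ht : t ∈ Icc (0 : ℝ) 1) (hy : y ∈ Q.tube ε) :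
    Q.level h k ε s (R.conj h t y) t = Q.cutoff ε s y := by
  rw [level, if_pos ⟨y, hy, rfl⟩, ha.conj_conj ht hy]

theorem isClosed_levels (ha : Q.IsAdapted h k ε) (z : M) :
    IsClosed {r | r ∈ Icc (0 : ℝ) 1 ∧ ∃ w ∈ Q.tube ε, R.conj h r w = z} := by
  have hK : IsCompact (Icc (0 : ℝ) 1 ×ˢ Q.tube ε) := isCompact_Icc.prod (isCompact_tube ε)
  have hc : ContinuousOn (fun q : ℝ × M => R.conj h q.1 q.2) (Icc (0 : ℝ) 1 ×ˢ Q.tube ε) :=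
    fun q hq => (contMDiffAt_conj ha.contMDiff ha.mapsTo hq.2.1
      (ha.mem _ hq.1 _ hq.2)).continuousAt.continuousWithinAt
  have h1 := (hK.of_isClosed_subset (hc.preimage_isClosed_of_isClosed hK.isClosed
    (isClosed_singleton (x := z))) inter_subset_left).image continuous_fst
  convert h1.isClosed using 1
  ext r
  constructor
  · rintro ⟨hr, w, hw, hz⟩
    exact ⟨(r, w), ⟨⟨hr, hw⟩, hz⟩, rfl⟩
  · rintro ⟨⟨r, w⟩, ⟨⟨hr, hw⟩, hz⟩, rfl⟩
    exact ⟨hr, w, hw, hz⟩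

theorem exists_hasDerivWithinAt_level (ha : Q.IsAdapted h k ε) (hs : s ∈ Icc (0 : ℝ) 1) (z : M)
    (ht : t ∈ Icc (0 : ℝ) 1) :
    ∃ d : ℝ, ‖d‖ ≤ 1 / 2 ∧ HasDerivWithinAt (Q.level h k ε s z) d (Icc 0 1) t := by
  by_cases hz : ∃ w ∈ Q.tube ε, R.conj h t w = z
  · obtain ⟨w, hw, rfl⟩ := hz
    obtain ⟨d, hd, hd'⟩ := ha.exists_hasDerivAt_cutoff hs ht hw
    refine ⟨d, hd, hd'.hasDerivWithinAt.congr_of_eventuallyEq ?_ ?_⟩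
    · have hzc := ha.conj_mem ht hw
      have c1 : ContinuousAt (fun r : ℝ => k (R.act r (R.conj h t w))) t := by
        have := (R.contMDiffOn_act.contMDiffAt ((isOpen_univ.prod R.isOpen_carrier).mem_nhds
          (show (t, R.conj h t w) ∈ _ from ⟨mem_univ _, hzc⟩))).continuousAt
        exact ha.contMDiff_inv.continuous.continuousAt.comp
          (this.comp (f := fun s : ℝ => (s, R.conj h t w)) (by fun_prop))
      have h1 := c1.eventually (R.isOpen_carrier.mem_nhds
        (by beta_reduce; rw [ha.inv_act_conj ht hw]; exact act_mem hw.1 t))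
      filter_upwards [self_mem_nhdsWithin, nhdsWithin_le_nhds h1] with r hr hr'
      rw [level]
      split_ifs with hex
      · rfl
      · have hw' : R.conj k r (R.conj h t w) ∈ R.carrier :=
          RegularNeighborhood.conj_mem ha.contMDiff_inv ha.mapsTo_inv hzc hr'
        have hnot : R.conj k r (R.conj h t w) ∉ Q.tube ε := fun hmem =>
          hex ⟨_, hmem, RegularNeighborhood.conj_conj ha.contMDiff_inv ha.mapsTo_inv
            ha.contMDiff ha.mapsTo ha.rightInverse hzc hr'⟩
        rw [cutoff_of_ge ha.pos]
        by_contra! hlt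
        exact hnot ⟨hw', hlt.le⟩
    · rw [ha.level_conj ht hw, ha.conj_conj ht hw]
  · refine ⟨0, by simp, (hasDerivWithinAt_const t _ (1 : ℝ)).congr_of_eventuallyEq ?_ ?_⟩
    · have h1 := (ha.isClosed_levels z).isOpen_compl.mem_nhds (x := t) fun h => hz h.2
      filter_upwards [self_mem_nhdsWithin, nhdsWithin_le_nhds h1] with r hr hr'
      rw [level, if_neg fun h => hr' ⟨hr, h⟩]
    · rw [level, if_neg hz]

theorem abs_level_sub_le (ha : Q.IsAdapted h k ε) (hs : s ∈ Icc (0 : ℝ) 1) (z : M) {r : ℝ}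
    (ht : t ∈ Icc (0 : ℝ) 1) (hr : r ∈ Icc (0 : ℝ) 1) :
    |Q.level h k ε s z r - Q.level h k ε s z t| ≤ 1 / 2 * |r - t| := by
  have : ∀ t, ∃ d : ℝ, t ∈ Icc (0 : ℝ) 1 →
      ‖d‖ ≤ 1 / 2 ∧ HasDerivWithinAt (Q.level h k ε s z) d (Icc 0 1) t := fun t => by
    by_cases ht : t ∈ Icc (0 : ℝ) 1
    · obtain ⟨d, hd⟩ := ha.exists_hasDerivWithinAt_level hs z ht
      exact ⟨d, fun _ => hd⟩
    · exact ⟨0, fun h => absurd h ht⟩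
  choose d hd using this
  exact (convex_Icc (0 : ℝ) 1).norm_image_sub_le_of_norm_hasDerivWithin_le
    (fun x hx => (hd x hx).2) (fun x hx => (hd x hx).1) ht hr

theorem eq_of_level_eq (ha : Q.IsAdapted h k ε) (hs : s ∈ Icc (0 : ℝ) 1) (z : M) {r : ℝ}
    (ht : t ∈ Icc (0 : ℝ) 1) (hr : r ∈ Icc (0 : ℝ) 1) (ht' : Q.level h k ε s z t = t)
    (hr' : Q.level h k ε s z r = r) : r = t := by
  have := ha.abs_level_sub_le hs z ht hr
  rw [ht', hr'] at this
  have h1 : |r - t| = 0 := by linarith [abs_nonneg (r - t)]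
  linarith [abs_eq_zero.1 h1]

theorem exists_level_eq (ha : Q.IsAdapted h k ε) (hs : s ∈ Icc (0 : ℝ) 1) (z : M) :
    ∃ r ∈ Icc (0 : ℝ) 1, Q.level h k ε s z r = r := by
  have hc : ContinuousOn (Q.level h k ε s z) (Icc 0 1) := fun t ht => by
    obtain ⟨d, -, hd⟩ := ha.exists_hasDerivWithinAt_level hs z ht
    exact hd.continuousWithinAt
  exact exists_mem_Icc_isFixedPt_of_mapsTo hc zero_le_one fun r _ => level_mem hs h k ε z r

/-- The value at `z = deform x` of the parameter for which `x` is obtained from `z`. -/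
theorem level_deform (ha : Q.IsAdapted h k ε) (hs : s ∈ Icc (0 : ℝ) 1) (x : M) :
    ∃ r ∈ Icc (0 : ℝ) 1, Q.level h k ε s (Q.deform h ε s x) r = r ∧
      (x ∈ Q.tube ε → Q.deform h ε s x = R.conj h r x) ∧ (x ∉ Q.tube ε → r = 1) := by
  by_cases hx : x ∈ Q.tube ε
  · refine ⟨Q.cutoff ε s x, cutoff_mem hs _ _, ?_, fun _ => deform_of_mem hx, fun h => absurd hx h⟩
    rw [deform_of_mem hx, ha.level_conj (cutoff_mem hs _ _) hx]
  · refine ⟨1, by simp, ?_, fun h => absurd h hx, fun _ => rfl⟩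
    rw [deform_of_notMem hx, level, if_neg]
    rintro ⟨w, hw, hwx⟩
    have h1 := ha.mem 1 (by simp) w hw
    rw [act_one hw.1] at h1
    rw [conj_one hw.1 h1] at hwx
    rw [ha.leftInverse.injective hwx] at hw
    exact hx hw

theorem deform_injective (ha : Q.IsAdapted h k ε) (hs : s ∈ Icc (0 : ℝ) 1) :
    Function.Injective (Q.deform h ε s) := by
  have hone : ∀ w ∈ Q.tube ε, R.conj h 1 w = h w := fun w hw => by
    have h1 := ha.mem 1 (by simp) w hw
    rw [act_one hw.1] at h1
    exact conj_one hw.1 h1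
  intro x y hxy
  obtain ⟨r, hr, h1, h2, h3⟩ := ha.level_deform hs x
  obtain ⟨t, ht, h4, h5, h6⟩ := ha.level_deform hs y
  rw [hxy] at h1
  obtain rfl := ha.eq_of_level_eq hs _ ht hr h4 h1
  by_cases hx : x ∈ Q.tube ε <;> by_cases hy : y ∈ Q.tube ε
  · rw [h2 hx, h5 hy] at hxy
    rw [← ha.conj_conj hr hx, hxy, ha.conj_conj hr hy]
  · obtain rfl := h6 hy
    rw [h2 hx, deform_of_notMem hy, hone x hx] at hxy
    exact ha.leftInverse.injective hxy
  · obtain rfl := h3 hx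
    rw [h5 hy, deform_of_notMem hx, hone y hy] at hxy
    exact ha.leftInverse.injective hxy
  · rw [deform_of_notMem hx, deform_of_notMem hy] at hxy
    exact ha.leftInverse.injective hxy

theorem deform_surjective (ha : Q.IsAdapted h k ε) (hs : s ∈ Icc (0 : ℝ) 1) :
    Function.Surjective (Q.deform h ε s) := by
  intro z
  obtain ⟨r, hr, hz⟩ := ha.exists_level_eq hs z
  by_cases hex : ∃ w ∈ Q.tube ε, R.conj h r w = z
  · obtain ⟨w, hw, rfl⟩ := hex
    rw [ha.level_conj hr hw] at hz
    exact ⟨w, by rw [deform_of_mem hw, hz]⟩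
  · rw [level, if_neg hex] at hz
    subst hz
    refine ⟨k z, ?_⟩
    rw [deform_of_notMem, ha.rightInverse]
    intro hk
    have h1 := ha.mem 1 (by simp) _ hk
    rw [act_one hk.1] at h1
    exact hex ⟨k z, hk, by rw [conj_one hk.1 h1, ha.rightInverse]⟩

end IsAdapted

end SqNorm

end RegularNeighborhood

/-- A continuous bijection which coincides with a homeomorphism outside of a compact set is a
closed map. -/
theorem isClosedMap_of_eqOn_compl {X Y : Type*} [TopologicalSpace X] [TopologicalSpace Y]
    [T2Space Y] {f g : X → Y} (hf : Continuous f) (hg : Continuous g) (hgc : IsClosedMap g)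
    {C : Set X} (hC : IsCompact C) (hfg : EqOn f g Cᶜ) : IsClosedMap f := by
  intro F hF
  have h1 : f '' F = f '' (F ∩ C) ∪ g '' (F ∩ closure Cᶜ) := by
    rw [← ((hfg.closure hf hg).mono inter_subset_right).image_eq, ← image_union,
      ← inter_union_distrib_left, eq_univ_of_forall (s := C ∪ closure Cᶜ) ?_, inter_univ]
    intro x
    by_cases hx : x ∈ C
    · exact Or.inl hx
    · exact Or.inr (subset_closure hx)
  rw [h1]
  exact ((hC.inter_left hF).image hf).isClosed.union (hgc _ (hF.inter isClosed_closure))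

section
variable {E : Type*} [NormedAddCommGroup E] [NormedSpace ℝ E]
  {H : Type*} [TopologicalSpace H] {I : ModelWithCorners ℝ E H}
  {M : Type*} [TopologicalSpace M] [ChartedSpace H M]
  {E' : Type*} [NormedAddCommGroup E'] [NormedSpace ℝ E']
  {H' : Type*} [TopologicalSpace H'] {J : ModelWithCorners ℝ E' H'}
  {N : Type*} [TopologicalSpace N] [ChartedSpace H' N]

theorem mfderiv_comp_prodMk_of_eq_zero {m : M → ℝ} {f : M → M} {P : ℝ × M → N} {x : M}
    (hm : MDifferentiableAt I 𝓘(ℝ, ℝ) m x) (hf : MDifferentiableAt I I f x)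
    (hP : MDifferentiableAt (𝓘(ℝ, ℝ).prod I) J P (m x, f x)) (v : TangentSpace I x)
    (hv : mfderiv I I f x v = 0) :
    mfderiv I J (fun y => P (m y, f y)) x v =
      mfderiv 𝓘(ℝ, ℝ) J (fun r => P (r, f x)) (m x) (mfderiv I 𝓘(ℝ, ℝ) m x v) := by
  have h1 : HasMFDerivAt I J (fun y => P (m y, f y)) x _ :=
    HasMFDerivAt.comp x hP.hasMFDerivAt (hm.hasMFDerivAt.prodMk hf.hasMFDerivAt)
  have h2 : HasMFDerivAt 𝓘(ℝ, ℝ) J (fun r => P (r, f x)) (m x) _ :=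
    HasMFDerivAt.comp (f := fun r : ℝ => (r, f x)) (m x) hP.hasMFDerivAt
      ((hasMFDerivAt_id (m x)).prodMk (hasMFDerivAt_const (f x) (m x)))
  refine (DFunLike.congr_fun h1.mfderiv v).trans
    (Eq.trans ?_ (DFunLike.congr_fun h2.mfderiv (mfderiv I 𝓘(ℝ, ℝ) m x v)).symm)
  exact congrArg (mfderiv (𝓘(ℝ, ℝ).prod I) J P (m x, f x)) (Prod.ext rfl hv)

theorem eq_zero_of_mfderiv_eq_zero_of_leftInverse {f k : M → M} {x : M}
    (hf : MDifferentiableAt I I f x) (hk : MDifferentiableAt I I k (f x))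
    (hid : k ∘ f =ᶠ[𝓝 x] id) (v : TangentSpace I x) (hv : mfderiv I I f x v = 0) : v = 0 := by
  have h1 : HasMFDerivAt I I (k ∘ f) x _ := HasMFDerivAt.comp x hk.hasMFDerivAt hf.hasMFDerivAt
  have h2 := DFunLike.congr_fun (hasMFDerivAt_unique (h1.congr_of_eventuallyEq hid.symm)
    (hasMFDerivAt_id x)) v
  exact h2.symm.trans ((congrArg (mfderiv I I k (f x)) hv).trans (map_zero _))

theorem eq_zero_of_mfderiv_eq_zero {m : M → ℝ} {f : M → M} {g : ℝ × M → M} {x : M}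
    (hm : MDifferentiableAt I 𝓘(ℝ, ℝ) m x) (hf : MDifferentiableAt I I f x)
    (hg : MDifferentiableAt (𝓘(ℝ, ℝ).prod I) I g (m x, f x))
    (hid : (fun y => g (m y, f y)) =ᶠ[𝓝 x] id) {d : ℝ} (hd : d ≠ 1)
    (hd' : HasDerivAt (fun r => m (g (r, f x))) d (m x)) (v : TangentSpace I x)
    (hv : mfderiv I I f x v = 0) : v = 0 := by
  have hx : g (m x, f x) = x := hid.self_of_nhds
  have hmg : MDifferentiableAt (𝓘(ℝ, ℝ).prod I) 𝓘(ℝ, ℝ) (m ∘ g) (m x, f x) := by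
    rw [← hx] at hm
    exact hm.comp _ hg
  have h1 := mfderiv_comp_prodMk_of_eq_zero hm hf hg v hv
  have h2 := mfderiv_comp_prodMk_of_eq_zero hm hf hmg v hv
  have h3 : (fun y => (m ∘ g) (m y, f y)) =ᶠ[𝓝 x] m := hid.mono fun y hy => congrArg m hy
  rw [h3.mfderiv_eq] at h2
  obtain ⟨c, hc⟩ : ∃ c : ℝ, c = mfderiv I 𝓘(ℝ, ℝ) m x v := ⟨_, rfl⟩
  have h4 : c = c * d :=
    hc.trans (h2.trans ((DFunLike.congr_fun hd'.hasFDerivAt.hasMFDerivAt.mfderiv _).trans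
      (congrArg (fun c : ℝ => c * d) hc.symm)))
  have h5 : c * (1 - d) = 0 := by
    rw [mul_sub, ← h4]
    ring
  have h6 : mfderiv I 𝓘(ℝ, ℝ) m x v = 0 :=
    hc.symm.trans ((mul_eq_zero.1 h5).resolve_right (sub_ne_zero.2 hd.symm))
  rw [hid.mfderiv_eq, mfderiv_id] at h1
  refine h1.trans ?_
  rw [h6, map_zero]
  rfl

end

namespace RegularNeighborhood

variable {E : Type*} [NormedAddCommGroup E] [NormedSpace ℝ E]
  {H : Type*} [TopologicalSpace H] {I : ModelWithCorners ℝ E H}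
  {M : Type*} [TopologicalSpace M] [ChartedSpace H M] {B : Set M}
  {R : RegularNeighborhood I B} {Q : SqNorm R}

namespace SqNorm.IsAdapted

variable [IsManifold I ∞ M] [T2Space M] {h k : M → M} {ε s t : ℝ} {x : M}

theorem contMDiff_deform (ha : Q.IsAdapted h k ε) (hs : s ∈ Icc (0 : ℝ) 1) :
    ContMDiff I I ∞ (Q.deform h ε s) := fun x =>
  (smoothFamilyAt_deform (Λ := Unit) (h := fun _ => h) (ε := fun _ => ε) (s := fun _ => s)
    (fun l x => .of_contMDiff ha.contMDiff l x) (fun _ => ha.mapsTo) continuous_const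
    continuous_const (fun _ => ha.pos) (fun _ => hs) (fun _ => ha.mem) () x).contMDiffAt

/-- The deformed diffeomorphism, as a homeomorphism. -/
noncomputable def homeomorph (ha : Q.IsAdapted h k ε) (hs : s ∈ Icc (0 : ℝ) 1) : M ≃ₜ M :=
  (Equiv.ofBijective _ ⟨ha.deform_injective hs, ha.deform_surjective hs⟩).toHomeomorphOfContinuousClosed
    (ha.contMDiff_deform hs).continuous
    (isClosedMap_of_eqOn_compl (ha.contMDiff_deform hs).continuous ha.contMDiff.continuous
      (Homeomorph.isClosedMap (X := M) (Y := M)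
        ⟨⟨h, k, ha.leftInverse, ha.rightInverse⟩, ha.contMDiff.continuous,
          ha.contMDiff_inv.continuous⟩)
      (isCompact_tube (Q := Q) ε) fun _ hx => deform_of_notMem hx)

theorem mfderiv_deform_eq_zero_of_mem (ha : Q.IsAdapted h k ε) (hs : s ∈ Icc (0 : ℝ) 1)
    (hx : x ∈ Q.tube ε) (v : TangentSpace I x) (hv : mfderiv I I (Q.deform h ε s) x v = 0) :
    v = 0 := by
  set t := Q.cutoff ε s x with htdef
  set z := Q.deform h ε s x with hzdef
  have ht : t ∈ Icc (0 : ℝ) 1 := cutoff_mem hs _ _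
  have hz : z = R.conj h t x := deform_of_mem hx
  have hhx : h x ∈ R.carrier := by
    have := ha.mem 1 (by simp) x hx
    rwa [act_one hx.1] at this
  have hm : ContMDiffAt I 𝓘(ℝ, ℝ) ∞ (Q.cutoff ε s) x :=
    (smoothFamilyAt_cutoff (Λ := Unit) (ε := fun _ => ε) (s := fun _ => s)
      continuous_const continuous_const (fun _ => ha.pos) hx.1 ()).contMDiffAt
  have hg : ContMDiffAt (𝓘(ℝ, ℝ).prod I) I ∞ (fun q : ℝ × M => R.conj k q.1 q.2) (t, z) :=
    hz ▸ ha.contMDiffAt_conj_inv ht hx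
  have hgx : R.conj k t z = x := by rw [hz, ha.conj_conj ht hx]
  have hid : (fun y => R.conj k (Q.cutoff ε s y) (Q.deform h ε s y)) =ᶠ[𝓝 x] id := by
    have h1 : ContinuousAt (fun y => h (R.act (Q.cutoff ε s y) y)) x := by
      refine ha.contMDiff.continuous.continuousAt.comp ?_
      exact (R.contMDiffOn_act.contMDiffAt ((isOpen_univ.prod R.isOpen_carrier).mem_nhds
        (show (t, x) ∈ _ from ⟨mem_univ _, hx.1⟩))).continuousAt.comp
        (f := fun y => (Q.cutoff ε s y, y)) (hm.continuousAt.prodMk continuousAt_id)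
    filter_upwards [R.isOpen_carrier.mem_nhds hx.1,
      ha.contMDiff.continuous.continuousAt.eventually (R.isOpen_carrier.mem_nhds hhx),
      h1.eventually (R.isOpen_carrier.mem_nhds (ha.mem t ht x hx))] with y hy1 hy2 hy3
    rw [deform_eq_conj ha.pos hy1 hy2, RegularNeighborhood.conj_conj ha.contMDiff ha.mapsTo
      ha.contMDiff_inv ha.mapsTo_inv ha.leftInverse hy1 hy3, id]
  obtain ⟨d, hd, hd'⟩ := ha.exists_hasDerivAt_cutoff hs ht hx
  rw [← hz] at hd'
  have hd1 : d ≠ 1 := fun h => by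
    rw [h, abs_one] at hd
    norm_num at hd
  exact eq_zero_of_mfderiv_eq_zero (g := fun q : ℝ × M => R.conj k q.1 q.2)
    (hm.mdifferentiableAt (by simp)) ((ha.contMDiff_deform hs x).mdifferentiableAt (by simp))
    (hg.mdifferentiableAt (by simp)) hid hd1 hd' v hv

theorem mfderiv_deform_eq_zero_of_notMem (ha : Q.IsAdapted h k ε) (hs : s ∈ Icc (0 : ℝ) 1)
    (hx : x ∉ Q.tube ε) (v : TangentSpace I x) (hv : mfderiv I I (Q.deform h ε s) x v = 0) :
    v = 0 := by
  have hid : (k ∘ Q.deform h ε s) =ᶠ[𝓝 x] id := by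
    filter_upwards [(isCompact_tube (Q := Q) ε).isClosed.isOpen_compl.mem_nhds hx] with y hy
    rw [Function.comp_apply, deform_of_notMem hy, ha.leftInverse, id]
  exact eq_zero_of_mfderiv_eq_zero_of_leftInverse
    ((ha.contMDiff_deform hs x).mdifferentiableAt (by simp))
    ((ha.contMDiff_inv _).mdifferentiableAt (by simp)) hid v hv

/-- The deformed diffeomorphism. -/
noncomputable def diffeomorph [FiniteDimensional ℝ E] (ha : Q.IsAdapted h k ε)
    (hs : s ∈ Icc (0 : ℝ) 1) : M ≃ₘ⟮I, I⟯ M where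
  toEquiv := (ha.homeomorph hs).toEquiv
  contMDiff_toFun := ha.contMDiff_deform hs
  contMDiff_invFun := (ha.homeomorph hs).contMDiff_symm_of_mfderiv (ha.contMDiff_deform hs)
    fun x v hv => by
      by_cases hx : x ∈ Q.tube ε
      · exact ha.mfderiv_deform_eq_zero_of_mem hs hx v hv
      · exact ha.mfderiv_deform_eq_zero_of_notMem hs hx v hv

end SqNorm.IsAdapted

end RegularNeighborhood

namespace SmoothFamilyAt

variable {Λ : Type*} [TopologicalSpace Λ]
  {E : Type*} [NormedAddCommGroup E] [NormedSpace ℝ E]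
  {H : Type*} [TopologicalSpace H] {I : ModelWithCorners ℝ E H}
  {M : Type*} [TopologicalSpace M] [ChartedSpace H M]
  {E' : Type*} [NormedAddCommGroup E'] [NormedSpace ℝ E']
  {H' : Type*} [TopologicalSpace H'] {J : ModelWithCorners ℝ E' H'}
  {N : Type*} [TopologicalSpace N] [ChartedSpace H' N] {f : Λ → M → N} {l : Λ} {x : M}

theorem continuousAt_fderivWithin_localRep (hf : SmoothFamilyAt I J f l x) :
    ContinuousAt (fun q : Λ × M => fderivWithin ℝ (_root_.localRep I J (chartAt H x)
      (chartAt H' (f l x)) (f q.1)) (range I) ((chartAt H x).extend I q.2)) (l, x) :=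
  (hf.localRep.fderivWithin I.uniqueDiffOn (mem_range_self _)).tendsto_apply.comp
    (tendsto_prod_extend I (chartAt H x) (mem_chart_source H x) l)

theorem eventually_differentiableWithinAt (hf : SmoothFamilyAt I J f l x) :
    ∀ᶠ q : Λ × M in 𝓝 (l, x), DifferentiableWithinAt ℝ (_root_.localRep I J (chartAt H x)
      (chartAt H' (f l x)) (f q.1)) (range I) ((chartAt H x).extend I q.2) :=
  ((tendsto_prod_extend I (chartAt H x) (mem_chart_source H x) l).eventually
    hf.localRep.smooth).mono fun _ h => h.differentiableWithinAt (by simp)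

end SmoothFamilyAt

namespace RegularNeighborhood

variable {Λ : Type*} [TopologicalSpace Λ]
  {E : Type*} [NormedAddCommGroup E] [NormedSpace ℝ E]
  {H : Type*} [TopologicalSpace H] {I : ModelWithCorners ℝ E H}
  {M : Type*} [TopologicalSpace M] [ChartedSpace H M] {B : Set M}
  {R : RegularNeighborhood I B} {Q : SqNorm R}

variable [IsManifold I ∞ M] [T2Space M]

section Single

variable {h k : M → M} {t : ℝ} {y : M}

theorem contMDiffAt_conj_conj_left (hh : ContMDiff I I ∞ h) (hB : MapsTo h B B)
    (hk : ContMDiff I I ∞ k) (hkB : MapsTo k B B) (hkh : Function.LeftInverse k h)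
    (hy : y ∈ R.carrier) (hty : h (R.act t y) ∈ R.carrier) :
    ContMDiffAt 𝓘(ℝ, ℝ) I ∞ (fun r : ℝ => R.conj k r (R.conj h t y)) t := by
  have hz := conj_mem hh hB hy hty
  refine (contMDiffAt_conj hk hkB hz ?_).comp (f := fun r : ℝ => (r, R.conj h t y)) t
    (contMDiffAt_id.prodMk contMDiffAt_const)
  rw [act_conj hh hB hy hty, hkh]
  exact act_mem hy t

theorem eventually_conj_conj_left (hh : ContMDiff I I ∞ h) (hB : MapsTo h B B)
    (hk : ContMDiff I I ∞ k) (hkB : MapsTo k B B) (hkh : Function.LeftInverse k h)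
    (hhk : Function.LeftInverse h k) (hy : y ∈ R.carrier) (hty : h (R.act t y) ∈ R.carrier) :
    ∀ᶠ r in 𝓝 t, R.conj h r (R.conj k r (R.conj h t y)) = R.conj h t y := by
  have hz := conj_mem hh hB hy hty
  have c1 : ContinuousAt (fun r : ℝ => k (R.act r (R.conj h t y))) t := by
    have := (R.contMDiffOn_act.contMDiffAt ((isOpen_univ.prod R.isOpen_carrier).mem_nhds
      (show (t, R.conj h t y) ∈ _ from ⟨mem_univ _, hz⟩))).continuousAt
    exact hk.continuous.continuousAt.comp
      (this.comp (f := fun s : ℝ => (s, R.conj h t y)) (by fun_prop))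
  have h1 : k (R.act t (R.conj h t y)) ∈ R.carrier := by
    rw [act_conj hh hB hy hty, hkh]
    exact act_mem hy t
  filter_upwards [c1.eventually (R.isOpen_carrier.mem_nhds h1)] with r hr
  exact conj_conj hk hkB hh hB hhk hz hr

theorem mfderiv_conj_injective (hh : ContMDiff I I ∞ h) (hB : MapsTo h B B)
    (hk : ContMDiff I I ∞ k) (hkB : MapsTo k B B) (hkh : Function.LeftInverse k h)
    (hy : y ∈ R.carrier) (hty : h (R.act t y) ∈ R.carrier) (v : TangentSpace I y)
    (hv : mfderiv I I (R.conj h t) y v = 0) : v = 0 := by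
  have hc : ContMDiffAt I I ∞ (R.conj h t) y := (contMDiffAt_conj hh hB hy hty).comp
    (f := fun y : M => (t, y)) y (contMDiffAt_const.prodMk contMDiffAt_id)
  have hkc : ContMDiffAt I I ∞ (R.conj k t) (R.conj h t y) := by
    refine (contMDiffAt_conj hk hkB (conj_mem hh hB hy hty) ?_).comp
      (f := fun y : M => (t, y)) _ (contMDiffAt_const.prodMk contMDiffAt_id)
    rw [act_conj hh hB hy hty, hkh]
    exact act_mem hy t
  refine eq_zero_of_mfderiv_eq_zero_of_leftInverse (hc.mdifferentiableAt (by simp))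
    (hkc.mdifferentiableAt (by simp)) ?_ v hv
  have c1 : ContinuousAt (fun y => h (R.act t y)) y := by
    have := (R.contMDiffOn_act.contMDiffAt ((isOpen_univ.prod R.isOpen_carrier).mem_nhds
      (show (t, y) ∈ _ from ⟨mem_univ _, hy⟩))).continuousAt
    exact hh.continuous.continuousAt.comp (this.comp (f := fun y : M => (t, y)) (by fun_prop))
  filter_upwards [R.isOpen_carrier.mem_nhds hy,
    c1.eventually (R.isOpen_carrier.mem_nhds hty)] with w hw hw'
  exact conj_conj hh hB hk hkB hkh hw hw'

end Single

/-- The derivative of `Q` along the curve `r ↦ (conj h r)⁻¹ z` depends continuously on everything. -/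
theorem continuousAt_deriv_conj [FiniteDimensional ℝ E] {h k : Λ → M → M}
    (hh : ∀ l x, SmoothFamilyAt I I h l x)
    (hB : ∀ l, MapsTo (h l) B B) (hk : ∀ l, ContMDiff I I ∞ (k l)) (hkB : ∀ l, MapsTo (k l) B B)
    (hkh : ∀ l, Function.LeftInverse (k l) (h l)) (hhk : ∀ l, Function.LeftInverse (h l) (k l))
    {l : Λ} {t : ℝ} {y : M} (hy : y ∈ R.carrier) (hty : h l (R.act t y) ∈ R.carrier) :
    ContinuousAt (fun q : Λ × ℝ × M => deriv
      (fun r => Q (R.conj (k q.1) r (R.conj (h q.1) q.2.1 q.2.2))) q.2.1) (l, (t, y)) := by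
  have hh' : ∀ l, ContMDiff I I ∞ (h l) := fun l x => (hh l x).contMDiffAt
  set X := 𝓘(ℝ, ℝ).prod I with hX
  set Φ := (chartAt (ModelProd ℝ H) ((t, y) : ℝ × M)) with hΦ
  have hΦ1 : ∀ p : ℝ × M, Φ.extend X p = (p.1, extChartAt I y p.2) := fun p => rfl
  have hF := smoothFamilyAt_conj hh hB hy hty
  have hQ : SmoothFamilyAt I 𝓘(ℝ, ℝ) (fun _ : Λ => Q) l y :=
    .of_contMDiffOn Q.contMDiffOn (R.isOpen_carrier.mem_nhds hy) l
  set z := R.conj (h l) t y with hz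
  set F : Λ → ℝ × E → E := fun l' => localRep X I Φ (chartAt H z)
    (fun q => R.conj (h l') q.1 q.2) with hFdef
  set G : E → ℝ := localRep I 𝓘(ℝ, ℝ) (chartAt H y) (chartAt ℝ (Q y)) Q with hGdef
  have hF1 : SmoothFamilyWithinAt F (range X) l (Φ.extend X (t, y)) := hF.localRep
  let A : Λ × ℝ × M → ℝ × E →L[ℝ] E :=
    fun q => fderivWithin ℝ (F q.1) (range X) (Φ.extend X q.2)
  let D : Λ × ℝ × M → E →L[ℝ] E := fun q => (A q).comp (ContinuousLinearMap.inr ℝ ℝ E)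
  have cA : ContinuousAt A (l, (t, y)) := hF.continuousAt_fderivWithin_localRep
  have cG : ContinuousAt (fun q : Λ × ℝ × M => fderivWithin ℝ G (range I) (extChartAt I y q.2.2))
      (l, (t, y)) := hQ.continuousAt_fderivWithin_localRep.comp (f := fun q : Λ × ℝ × M => (q.1, q.2.2))
    (x := (l, (t, y))) (by fun_prop)
  have cD : ContinuousAt D (l, (t, y)) := cA.clm_comp continuousAt_const
  -- invertibility of the partial derivative
  have hinv : (D (l, (t, y))).IsInvertible := by
    refine ContinuousLinearMap.isInvertible_of_injective _ fun v hv => ?_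
    have hc : MDifferentiableAt I I (R.conj (h l) t) y :=
      ((contMDiffAt_conj (hh' l) (hB l) hy hty).comp (f := fun y : M => (t, y)) y
        (contMDiffAt_const.prodMk contMDiffAt_id)).mdifferentiableAt (by simp)
    refine mfderiv_conj_injective (hh' l) (hB l) (hk l) (hkB l) (hkh l) hy hty v ?_
    have h1 : HasFDerivWithinAt (F l) (A (l, (t, y))) (range X) (t, extChartAt I y y) :=
      ((hF1.smoothAt (mem_range_self _)).differentiableWithinAt (by simp)).hasFDerivWithinAt
    have h2 : HasFDerivWithinAt (fun e : E => F l (t, e)) (D (l, (t, y))) (range I)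
        (extChartAt I y y) := by
      refine h1.comp (f := fun e : E => (t, e)) _
        (hasFDerivAt_prodMk_right t _).hasFDerivWithinAt ?_
      rintro _ ⟨e, rfl⟩
      exact ⟨(t, e), rfl⟩
    have h3 : mfderiv I I (R.conj (h l) t) y = D (l, (t, y)) := by
      rw [hc.mfderiv]
      exact h2.fderivWithin (I.uniqueDiffOn _ (mem_range_self _))
    rw [h3]
    exact hv
  have hinv' : ∀ᶠ q in 𝓝 (l, (t, y)), (D q).IsInvertible :=
    cD.eventually ((ContinuousLinearEquiv.isOpen (𝕜 := ℝ) (E := E) (F := E)).mem_nhds hinv)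
  have cinv : ContinuousAt (fun q => (D q).inverse) (l, (t, y)) := by
    obtain ⟨e, he⟩ := hinv
    have h1 : ContinuousAt ContinuousLinearMap.inverse (D (l, (t, y))) := by
      rw [← he]
      exact (contDiffAt_map_inverse (n := 0) e).continuousAt
    exact ContinuousAt.comp (f := D) h1 cD
  have hkey : ContinuousAt (fun q : Λ × ℝ × M =>
      fderivWithin ℝ G (range I) (extChartAt I y q.2.2) (-((D q).inverse (A q (1, 0)))))
      (l, (t, y)) :=
    cG.clm_apply (cinv.clm_apply (cA.clm_apply continuousAt_const)).neg
  refine hkey.congr ?_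
  have ev1 : ∀ᶠ q : Λ × ℝ × M in 𝓝 (l, (t, y)), q.2.2 ∈ (chartAt H y).source :=
    (continuousAt_snd.snd (x := (l, (t, y)))).eventually
      ((chartAt H y).open_source.mem_nhds (mem_chart_source H y))
  have ev2 : ∀ᶠ q : Λ × ℝ × M in 𝓝 (l, (t, y)), q.2.2 ∈ R.carrier :=
    (continuousAt_snd.snd (x := (l, (t, y)))).eventually (R.isOpen_carrier.mem_nhds hy)
  have ev3 : ∀ᶠ q : Λ × ℝ × M in 𝓝 (l, (t, y)), h q.1 (R.act q.2.1 q.2.2) ∈ R.carrier :=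
    (smoothFamilyAt_comp_act hh hy l).continuousAt.eventually (R.isOpen_carrier.mem_nhds hty)
  have ev4 := hF.eventually_differentiableWithinAt
  have ev5 := (Continuous.tendsto (f := fun q : Λ × ℝ × M => (q.1, q.2.2)) (by fun_prop)
    (l, (t, y))).eventually hQ.eventually_differentiableWithinAt
  filter_upwards [hinv', ev1, ev2, ev3, ev4, ev5] with ⟨l', t', y'⟩ e0 e1 e2 e3 e4 e5
  simp only at e1 e2 e3 e4 e5 ⊢
  have hcurve := contMDiffAt_conj_conj_left (hh' l') (hB l') (hk l') (hkB l') (hkh l') e2 e3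
  have hval : R.conj (k l') t' (R.conj (h l') t' y') = y' :=
    conj_conj (hh' l') (hB l') (hk l') (hkB l') (hkh l') e2 e3
  set z' := R.conj (h l') t' y' with hz'
  have hev := eventually_conj_conj_left (hh' l') (hB l') (hk l') (hkB l') (hkh l') (hhk l') e2 e3
  rw [← hz'] at hev
  have hsrc' : ∀ᶠ r in 𝓝 t', R.conj (k l') r z' ∈ (chartAt H y).source :=
    hcurve.continuousAt.eventually ((chartAt H y).open_source.mem_nhds
      (by beta_reduce; rwa [hval]))
  set c : ℝ → E := fun r => extChartAt I y (R.conj (k l') r z') with hc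
  have hcd : HasDerivAt c (deriv c t') t' := by
    have h1 : ContMDiffAt 𝓘(ℝ, ℝ) 𝓘(ℝ, E) ∞ c t' :=
      ContMDiffAt.comp t' (g := extChartAt I y) (contMDiffAt_extChartAt' (by rwa [hval])) hcurve
    exact (h1.contDiffAt.differentiableAt (by simp)).hasDerivAt
  have hct : c t' = extChartAt I y y' := by rw [hc]; simp only; rw [hval]
  -- the derivative of the curve
  have h1 : HasDerivAt (F l' ∘ fun r => (r, c r)) (A (l', (t', y')) (1, deriv c t')) t' := by
    refine HasFDerivWithinAt.comp_hasDerivAt_of_eq t'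
      e4.hasFDerivWithinAt ((hasDerivAt_id t').prodMk hcd)
      (Eventually.of_forall fun r => ?_) ?_
    · exact ⟨Φ (r, R.conj (k l') r z'), rfl⟩
    · rw [hΦ1, hct]
  have h2 : F l' ∘ (fun r => (r, c r)) =ᶠ[𝓝 t'] fun _ => (chartAt H z).extend I z' := by
    filter_upwards [hev, hsrc'] with r hr hr'
    have h3 : (Φ.extend X).symm (r, c r) = (r, R.conj (k l') r z') := by
      have : (Φ.extend X).symm (r, c r) = (r, (extChartAt I y).symm (c r)) := rfl
      rw [this, hc]
      simp only
      rw [(extChartAt I y).left_inv (by rwa [extChartAt_source])]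
    simp only [hFdef, localRep, Function.comp_apply, h3]
    rw [hr]
  have h3 : A (l', (t', y')) (1, deriv c t') = 0 :=
    h1.unique ((hasDerivAt_const t' _).congr_of_eventuallyEq h2)
  have h4 : deriv c t' = -((D (l', (t', y'))).inverse (A (l', (t', y')) (1, 0))) := by
    obtain ⟨e, he⟩ := e0
    have h5 : A (l', (t', y')) (1, 0) + e (deriv c t') = 0 := by
      have : e (deriv c t') = A (l', (t', y')) (0, deriv c t') :=
        DFunLike.congr_fun he (deriv c t')
      rw [this, ← map_add]
      simpa using h3
    rw [← he, ContinuousLinearMap.inverse_equiv, eq_neg_of_add_eq_zero_left h5]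
    simp
  have h6 : HasDerivAt (G ∘ c) (fderivWithin ℝ G (range I) (extChartAt I y y') (deriv c t')) t' :=
    HasFDerivWithinAt.comp_hasDerivAt_of_eq t'
      e5.hasFDerivWithinAt hcd
      (Eventually.of_forall fun r => ⟨chartAt H y (R.conj (k l') r z'), rfl⟩) hct.symm
  rw [← h4]
  refine (h6.congr_of_eventuallyEq ?_).deriv.symm
  filter_upwards [hsrc'] with r hr
  have h7 : ((chartAt H y).extend I).symm (c r) = R.conj (k l') r z' :=
    (extChartAt I y).left_inv (by rwa [extChartAt_source])
  simp only [hGdef, localRep, Function.comp_apply, h7]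
  rfl

end RegularNeighborhood

theorem continuousAt_div_one_add_abs {X : Type*} [TopologicalSpace X] {u n : X → ℝ} {x : X}
    (hu : ContinuousAt u x) (hn : u x = 0 ∨ ContinuousAt n x) :
    ContinuousAt (fun y => u y / (1 + |n y|)) x := by
  rcases hn with h0 | hn
  · have h1 : Tendsto (fun y => |u y|) (𝓝 x) (𝓝 0) := by
      have := hu.abs.tendsto
      rwa [h0, abs_zero] at this
    have h2 : Tendsto (fun y => u y / (1 + |n y|)) (𝓝 x) (𝓝 0) := by
      refine squeeze_zero_norm (fun y => ?_) h1
      have h3 : 0 < 1 + |n y| := by positivity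
      rw [Real.norm_eq_abs, abs_div, abs_of_pos h3]
      exact div_le_self (abs_nonneg _) (by linarith [abs_nonneg (n y)])
    rw [ContinuousAt, h0, zero_div]
    exact h2
  · exact hu.div (continuousAt_const.add hn.abs) (by positivity)

theorem exists_forall_abs_deriv_smoothTransition_le :
    ∃ L : ℝ, 0 ≤ L ∧ ∀ q, |deriv Real.smoothTransition q| ≤ L := by
  have hc : Continuous (deriv Real.smoothTransition) :=
    (Real.smoothTransition.contDiff (n := 1)).continuous_deriv le_rfl
  obtain ⟨L, hL⟩ := (isCompact_Icc (a := (0 : ℝ)) (b := 1)).exists_bound_of_continuousOn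
    hc.continuousOn
  refine ⟨L, (norm_nonneg _).trans (hL 0 (by simp)), fun q => ?_⟩
  by_cases hq : q ∈ Icc (0 : ℝ) 1
  · exact hL q hq
  · have h0 : deriv Real.smoothTransition q = 0 := by
      rw [mem_Icc, not_and_or, not_le, not_le] at hq
      rcases hq with hq | hq
      · have : Real.smoothTransition =ᶠ[𝓝 q] fun _ => 0 := by
          filter_upwards [gt_mem_nhds hq] with r hr
          exact Real.smoothTransition.zero_of_nonpos hr.le
        rw [this.deriv_eq, deriv_const]
      · have : Real.smoothTransition =ᶠ[𝓝 q] fun _ => 1 := by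
          filter_upwards [lt_mem_nhds hq] with r hr
          exact Real.smoothTransition.one_of_one_le hr.le
        rw [this.deriv_eq, deriv_const]
    rw [h0, abs_zero]
    exact (norm_nonneg _).trans (hL 0 (by simp))

namespace RegularNeighborhood

variable {Λ : Type*} [TopologicalSpace Λ]
  {E : Type*} [NormedAddCommGroup E] [NormedSpace ℝ E]
  {H : Type*} [TopologicalSpace H] {I : ModelWithCorners ℝ E H}
  {M : Type*} [TopologicalSpace M] [ChartedSpace H M] {B : Set M}
  {R : RegularNeighborhood I B} {Q : SqNorm R}

variable [IsManifold I ∞ M] [T2Space M]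

section Scaling

variable {h k : M → M} {t ε : ℝ} {y : M}

theorem deriv_conj_act (hh : ContMDiff I I ∞ h) (hB : MapsTo h B B) (hk : ContMDiff I I ∞ k)
    (hkB : MapsTo k B B) (hkh : Function.LeftInverse k h) (hε : ε ≠ 0) (hy : y ∈ R.carrier)
    (hty : h (R.act (t * ε) y) ∈ R.carrier) :
    deriv (fun r => Q (R.conj k r (R.conj h t (R.act ε y)))) t =
      ε ^ 2 * ε * deriv (fun r => Q (R.conj k r (R.conj h (t * ε) y))) (t * ε) := by
  have hz := conj_mem hh hB hy hty
  have hkz : k (R.act (t * ε) (R.conj h (t * ε) y)) ∈ R.carrier := by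
    rw [act_conj hh hB hy hty, hkh]
    exact act_mem hy _
  have c1 : ContinuousAt (fun r : ℝ => k (R.act (r * ε) (R.conj h (t * ε) y))) t := by
    have := (R.contMDiffOn_act.contMDiffAt ((isOpen_univ.prod R.isOpen_carrier).mem_nhds
      (show (t * ε, R.conj h (t * ε) y) ∈ _ from ⟨mem_univ _, hz⟩))).continuousAt
    exact hk.continuous.continuousAt.comp
      (this.comp (f := fun s : ℝ => (s * ε, R.conj h (t * ε) y)) (by fun_prop))
  have h1 : (fun r => Q (R.conj k r (R.conj h t (R.act ε y)))) =ᶠ[𝓝 t]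
      fun r => ε ^ 2 * Q (R.conj k (r * ε) (R.conj h (t * ε) y)) := by
    filter_upwards [c1.eventually (R.isOpen_carrier.mem_nhds hkz)] with r hr
    rw [conj_act hh hB hε hy hty, conj_act hk hkB hε hz hr, Q.act _ (conj_mem hk hkB hz hr)]
  have h2 : DifferentiableAt ℝ (fun r => Q (R.conj k r (R.conj h (t * ε) y))) (t * ε) := by
    have h3 : ContMDiffAt 𝓘(ℝ, ℝ) 𝓘(ℝ, ℝ) ∞
        (fun r => Q (R.conj k r (R.conj h (t * ε) y))) (t * ε) :=
      (Q.contMDiffOn.contMDiffAt (R.isOpen_carrier.mem_nhds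
        (by rw [conj_conj hh hB hk hkB hkh hy hty]; exact hy))).comp (t * ε)
        (contMDiffAt_conj_conj_left hh hB hk hkB hkh hy hty)
    exact h3.contDiffAt.differentiableAt (by simp)
  have h3 : HasDerivAt (fun r => Q (R.conj k (r * ε) (R.conj h (t * ε) y)))
      (deriv (fun r => Q (R.conj k r (R.conj h (t * ε) y))) (t * ε) * ε) t := by
    have h4 : HasDerivAt (fun r : ℝ => r * ε) ε t := by
      simpa using (hasDerivAt_id t).mul_const ε
    exact h2.hasDerivAt.comp t h4
  rw [h1.deriv_eq, (h3.const_mul (ε ^ 2)).deriv]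
  ring

theorem SqNorm.exists_act_eq (hε : 0 < ε) {w : M} (hw : w ∈ Q.tube ε) :
    ∃ y, (y ∈ R.carrier ∧ Q y ≤ 2) ∧ R.act ε y = w := by
  refine ⟨R.act ε⁻¹ w, ⟨act_mem hw.1 _, ?_⟩, act_act_inv hw.1 hε.ne'⟩
  rw [Q.act _ hw.1, inv_pow, inv_mul_le_iff₀ (by positivity), mul_comm]
  exact hw.2

end Scaling

/-- The size of the tube can be chosen continuously. -/
theorem SqNorm.exists_isAdapted [FiniteDimensional ℝ E] (Q : SqNorm R) (hBc : IsCompact B)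
    {h k : Λ → M → M} (hh : ∀ l x, SmoothFamilyAt I I h l x)
    (hB : ∀ l, MapsTo (h l) B B) (hk : ∀ l, ContMDiff I I ∞ (k l)) (hkB : ∀ l, MapsTo (k l) B B)
    (hkh : ∀ l, Function.LeftInverse (k l) (h l)) (hhk : ∀ l, Function.LeftInverse (h l) (k l)) :
    ∃ ε : Λ → ℝ, Continuous ε ∧ ∀ l, ε l ≤ 1 ∧ Q.IsAdapted (h l) (k l) (ε l) := by
  have hh' : ∀ l, ContMDiff I I ∞ (h l) := fun l x => (hh l x).contMDiffAt
  rcases B.eq_empty_or_nonempty with rfl | ⟨b, hb⟩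
  · have hempty : ∀ y, y ∉ Q.tube 1 := fun y hy => (R.mapsTo_proj hy.1).elim
    exact ⟨fun _ => 1, continuous_const, fun l => ⟨le_rfl, hh' l, hk l, hkh l, hhk l, hB l, hkB l,
      one_pos, fun t _ y hy => absurd hy (hempty y), fun t _ y hy => absurd hy (hempty y)⟩⟩
  have : LocallyCompactSpace M := Manifold.locallyCompact_of_finiteDimensional I
  obtain ⟨κ, hκ1, hκ0, -, hκ⟩ := exists_continuous_one_zero_of_isCompact hBc
    R.isOpen_carrier.isClosed_compl (disjoint_compl_right_iff_subset.2 R.subset_carrier)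
  obtain ⟨L, hL0, hL⟩ := exists_forall_abs_deriv_smoothTransition_le
  set n : Λ × ℝ × M → ℝ := fun q => deriv
      (fun r => Q (R.conj (k q.1) r (R.conj (h q.1) q.2.1 q.2.2))) q.2.1 with hn
  set u : Λ × ℝ × M → ℝ := fun q => κ (h q.1 (R.act q.2.1 q.2.2)) with hu
  set f : Λ × ℝ × M → ℝ := fun q => q.2.1 + u q / (1 + |n q|) with hf
  set K : Set (ℝ × M) := Icc (0 : ℝ) 1 ×ˢ {x | x ∈ R.carrier ∧ Q x ≤ 2} with hK
  have hKc : IsCompact K := isCompact_Icc.prod (Q.isCompact_le 2)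
  have hbK : ((0 : ℝ), b) ∈ K :=
    ⟨by simp, R.subset_carrier hb, by rw [Q.apply_of_mem hb]; norm_num⟩
  have hfc : ∀ l, ∀ p ∈ K, ContinuousAt f (l, p) := by
    rintro l ⟨t, y⟩ ⟨-, hy, -⟩
    refine (continuousAt_snd.fst).add (continuousAt_div_one_add_abs ?_ ?_)
    · exact κ.continuous.continuousAt.comp (smoothFamilyAt_comp_act hh hy l).continuousAt
    · by_cases hty : h l (R.act t y) ∈ R.carrier
      · exact Or.inr (continuousAt_deriv_conj hh hB hk hkB hkh hhk hy hty)
      · exact Or.inl (hκ0 hty)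
  have : CompactSpace K := isCompact_iff_compactSpace.1 hKc
  have hFc : Continuous (fun q : Λ × K => f (q.1, q.2.1)) := continuous_iff_continuousAt.2
    fun q => (hfc q.1 q.2.1 q.2.2).comp (f := fun q : Λ × K => (q.1, q.2.1)) (by fun_prop)
  have hcont := (isCompact_univ (X := K)).continuous_sInf (f := fun l (p : K) => f (l, p.1)) hFc
  set a : ℝ := 1 / (4 * (L + 1)) with ha
  have ha0 : 0 < a := by positivity
  have hLa : L * (2 * a) ≤ 1 / 2 := by
    rw [ha]
    have : L * (2 * (1 / (4 * (L + 1)))) = L / (L + 1) * (1 / 2) := by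
      field_simp
      ring
    rw [this]
    have h1 : L / (L + 1) ≤ 1 := (div_le_one (by positivity)).2 (by linarith)
    linarith
  have ha1 : a ≤ 1 / 2 := by
    rw [ha]
    refine one_div_le_one_div_of_le two_pos ?_
    linarith
  set m : Λ → ℝ := fun l => sInf ((fun p : K => f (l, p.1)) '' univ) with hm
  have hbdd : ∀ l, BddBelow ((fun p : K => f (l, p.1)) '' univ) := fun l =>
    ⟨0, by
      rintro _ ⟨⟨p, hp⟩, -, rfl⟩
      have h1 := (hκ (h l (R.act p.1 p.2))).1
      have h2 : 0 ≤ u (l, p) / (1 + |n (l, p)|) := div_nonneg h1 (by positivity)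
      exact add_nonneg hp.1.1 h2⟩
  have hle : ∀ l, ∀ p ∈ K, m l ≤ f (l, p) := fun l p hp =>
    csInf_le (hbdd l) ⟨⟨p, hp⟩, mem_univ _, rfl⟩
  have hpos : ∀ l, 0 < m l := by
    intro l
    have hFl : Continuous (fun p : K => f (l, p.1)) := hFc.comp (f := fun p : K => (l, p)) (by fun_prop)
    obtain ⟨⟨⟨t, y⟩, hp⟩, -, hp2⟩ := (isCompact_univ.image hFl).sInf_mem
      ⟨_, ⟨⟨_, hbK⟩, mem_univ _, rfl⟩⟩
    change 0 < sInf _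
    rw [← hp2]
    change 0 < t + u (l, (t, y)) / (1 + |n (l, (t, y))|)
    have h1 := (hκ (h l (R.act t y))).1
    have h2 : 0 ≤ u (l, (t, y)) / (1 + |n (l, (t, y))|) := div_nonneg h1 (by positivity)
    rcases hp.1.1.eq_or_lt with h0 | h0
    · simp only at h0
      subst h0
      have h3 : u (l, (0, y)) = 1 := by
        rw [hu]
        simp only
        rw [act_zero hp.2.1]
        exact hκ1 (hB l (proj_mem hp.2.1))
      rw [h3, zero_add]
      positivity
    · simp only at h0
      linarith
  have hm2 : ∀ l, m l ≤ 2 := fun l => by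
    refine (hle l _ hbK).trans ?_
    have h1 := (hκ (h l (R.act 0 b))).2
    have h2 : u (l, (0, b)) / (1 + |n (l, (0, b))|) ≤ 1 :=
      (div_le_one (by positivity)).2 (h1.trans (by linarith [abs_nonneg (n (l, (0, b)))]))
    change (0 : ℝ) + u (l, (0, b)) / (1 + |n (l, (0, b))|) ≤ 2
    linarith
  -- the two properties of the chosen size
  have key : ∀ l, ∀ t ∈ Icc (0 : ℝ) (a * m l), ∀ y, y ∈ R.carrier → Q y ≤ 2 →
      h l (R.act t y) ∈ R.carrier ∧ a * m l * |n (l, (t, y))| ≤ 2 * a := by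
    intro l t ht y hy hy2
    have hml := hpos l
    have ht1 : t ≤ 1 := ht.2.trans (by nlinarith [hm2 l])
    have h1 := hle l (t, y) ⟨⟨ht.1, ht1⟩, hy, hy2⟩
    change m l ≤ t + u (l, (t, y)) / (1 + |n (l, (t, y))|) at h1
    have h0 : 0 < 1 + |n (l, (t, y))| := by positivity
    have h2 : m l / 2 ≤ u (l, (t, y)) / (1 + |n (l, (t, y))|) := by
      nlinarith [ht.2]
    rw [le_div_iff₀ h0] at h2
    have h3 : 0 < u (l, (t, y)) := lt_of_lt_of_le (by positivity) h2
    constructor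
    · by_contra hnot
      exact h3.ne' (hκ0 hnot)
    · have h4 : u (l, (t, y)) ≤ 1 := (hκ _).2
      have h5 : m l * |n (l, (t, y))| ≤ 2 := by nlinarith
      nlinarith
  refine ⟨fun l => a * m l, hcont.const_mul a, fun l => ⟨by nlinarith [hm2 l, hpos l], hh' l, hk l,
    hkh l, hhk l, hB l, hkB l, mul_pos ha0 (hpos l), ?_, ?_⟩⟩
  all_goals
    have hε : 0 < a * m l := mul_pos ha0 (hpos l)
    intro t ht w hw
    obtain ⟨y, ⟨hy, hy2⟩, rfl⟩ := SqNorm.exists_act_eq hε hw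
    have htm : t * (a * m l) ∈ Icc (0 : ℝ) (a * m l) :=
      ⟨mul_nonneg ht.1 hε.le, mul_le_of_le_one_left hε.le ht.2⟩
    obtain ⟨h1, h2⟩ := key l _ htm y hy hy2
  · rwa [act_act hy]
  · intro q
    rw [deriv_conj_act (hh' l) (hB l) (hk l) (hkB l) (hkh l) hε.ne' hy h1]
    change _ * |(a * m l) ^ 2 * (a * m l) * n (l, (t * (a * m l), y))| ≤ _
    rw [abs_mul, abs_mul, abs_of_pos hε, abs_of_pos (pow_pos hε 2)]
    set N := |n (l, (t * (a * m l), y))|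
    have h3 : |deriv Real.smoothTransition q| * (a * m l * N) ≤ 1 / 2 :=
      (mul_le_mul (hL q) h2 (by positivity) hL0).trans hLa
    calc |deriv Real.smoothTransition q| * ((a * m l) ^ 2 * (a * m l) * N)
        = (a * m l) ^ 2 * (|deriv Real.smoothTransition q| * (a * m l * N)) := by ring
      _ ≤ (a * m l) ^ 2 * (1 / 2) := by gcongr
      _ = (a * m l) ^ 2 / 2 := by ring

end RegularNeighborhood

/-- A deformation of a pair into a smaller pair, keeping the latter invariant. -/
theorem inclusionOfPairsIsHomotopyEquiv_of_deformation {D : Type*} (τ : TopologicalSpace D)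
    {X X' A : Set D} (hA : A ⊆ X) (hX : X' ⊆ X) (Φ : unitInterval × X → D) (hΦ : Continuous Φ)
    (h1 : ∀ x, Φ (1, x) = x) (h0 : ∀ x, Φ (0, x) ∈ X') (hΦX : ∀ q, Φ q ∈ X)
    (hΦX' : ∀ s (x : X), (x : D) ∈ X' → Φ (s, x) ∈ X')
    (hΦA : ∀ s (x : X), (x : D) ∈ A → Φ (s, x) ∈ A) :
    InclusionOfPairsIsHomotopyEquiv τ (A ∩ X') X' A X := by
  refine ⟨inter_subset_right, hA, inter_subset_left, hX, fun x hx => hx.1,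
    ⟨fun x => ⟨Φ (0, x), h0 x⟩, by fun_prop⟩, fun x hx => ⟨hΦA 0 x hx, h0 x⟩, ⟨?_⟩, ⟨?_⟩⟩
  · refine
      { toFun := fun q => ⟨Φ (q.1, inclusion hX q.2), hΦX' _ _ q.2.2⟩
        continuous_toFun := ?_
        map_zero_left := fun x => rfl
        map_one_left := fun x => Subtype.ext (h1 _)
        prop' := fun t x hx => ⟨hΦA _ _ hx.1, hΦX' _ _ x.2⟩ }
    exact (hΦ.comp (continuous_fst.prodMk ((continuous_inclusion hX).comp
      continuous_snd))).subtype_mk _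
  · exact
      { toFun := fun q => ⟨Φ q, hΦX q⟩
        continuous_toFun := by fun_prop
        map_zero_left := fun x => rfl
        map_one_left := fun x => Subtype.ext (h1 _)
        prop' := fun t x hx => hΦA _ _ hx }

namespace RegularNeighborhood

variable {E : Type*} [NormedAddCommGroup E] [NormedSpace ℝ E] [FiniteDimensional ℝ E]
  {H : Type*} [TopologicalSpace H] {I : ModelWithCorners ℝ E H}
  {M : Type*} [TopologicalSpace M] [ChartedSpace H M] {B : Set M}
  {R : RegularNeighborhood I B} {Q : SqNorm R}

theorem _root_.mapsTo_of_mem_diffInv {h : M ≃ₘ⟮I, I⟯ M} (hh : h ∈ DiffInv I B) : MapsTo h B B :=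
  mapsTo_iff_image_subset.2 hh.subset

theorem _root_.mapsTo_symm_of_mem_diffInv {h : M ≃ₘ⟮I, I⟯ M} (hh : h ∈ DiffInv I B) :
    MapsTo h.symm B B := fun b hb => by
  rw [← show h '' B = B from hh] at hb
  obtain ⟨c, hc, rfl⟩ := hb
  rwa [h.symm_apply_apply]

namespace SqNorm

variable [IsManifold I ∞ M] [T2Space M]

section Single

variable {h : M ≃ₘ⟮I, I⟯ M} {ε s : ℝ}

theorem isOpen_lt (c : ℝ) : IsOpen {x | x ∈ R.carrier ∧ Q x < c} :=
  Q.contMDiffOn.continuousOn.isOpen_inter_preimage R.isOpen_carrier isOpen_Iio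

theorem deform_of_mem_base (ha : Q.IsAdapted h h.symm ε) {b : M} (hb : b ∈ B) :
    Q.deform h ε s b = h b := by
  rw [deform_of_mem (subset_tube ε hb), conj_of_mem ha.contMDiff ha.mapsTo _ hb]

theorem diffeomorph_mem_diffInv (hh : h ∈ DiffInv I B) (ha : Q.IsAdapted h h.symm ε)
    (hs : s ∈ Icc (0 : ℝ) 1) : ha.diffeomorph hs ∈ DiffInv I B := by
  have : EqOn (ha.diffeomorph hs) h B := fun b hb => deform_of_mem_base ha hb
  exact this.image_eq.trans hh

theorem diffeomorph_mem_diffFix (hh : h ∈ DiffFix I B) (ha : Q.IsAdapted h h.symm ε)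
    (hs : s ∈ Icc (0 : ℝ) 1) : ha.diffeomorph hs ∈ DiffFix I B := fun b hb =>
  (deform_of_mem_base ha hb).trans (hh b hb)

theorem diffeomorph_mem_diffInvLin (hh : h ∈ DiffInvLin R)
    (ha : Q.IsAdapted h h.symm ε) (hs : s ∈ Icc (0 : ℝ) 1) :
    ha.diffeomorph hs ∈ DiffInvLin R := by
  obtain ⟨hinv, g, hg, U, hU, hBU, hUR, hhg⟩ := hh
  refine ⟨diffeomorph_mem_diffInv hinv ha hs, g, hg, ?_⟩
  obtain ⟨c, hc, hcU⟩ := Q.exists_le_subset hU hBU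
  refine ⟨_, isOpen_lt (Q := Q) c, fun b hb => ⟨R.subset_carrier hb, by
    rwa [Q.apply_of_mem hb]⟩, fun x hx => hx.1, fun x hx => ?_⟩
  change Q.deform h ε s x = g x
  by_cases hxt : x ∈ Q.tube ε
  · rw [deform_of_mem hxt]
    refine conj_eq_of_eqOn ha.contMDiff ha.mapsTo hg hU hhg hx.1 (hcU ⟨act_mem hx.1 _, ?_⟩)
    have h1 := cutoff_mem (Q := Q) hs ε x
    rw [Q.act _ hx.1]
    have h2 : Q.cutoff ε s x ^ 2 ≤ 1 := pow_le_one₀ h1.1 h1.2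
    have h3 := Q.nonneg _ hx.1
    have h4 : Q x < c := hx.2
    nlinarith
  · rw [deform_of_notMem hxt]
    exact hhg (hcU ⟨hx.1, hx.2.le⟩)

theorem diffeomorph_zero_mem_diffInvLin (hh : h ∈ DiffInv I B) (ha : Q.IsAdapted h h.symm ε)
    (hs : s ∈ Icc (0 : ℝ) 1) (h0 : s = 0) : ha.diffeomorph hs ∈ DiffInvLin R := by
  subst h0
  refine ⟨diffeomorph_mem_diffInv hh ha hs, R.conj h 0,
    isBundleIso_conj_zero ha.contMDiff ha.mapsTo ha.contMDiff_inv ha.mapsTo_inv ha.leftInverse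
      ha.rightInverse, _, isOpen_lt (Q := Q) (ε ^ 2), fun b hb => ⟨R.subset_carrier hb, ?_⟩,
    fun x hx => hx.1, fun x hx => ?_⟩
  · rw [Q.apply_of_mem hb]
    exact pow_pos ha.pos 2
  · have h1 : Q x < ε ^ 2 := hx.2
    have hxt : x ∈ Q.tube ε := ⟨hx.1, by nlinarith [sq_nonneg ε]⟩
    change Q.deform h ε 0 x = _
    rw [deform_of_mem hxt, cutoff_of_le ha.pos 0 h1.le]

theorem diffeomorph_one (ha : Q.IsAdapted h h.symm ε) (hs : s ∈ Icc (0 : ℝ) 1) (h1 : s = 1) :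
    ha.diffeomorph hs = h := by
  subst h1
  refine Diffeomorph.ext fun x => congrFun (deform_one fun y hy => ?_) x
  have := ha.mem 1 (by simp) y hy
  rwa [act_one hy.1] at this

end Single

section Family

variable {Λ : Type*} [TopologicalSpace Λ] {h : Λ → M ≃ₘ⟮I, I⟯ M} {ε s : Λ → ℝ}

theorem continuous_weak_diffeomorph
    (hh : @Continuous _ _ _ (weakDiffTopology I M) h) (hε : Continuous ε) (hs : Continuous s)
    (ha : ∀ l, Q.IsAdapted (h l) (h l).symm (ε l)) (hs' : ∀ l, s l ∈ Icc (0 : ℝ) 1) :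
    @Continuous _ _ _ (weakDiffTopology I M) fun l => (ha l).diffeomorph (hs' l) := by
  have : LocallyCompactSpace M := Manifold.locallyCompact_of_finiteDimensional I
  refine continuous_induced_rng.2 (continuous_weakWhitneyInfty_of_smoothFamilyAt fun l x => ?_)
  exact smoothFamilyAt_deform (h := fun l => h l)
    (smoothFamilyAt_of_continuous_weakWhitneyInfty (continuous_induced_rng.1 hh))
    (fun l => (ha l).mapsTo) hε hs (fun l => (ha l).pos) hs' (fun l => (ha l).mem) l x

theorem _root_.strongDiffTopology_le_weakDiffTopology :
    strongDiffTopology I M ≤ weakDiffTopology I M :=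
  induced_mono strongWhitneyInfty_le_weakWhitneyInfty

theorem continuous_strong_diffeomorph
    (hh : @Continuous _ _ _ (strongDiffTopology I M) h) (hε : Continuous ε) (hs : Continuous s)
    (ha : ∀ l, Q.IsAdapted (h l) (h l).symm (ε l)) (hs' : ∀ l, s l ∈ Icc (0 : ℝ) 1)
    (hε1 : ∀ l, ε l ≤ 1) :
    @Continuous _ _ _ (strongDiffTopology I M) fun l => (ha l).diffeomorph (hs' l) := by
  have hw := continuous_weak_diffeomorph
    (continuous_le_rng strongDiffTopology_le_weakDiffTopology hh) hε hs ha hs'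
  refine continuous_induced_rng.2 (continuous_strongWhitneyInfty_of_eqOn_compl
    (continuous_induced_rng.1 hw) (continuous_induced_rng.1 hh) (Q.isCompact_le 2)
    fun l x hx => deform_of_notMem fun hxt => hx ⟨hxt.1, hxt.2.trans ?_⟩)
  nlinarith [hε1 l, (ha l).pos]

end Family

end SqNorm

end RegularNeighborhood

theorem theorem4p1
    {E : Type*} [NormedAddCommGroup E] [NormedSpace ℝ E] [FiniteDimensional ℝ E]
    {H : Type*} [TopologicalSpace H] (I : ModelWithCorners ℝ E H) (hI : IsHalfSpaceModel I)
    {M : Type*} [TopologicalSpace M] [T2Space M] [ParacompactSpace M]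
    [ChartedSpace H M] [IsManifold I ∞ M]
    (B : Set M) (hB : IsCompact B) (hBM : IsProperSubmanifold I B)
    (R : RegularNeighborhood I B) :
    InclusionOfPairsIsHomotopyEquiv (weakDiffTopology I M)
      (DiffFixLin R) (DiffInvLin R) (DiffFix I B) (DiffInv I B) ∧
    InclusionOfPairsIsHomotopyEquiv (strongDiffTopology I M)
      (DiffFixLin R) (DiffInvLin R) (DiffFix I B) (DiffInv I B) := by
  have : LocallyCompactSpace M := Manifold.locallyCompact_of_finiteDimensional I
  obtain ⟨Q⟩ := R.nonempty_sqNorm hB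
  have hfix : DiffFix I B ⊆ DiffInv I B := fun h hh => by
    have : EqOn h id B := hh
    exact this.image_eq.trans (image_id B)
  have hlin : DiffInvLin R ⊆ DiffInv I B := fun h hh => hh.1
  obtain ⟨ε, hε, hε'⟩ : ∃ ε : DiffInv I B → ℝ,
      @Continuous _ _ ((weakDiffTopology I M).induced (↑)) _ ε ∧
      ∀ h, ε h ≤ 1 ∧ Q.IsAdapted (h : M ≃ₘ⟮I, I⟯ M) (h : M ≃ₘ⟮I, I⟯ M).symm (ε h) := by
    let _ := weakDiffTopology I M
    refine Q.exists_isAdapted hB (Λ := DiffInv I B) (h := fun h x => (h : M ≃ₘ⟮I, I⟯ M) x)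
      (k := fun h x => (h : M ≃ₘ⟮I, I⟯ M).symm x) ?_ (fun h => mapsTo_of_mem_diffInv h.2)
      (fun h => h.1.symm.contMDiff) (fun h => mapsTo_symm_of_mem_diffInv h.2)
      (fun h => h.1.symm_apply_apply) (fun h => h.1.apply_symm_apply)
    exact smoothFamilyAt_of_continuous_weakWhitneyInfty
      (f := fun h : DiffInv I B => (h : M ≃ₘ⟮I, I⟯ M).toContMDiffMap)
      (continuous_induced_rng.1 (continuous_subtype_val (p := (· ∈ DiffInv I B))))
  have hmem : ∀ s : unitInterval, (s : ℝ) ∈ Icc (0 : ℝ) 1 := fun s => s.2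
  have key : ∀ τ : TopologicalSpace (M ≃ₘ⟮I, I⟯ M),
      @Continuous _ _ (@instTopologicalSpaceProd _ _ _ (τ.induced (↑))) τ
        (fun q : unitInterval × DiffInv I B => (hε' q.2).2.diffeomorph (hmem q.1)) →
      InclusionOfPairsIsHomotopyEquiv τ
        (DiffFixLin R) (DiffInvLin R) (DiffFix I B) (DiffInv I B) := fun τ hτ =>
    inclusionOfPairsIsHomotopyEquiv_of_deformation τ hfix hlin _ hτ
      (fun h => RegularNeighborhood.SqNorm.diffeomorph_one _ _ rfl)
      (fun h => RegularNeighborhood.SqNorm.diffeomorph_zero_mem_diffInvLin h.2 _ _ rfl)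
      (fun q => RegularNeighborhood.SqNorm.diffeomorph_mem_diffInv q.2.2 _ _)
      (fun s h hh => RegularNeighborhood.SqNorm.diffeomorph_mem_diffInvLin hh _ _)
      (fun s h hh => RegularNeighborhood.SqNorm.diffeomorph_mem_diffFix hh _ _)
  constructor
  · refine key _ ?_
    let _ := weakDiffTopology I M
    exact RegularNeighborhood.SqNorm.continuous_weak_diffeomorph
      (h := fun q : unitInterval × DiffInv I B => (q.2 : M ≃ₘ⟮I, I⟯ M))
      (ε := fun q => ε q.2) (s := fun q => q.1)
      (continuous_subtype_val.comp continuous_snd) (Continuous.comp hε continuous_snd)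
      (continuous_subtype_val.comp continuous_fst) (fun q => (hε' q.2).2) (fun q => hmem q.1)
  · refine key _ ?_
    have hε₂ := continuous_le_dom (induced_mono (g := ((↑) : DiffInv I B → M ≃ₘ⟮I, I⟯ M))
      (strongDiffTopology_le_weakDiffTopology (I := I) (M := M))) hε
    let _ := strongDiffTopology I M
    exact RegularNeighborhood.SqNorm.continuous_strong_diffeomorph
      (h := fun q : unitInterval × DiffInv I B => (q.2 : M ≃ₘ⟮I, I⟯ M))
      (ε := fun q => ε q.2) (s := fun q => q.1)
      (continuous_subtype_val.comp continuous_snd) (Continuous.comp hε₂ continuous_snd)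
      (continuous_subtype_val.comp continuous_fst) (fun q => (hε' q.2).2) (fun q => hmem q.1)
      (fun q => (hε' q.2).1)
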